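/- **Setting.** All vector fields are $C^\infty$ vector fields on the unit sphere $S^2\subset\mathbb R^3$. Such a field $v$ is of *class $PC$* if it has a cycle (non-constant periodic orbit) $\gamma$ that is parabolic of multiplicity two (its Poincaré map has the form $x\mapsto x+ax^2+\dots$ with $a\neq 0$), all singular points of $v$ and all cycles other than $\gamma$ are hyperbolic, and $v$ has no saddle connections (no orbit is an outgoing separatrix of a saddle and at the same time an incoming separatrix of the same or of another saddle). **Marked sets.** A *marked set* is a finite set $A\subset\mathbb R/\mathbb Z$ with an equivalence relation whose classes have one or two points each, such that two distinct two-point classes $\{a,b\}$, $\{c,d\}$ are never intermingled: the open arc from $a$ to $b$ contains both of $c,d$ or none of them. Two finite sets $A^+,A^-\subset\mathbb R/\mathbb Z$ are *non-synchronized* if $\#\big((A^++\alpha)\cap A^-\big)\le 1$ for every $\alpha\in\mathbb R$. **Characteristic pair.** Let $v$ be of class $PC$ with parabolic cycle $\gamma$. Take a sufficiently short cross-section $\Gamma$ to $\gamma$ with a smooth chart $x$, $x(\Gamma\cap\gamma)=0$, in which the Poincaré map is $P(x)=x+x^2+\dots$, and let $u(x)=x^2+\dots$ be the $C^\infty$ germ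 of a vector field on $(\mathbb R,0)$ whose time-one map is $P$. Choose small $b^-<0<b^+$ and put $T^\pm(b)=\int_{b^\pm}^{b}\frac{dx}{u(x)}$ for $b$ on the same side of $0$ as $b^\pm$. Let $D^\pm$ be the set of intersection points of the segment $[b^\pm,P(b^\pm))\subset\Gamma$ with the separatrices of saddles of $v$ that wind towards $\gamma$ in positive or negative time, and let $A^\pm(v)=T^\pm(D^\pm)\bmod\mathbb Z\subset\mathbb R/\mathbb Z$. Call two points of $A^\pm(v)$ equivalent if the corresponding points of $D^\pm$ lie on separatrices of the same saddle. The sets $A^+(v)$, $A^-(v)$ with these relations form the *characteristic pair* of $v$; it depends on the choice of $b^\pm$ only through additive constants. **Theorem 1.3.** Let $A^+,A^-$ be a pair of marked sets on $\mathbb R/\mathbb Z$ that is non-synchronized. Then there is a $C^\infty$ vector field $v$ of class $PC$ on $S^2$ such that, for a suitable choice of $b^\pm$, the characteristic pair of $v$ is $(A^+,A^-)$: $A^\pm(v)=A^\pm$ as sets with equivalence relations. -/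

import Mathlib

open Set Filter Topology MeasureTheory
open scoped ContDiff RealInnerProductSpace

/-! ### Vector fields on the two-sphere -/

/-- The ambient Euclidean space of the unit sphere `S²`. -/
abbrev E3 : Type := EuclideanSpace ℝ (Fin 3)

/-- The unit sphere `S² ⊆ ℝ³`. -/
abbrev S2 : Set E3 := Metric.sphere (0 : E3) 1

/-- A `C^∞` vector field on `S²`, presented as a `C^∞` map `ℝ³ → ℝ³` that is tangent to `S²` at the
points of `S²`. Every smooth vector field on `S²` extends to such a map, and all notions below
depend only on the restriction of the map to `S²`. -/
structure SphereField where
  toFun : E3 → E3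
  smooth : ContDiff ℝ ∞ toFun
  tangent : ∀ x ∈ S2, ⟪x, toFun x⟫ = 0

namespace SphereField

/-- `c` is a (complete) solution of `ẋ = V(x)` on the sphere; its range is an orbit of `V`. -/
def IsSolution (V : SphereField) (c : ℝ → E3) : Prop :=
  (∀ t, c t ∈ S2) ∧ ∀ t, HasDerivAt c (V.toFun (c t)) t

/-! ### Singular points and separatrices -/

/-- `p` is a singular point of `V`. -/
def IsSingularPoint (V : SphereField) (p : E3) : Prop :=
  p ∈ S2 ∧ V.toFun p = 0

/-- The derivative of `V` at `p`, as an endomorphism of the tangent plane `p^⊥ = T_p S²`. At a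
singular point the derivative maps the tangent plane into itself, and the orthogonal projection
only serves to restrict the codomain. -/
noncomputable def linearization (V : SphereField) (p : E3) :
    Module.End ℝ ((ℝ ∙ p)ᗮ : Submodule ℝ E3) :=
  (((ℝ ∙ p)ᗮ).orthogonalProjectionOnto ∘L fderiv ℝ V.toFun p ∘L ((ℝ ∙ p)ᗮ).subtypeL).toLinearMap

/-- A singular point is hyperbolic if no complex eigenvalue of the linearization is purely
imaginary or zero. -/
def IsHyperbolicPoint (V : SphereField) (p : E3) : Prop :=
  V.IsSingularPoint p ∧
    ∀ z : ℂ, Polynomial.aeval z (V.linearization p).charpoly = 0 → z.re ≠ 0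

/-- A hyperbolic saddle: one eigenvalue is negative and the other one is positive. -/
def IsSaddle (V : SphereField) (p : E3) : Prop :=
  V.IsSingularPoint p ∧ ∃ a b : ℝ, a < 0 ∧ 0 < b ∧
    (V.linearization p).HasEigenvalue a ∧ (V.linearization p).HasEigenvalue b

/-- `c` parametrizes a stable (incoming) separatrix of `p`. -/
def IsStableSeparatrix (V : SphereField) (p : E3) (c : ℝ → E3) : Prop :=
  V.IsSolution c ∧ (∀ t, c t ≠ p) ∧ Tendsto c atTop (𝓝 p)

/-- `c` parametrizes an unstable (outgoing) separatrix of `p`. -/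
def IsUnstableSeparatrix (V : SphereField) (p : E3) (c : ℝ → E3) : Prop :=
  V.IsSolution c ∧ (∀ t, c t ≠ p) ∧ Tendsto c atBot (𝓝 p)

/-- `c` parametrizes a separatrix of `p`. -/
def IsSeparatrix (V : SphereField) (p : E3) (c : ℝ → E3) : Prop :=
  V.IsStableSeparatrix p c ∨ V.IsUnstableSeparatrix p c

/-- `V` has a saddle connection: a common separatrix of two saddles, or a separatrix loop (`p = q`).
-/
def HasSaddleConnection (V : SphereField) : Prop :=
  ∃ p q c, V.IsSaddle p ∧ V.IsSaddle q ∧ V.IsUnstableSeparatrix p c ∧ V.IsStableSeparatrix q c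

/-! ### Closed orbits and Poincaré maps -/

/-- `γ` is a cycle of `V`: the orbit of a non-constant periodic solution. -/
def IsCycle (V : SphereField) (γ : Set E3) : Prop :=
  ∃ c : ℝ → E3, ∃ T : ℝ, V.IsSolution c ∧ 0 < T ∧ (∀ t, c (t + T) = c t) ∧
    V.toFun (c 0) ≠ 0 ∧ γ = range c

/-- A cross-section to `γ`, with a chart on it: a smooth simple compact arc
`σ : [-δ, δ] → S²`, transversal to `V`, which meets `γ` at the point `σ 0` only. The chart `x` is
the inverse of `σ`. -/
structure CrossSection (V : SphereField) (γ : Set E3) where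
  σ : ℝ → E3
  δ : ℝ
  δ_pos : 0 < δ
  smooth : ContDiff ℝ ∞ σ
  mem_sphere : ∀ s ∈ Icc (-δ) δ, σ s ∈ S2
  injOn : InjOn σ (Icc (-δ) δ)
  transversal : ∀ s ∈ Icc (-δ) δ, LinearIndependent ℝ ![deriv σ s, V.toFun (σ s)]
  mem_cycle_iff : ∀ s ∈ Icc (-δ) δ, (σ s ∈ γ ↔ s = 0)

/-- The positive semi-orbit of `x` meets the set `G`, for the first time after time `0`, at `y`. -/
def FirstReturn (V : SphereField) (G : Set E3) (x y : E3) : Prop :=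
  ∃ c : ℝ → E3, ∃ τ : ℝ, V.IsSolution c ∧ 0 < τ ∧ c 0 = x ∧ c τ = y ∧ y ∈ G ∧
    ∀ t ∈ Ioo 0 τ, c t ∉ G

/-- `P : (-η, η) → [-δ, δ]` is a representative of the germ of the Poincaré map of `γ`, written in
the chart of the cross-section `S`. -/
structure IsPoincareMap {V : SphereField} {γ : Set E3} (S : V.CrossSection γ) (P : ℝ → ℝ) (η : ℝ) :
    Prop where
  pos : 0 < η
  le : η ≤ S.δ
  smooth : ContDiffOn ℝ ∞ P (Ioo (-η) η)
  mapsTo : MapsTo P (Ioo (-η) η) (Icc (-S.δ) S.δ)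
  firstReturn : ∀ s ∈ Ioo (-η) η,
    V.FirstReturn (S.σ '' Icc (-S.δ) S.δ) (S.σ s) (S.σ (P s))

/-- The cycle `γ` is hyperbolic: its multiplier has absolute value different from `1`. -/
def IsHyperbolicCycle (V : SphereField) (γ : Set E3) : Prop :=
  V.IsCycle γ ∧ ∃ (S : V.CrossSection γ) (P : ℝ → ℝ) (η : ℝ),
    IsPoincareMap S P η ∧ |deriv P 0| ≠ 1

/-- The cycle `γ` is parabolic of multiplicity two: its Poincaré map has the form
`x ↦ x + a x² + …` with `a ≠ 0`. -/
def IsParabolicCycle (V : SphereField) (γ : Set E3) : Prop :=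
  V.IsCycle γ ∧ ∃ (S : V.CrossSection γ) (P : ℝ → ℝ) (η : ℝ),
    IsPoincareMap S P η ∧ deriv P 0 = 1 ∧ iteratedDeriv 2 P 0 ≠ 0

/-- `V` is a vector field of class `PC`, with parabolic cycle `γ`. -/
structure IsClassPC (V : SphereField) (γ : Set E3) : Prop where
  parabolic : V.IsParabolicCycle γ
  hyperbolic_points : ∀ p, V.IsSingularPoint p → V.IsHyperbolicPoint p
  hyperbolic_cycles : ∀ γ', V.IsCycle γ' → γ' ≠ γ → V.IsHyperbolicCycle γ'
  no_saddle_connection : ¬ V.HasSaddleConnection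

end SphereField

/-! ### Marked finite sets on the coordinate circle `ℝ/ℤ` -/

/-- A marked set: a finite subset of `ℝ/ℤ` with a proper equivalence relation, that is, each class
consists of one or two points, and distinct two-point classes `{a, b}`, `{c, d}` are not
intermingled: the open arc from `a` to `b` contains both of `c`, `d` or none of them. -/
structure MarkedSet where
  carrier : Finset UnitAddCircle
  rel : Setoid carrier
  card_class_le : ∀ a, {b | rel a b}.ncard ≤ 2
  not_intermingled : ∀ a b c d : carrier, rel a b → a ≠ b → rel c d → c ≠ d → ¬ rel a c →
    (sbtw (a : UnitAddCircle) c b ↔ sbtw (a : UnitAddCircle) d b)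

/-- Two subsets of `ℝ/ℤ` are non-synchronized: any shift of the first one has at most one point in
common with the second one. -/
def NonSynchronized (A B : Set UnitAddCircle) : Prop :=
  ∀ α : ℝ, (((fun a : UnitAddCircle => a + (α : UnitAddCircle)) '' A) ∩ B).encard ≤ 1

/-! ### Characteristic pairs -/

namespace SphereField

/-- The orbit of the solution `c` winds towards the cycle `γ` in positive or in negative time. -/
def WindsToward (c : ℝ → E3) (γ : Set E3) : Prop :=
  Disjoint (range c) γ ∧
    (Tendsto (fun t => Metric.infDist (c t) γ) atTop (𝓝 0) ∨
      Tendsto (fun t => Metric.infDist (c t) γ) atBot (𝓝 0))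

/-- The point `x` lies on a separatrix of `p` that winds towards `γ`. -/
def OnWindingSeparatrix (V : SphereField) (γ : Set E3) (p x : E3) : Prop :=
  ∃ c, V.IsSeparatrix p c ∧ WindsToward c γ ∧ x ∈ range c

/-- The smooth vector field `u(x) = x² + …` on `(-δ, δ)`, without zeros except for `0`, is a
generator of `P`: the restriction of `P` to `(-η, η)` is the time-one map of `ẋ = u(x)`. -/
structure IsGenerator (u P : ℝ → ℝ) (δ η : ℝ) : Prop where
  smooth : ContDiffOn ℝ ∞ u (Ioo (-δ) δ)
  zero : u 0 = 0
  deriv_zero : deriv u 0 = 0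
  deriv_two : iteratedDeriv 2 u 0 = 2
  pos : ∀ x ∈ Ioo (-δ) δ, x ≠ 0 → 0 < u x
  time_one : ∀ s ∈ Ioo (-η) η, ∃ y : ℝ → ℝ, y 0 = s ∧ y 1 = P s ∧
    ∀ t ∈ Icc (0 : ℝ) 1, y t ∈ Ioo (-δ) δ ∧ HasDerivWithinAt y (u (y t)) (Icc 0 1) t

/-- The time function `T(s) = ∫_b^s dx / u(x)`. -/
noncomputable def timeFunction (u : ℝ → ℝ) (b s : ℝ) : ℝ := ∫ x in b..s, 1 / u x

/-- The set of the intersection points of the segment `[b, P(b))` of the cross-section with the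
separatrices of saddles that wind towards `γ` (in the chart of the cross-section). -/
def windingPoints {V : SphereField} {γ : Set E3} (S : V.CrossSection γ) (P : ℝ → ℝ) (b : ℝ) :
    Set ℝ :=
  {s | s ∈ Ico b (P b) ∧ ∃ p, V.IsSaddle p ∧ V.OnWindingSeparatrix γ p (S.σ s)}

/-- The marked set `A` is the image under the time function, modulo `ℤ`, of the set of the
intersection points with `[b, P(b))`; two points of `A` are equivalent iff they come from
separatrices of the same saddle. -/
def IsCharacteristicSet {V : SphereField} {γ : Set E3} (S : V.CrossSection γ) (P u : ℝ → ℝ) (b : ℝ)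
    (A : MarkedSet) : Prop :=
  (A.carrier : Set UnitAddCircle) =
      (fun s => (timeFunction u b s : UnitAddCircle)) '' windingPoints S P b ∧
    ∀ a a' : A.carrier, A.rel a a' ↔
      ∃ s ∈ windingPoints S P b, ∃ s' ∈ windingPoints S P b,
        (timeFunction u b s : UnitAddCircle) = a ∧ (timeFunction u b s' : UnitAddCircle) = a' ∧
          ∃ p, V.IsSaddle p ∧ V.OnWindingSeparatrix γ p (S.σ s) ∧
            V.OnWindingSeparatrix γ p (S.σ s')

/-- `(Ap, Am)` is the characteristic pair `A^±` of the field `V` with parabolic cycle `γ`, for some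
admissible choice of a cross-section with a chart in which the Poincaré map is `x + x² + …`, and of
base points `bm < 0 < bp`. -/
def IsCharacteristicPair (V : SphereField) (γ : Set E3) (Ap Am : MarkedSet) : Prop :=
  ∃ (S : V.CrossSection γ) (P u : ℝ → ℝ) (η bp bm : ℝ),
    IsPoincareMap S P η ∧ deriv P 0 = 1 ∧ iteratedDeriv 2 P 0 = 2 ∧
    IsGenerator u P S.δ η ∧
    bp ∈ Ioo 0 η ∧ bm ∈ Ioo (-η) 0 ∧
    IsCharacteristicSet S P u bp Ap ∧ IsCharacteristicSet S P u bm Am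

end SphereField

/-! Let the height on the sphere obey $\dot z=z^2(1-z^2)$ and let the longitude move with speed
$2\pi(1-z^2)$. The equator is then a cycle, and the longitude divided by $2\pi$ plus $1/z$ is
constant along the other orbits. On the meridian of longitude zero, charted by $z$, the Poincaré map
is exactly $z/(1-z)$, the time-one map of $u=x^2$. The time function is $1/b-1/s$, so the class of
$1/s$ modulo $1$ is both the label of the orbit and, up to sign and a constant, the coordinate in
which characteristic sets are measured.

In the coordinates `flowPt (a, t)`, orbit label and time, this field is the constant field $(0,1)$.
The problem becomes planar: change $(0,1)$ inside a compact part of $0<a<1$, $t\ge 0$ so that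
saddles appear whose incoming separatrices rise along prescribed vertical lines. The times $t\ge0$
lie above the height $1/2$, so the cycle, the cross-section and the return map are not affected.

The brick is a box with the field $(\pm x\,b(x)c(y),\,1-b(x)c(y))$, where $b$ is a plateau and $c$
takes the value one at two levels. With the plus sign the lower zero is a saddle entered along the
axis and the upper one is a source. With the minus sign the upper zero is a saddle whose two stable
separatrices, followed backwards, leave the box through its bottom along symmetric lines; the lower
zero is a sink. The function $y\pm\log|x|$ grows at unit speed: this excludes cycles and drives the
separatrices out of the box (`IsPlateau.exists_separatrix`). Stretching $x$ puts them at any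
prescribed distance (`exists_plateau_separatrix`).

One box per class is centred at the midpoint of the class, and the boxes are stacked in time by
increasing width. As classes are not intermingled, lines that lead to a wide box miss the narrower
boxes below it (`exists_planarModel`). A stable separatrix either comes from the source of its own
box or descends to $t=-\infty$, so there are no saddle connections.

Planar functions are lifted to smooth functions on space (`liftFun_contDiff`). A half-turn reverses
the unperturbed field, hence a second model can be placed on the lower hemisphere, and
`modelField_turn` transfers all statements there. Cutting each circle outside its marked set turns
cyclic conditions into conditions on $(0,1)$; `isClassPC_model`, `isCharacteristicSet_upper` and
`isCharacteristicSet_lower` conclude. -/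

/-! ### Autonomous differential equations -/

section AutonomousODE

variable {E : Type*} [NormedAddCommGroup E] [NormedSpace ℝ E]

theorem ode_solution_unique {f : E → E} {K : NNReal} (hf : LipschitzWith K f) {c d : ℝ → E}
    (hc : ∀ t, HasDerivAt c (f (c t)) t) (hd : ∀ t, HasDerivAt d (f (d t)) t) {t₀ : ℝ}
    (h : c t₀ = d t₀) : c = d :=
  ODE_solution_unique_univ (v := fun _ => f) (s := fun _ => univ) (K := K) (t₀ := t₀)
    (fun _ => hf.lipschitzOnWith) (fun t => ⟨hc t, mem_univ _⟩) (fun t => ⟨hd t, mem_univ _⟩) h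

theorem hasDerivAt_time_shift {f : E → E} {c : ℝ → E} (hc : ∀ t, HasDerivAt c (f (c t)) t)
    (r t : ℝ) : HasDerivAt (fun t => c (t + r)) (f (c (t + r))) t := by
  simpa using (hc (t + r)).comp_add_const t r

theorem ode_solution_shift {f : E → E} {K : NNReal} (hf : LipschitzWith K f) {c d : ℝ → E}
    (hc : ∀ t, HasDerivAt c (f (c t)) t) (hd : ∀ t, HasDerivAt d (f (d t)) t) {t₁ t₂ : ℝ}
    (h : c t₁ = d t₂) (t : ℝ) : c t = d (t - t₁ + t₂) := by
  have h1 := ode_solution_unique hf hc (hasDerivAt_time_shift hd (t₂ - t₁)) (t₀ := t₁)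
    (by simpa using h)
  have := congrFun h1 t
  rw [this]
  ring_nf

theorem ode_solution_const {f : E → E} {K : NNReal} (hf : LipschitzWith K f) {c : ℝ → E}
    (hc : ∀ t, HasDerivAt c (f (c t)) t) {t₀ : ℝ} (h : f (c t₀) = 0) (t : ℝ) : c t = c t₀ := by
  have h1 := ode_solution_unique hf hc (d := fun _ => c t₀)
    (fun t => by rw [h]; exact hasDerivAt_const t _) (t₀ := t₀) rfl
  exact congrFun h1 t

/-- Bounded, globally Lipschitz vector fields are complete. -/
theorem exists_ode_solution [CompleteSpace E] {f : E → E} {K : NNReal} (hf : LipschitzWith K f)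
    {M : NNReal} (hM : ∀ x, ‖f x‖ ≤ M) (x₀ : E) :
    ∃ c : ℝ → E, c 0 = x₀ ∧ ∀ t, HasDerivAt c (f (c t)) t := by
  have key : ∀ n : ℕ, ∃ c : ℝ → E, c 0 = x₀ ∧
      ∀ t ∈ Icc (-(n + 1 : ℝ)) (n + 1), HasDerivWithinAt c (f (c t)) (Icc (-(n + 1 : ℝ)) (n + 1)) t := by
    intro n
    have h0 : (0 : ℝ) ∈ Icc (-(n + 1 : ℝ)) (n + 1) := by
      constructor <;> [(have : (0:ℝ) ≤ n := n.cast_nonneg; linarith); positivity]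
    -- The radius `M * (n + 1)` is the distance that speed `M` covers in half of the interval, so
    -- the Picard–Lindelöf condition holds for every `n`.
    have hpl : IsPicardLindelof (fun _ => f) (tmin := -(n + 1 : ℝ)) (tmax := n + 1) ⟨0, h0⟩ x₀
        (M * (n + 1)) 0 M K :=
      { lipschitzOnWith := fun _ _ => hf.lipschitzOnWith
        continuousOn := fun _ _ => continuousOn_const
        norm_le := fun _ _ x _ => hM x
        mul_max_le := by simp }
    exact hpl.exists_eq_forall_mem_Icc_hasDerivWithinAt₀
  choose c hc0 hc using key
  have hIoo : ∀ n : ℕ, ∀ t ∈ Ioo (-(n + 1 : ℝ)) (n + 1), HasDerivAt (c n) (f (c n t)) t :=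
    fun n t ht => (hc n t (Ioo_subset_Icc_self ht)).hasDerivAt (Icc_mem_nhds ht.1 ht.2)
  have hcons : ∀ n m : ℕ, n ≤ m → ∀ t ∈ Ioo (-(n + 1 : ℝ)) (n + 1), c n t = c m t := by
    intro n m hnm t ht
    have hn : (0 : ℝ) ≤ n := n.cast_nonneg
    have hnm' : (n : ℝ) ≤ m := by exact_mod_cast hnm
    refine ODE_solution_unique_of_mem_Ioo (v := fun _ => f) (s := fun _ => univ) (K := K)
      (t₀ := 0) (a := -(n + 1 : ℝ)) (b := n + 1)
      (fun _ _ => hf.lipschitzOnWith) ⟨by linarith, by linarith⟩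
      (fun t ht => ⟨hIoo n t ht, mem_univ _⟩)
      (fun t ht => ⟨hIoo m t ⟨by linarith [ht.1], by linarith [ht.2]⟩, mem_univ _⟩)
      ((hc0 n).trans (hc0 m).symm) ht
  have hmem : ∀ t : ℝ, ∀ n : ℕ, ⌈|t|⌉₊ ≤ n → t ∈ Ioo (-(n + 1 : ℝ)) (n + 1) := by
    intro t n hn
    have h1 : |t| ≤ n := (Nat.le_ceil _).trans (by exact_mod_cast hn)
    rw [abs_le] at h1
    constructor <;> linarith [h1.1, h1.2]
  -- The local solutions are glued: nearby times use indices at most one larger, and `hcons`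
  -- identifies the values.
  refine ⟨fun t => c ⌈|t|⌉₊ t, hc0 _, fun t => ?_⟩
  have h1 := hIoo (⌈|t|⌉₊ + 1) t (hmem t _ (Nat.le_succ _))
  have h2 : c (⌈|t|⌉₊ + 1) t = c ⌈|t|⌉₊ t :=
    (hcons _ _ (Nat.le_succ _) t (hmem t _ le_rfl)).symm
  rw [h2] at h1
  refine h1.congr_of_eventuallyEq ?_
  have h3 : ∀ᶠ s in 𝓝 t, |s| < |t| + 1 := continuous_abs.continuousAt.eventually_lt_const (by simp)
  filter_upwards [h3] with s hs
  have h4 : ⌈|s|⌉₊ ≤ ⌈|t|⌉₊ + 1 := by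
    rw [Nat.ceil_le]
    push_cast
    linarith [Nat.le_ceil |t|]
  exact hcons _ _ h4 s (hmem s _ le_rfl)

end AutonomousODE

/-! ### Scalar differential inequalities -/

/-- A level that is crossed only upwards is not crossed back. -/
theorem level_barrier {y y' : ℝ → ℝ} (hy : ∀ t, HasDerivAt y (y' t) t) {e : ℝ}
    (h : ∀ t, y t = e → 0 < y' t) {t₀ t : ℝ} (ht : t₀ ≤ t) (h0 : e ≤ y t₀) : e ≤ y t := by
  have := image_le_of_deriv_right_lt_deriv_boundary (f := fun t => -y t) (f' := fun t => -y' t)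
    (a := t₀) (b := t) (fun s _ => (hy s).neg.continuousAt.continuousWithinAt)
    (fun s _ => (hy s).neg.hasDerivWithinAt) (B := fun _ => -e) (B' := fun _ => 0)
    (by simpa using h0) (fun s => hasDerivAt_const s _)
    (fun s _ hs => by simpa using h s (by simpa using hs)) ⟨ht, le_rfl⟩
  simpa using this

/-- A solution of an expanding linear equation which tends to zero vanishes. -/
theorem eq_zero_of_tendsto_of_expanding {f g : ℝ → ℝ} {t₀ : ℝ}
    (hf : ∀ t ≥ t₀, HasDerivAt f (g t * f t) t) (hg : ∀ t ≥ t₀, 0 ≤ g t)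
    (hlim : Tendsto f atTop (𝓝 0)) {t : ℝ} (ht : t₀ ≤ t) : f t = 0 := by
  -- The square has derivative `2 * g * f ^ 2`, so it is nondecreasing, and its limit zero bounds it
  -- from above.
  have hmono : MonotoneOn (fun t => f t ^ 2) (Ici t₀) := by
    apply monotoneOn_of_deriv_nonneg (convex_Ici t₀)
    · exact fun s hs => ((hf s hs).pow 2).continuousAt.continuousWithinAt
    · intro s hs
      rw [interior_Ici] at hs
      exact ((hf s hs.le).pow 2).differentiableAt.differentiableWithinAt
    · intro s hs
      rw [interior_Ici] at hs
      have h1 := ((hf s (le_of_lt hs)).pow 2).deriv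
      have h2 : deriv (fun t => f t ^ 2) s = _ := h1
      rw [h2]
      have := hg s (le_of_lt hs)
      have h3 : 0 ≤ g s * (f s) ^ 2 := by positivity
      norm_num
      nlinarith
  have h2 : Tendsto (fun t => f t ^ 2) atTop (𝓝 0) := by simpa using hlim.pow 2
  have h3 : f t ^ 2 ≤ 0 := by
    apply ge_of_tendsto h2
    filter_upwards [eventually_ge_atTop t] with s hs
    exact hmono ht (ht.trans hs : t₀ ≤ s) hs
  exact pow_eq_zero_iff (two_ne_zero) |>.1 (le_antisymm h3 (sq_nonneg _))

/-- A periodic differentiable function has a critical point. -/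
theorem exists_deriv_eq_zero_of_periodic {y y' : ℝ → ℝ} {T : ℝ} (hT : 0 < T)
    (hy : ∀ t, HasDerivAt y (y' t) t) (hper : y T = y 0) : ∃ t, y' t = 0 := by
  obtain ⟨t, -, h⟩ := exists_hasDerivAt_eq_zero hT
    (fun t _ => (hy t).continuousAt.continuousWithinAt) hper.symm (fun t _ => hy t)
  exact ⟨t, h⟩

/-! ### One-sided uniqueness of solutions. -/

section HalfLine

variable {E : Type*} [NormedAddCommGroup E] [NormedSpace ℝ E]

theorem ode_solution_unique_right {f : E → E} {K : NNReal} (hf : LipschitzWith K f) {c d : ℝ → E}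
    {t₀ : ℝ} (hc : ∀ t ≥ t₀, HasDerivAt c (f (c t)) t) (hd : ∀ t ≥ t₀, HasDerivAt d (f (d t)) t)
    (h : c t₀ = d t₀) {t : ℝ} (ht : t₀ ≤ t) : c t = d t :=
  ODE_solution_unique_of_mem_Icc_right (v := fun _ => f) (s := fun _ => univ) (K := K)
    (fun _ _ => hf.lipschitzOnWith)
    (fun s hs => (hc s hs.1).continuousAt.continuousWithinAt)
    (fun s hs => (hc s hs.1).hasDerivWithinAt) (fun _ _ => mem_univ _)
    (fun s hs => (hd s hs.1).continuousAt.continuousWithinAt)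
    (fun s hs => (hd s hs.1).hasDerivWithinAt) (fun _ _ => mem_univ _) h ⟨ht, le_rfl⟩

theorem ode_solution_unique_left {f : E → E} {K : NNReal} (hf : LipschitzWith K f) {c d : ℝ → E}
    {t₀ : ℝ} (hc : ∀ t ≤ t₀, HasDerivAt c (f (c t)) t) (hd : ∀ t ≤ t₀, HasDerivAt d (f (d t)) t)
    (h : c t₀ = d t₀) {t : ℝ} (ht : t ≤ t₀) : c t = d t :=
  ODE_solution_unique_of_mem_Icc_left (v := fun _ => f) (s := fun _ => univ) (K := K)
    (fun _ _ => hf.lipschitzOnWith)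
    (fun s hs => (hc s hs.2).continuousAt.continuousWithinAt)
    (fun s hs => (hc s hs.2).hasDerivWithinAt) (fun _ _ => mem_univ _)
    (fun s hs => (hd s hs.2).continuousAt.continuousWithinAt)
    (fun s hs => (hd s hs.2).hasDerivWithinAt) (fun _ _ => mem_univ _) h ⟨le_rfl, ht⟩

end HalfLine

/-! ### Compactly supported perturbations of the constant planar field `(0, 1)` -/

/-- The planar field `(κ, 1 - β)`. -/
def planarField (κ β : ℝ × ℝ → ℝ) (q : ℝ × ℝ) : ℝ × ℝ := (κ q, 1 - β q)

theorem planarField_lipschitz {κ β : ℝ × ℝ → ℝ} (hκ : ContDiff ℝ ∞ κ) (hβ : ContDiff ℝ ∞ β)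
    {k : Set (ℝ × ℝ)} (hk : IsCompact k) (h : ∀ q ∉ k, κ q = 0 ∧ β q = 0) :
    ∃ K : NNReal, LipschitzWith K (planarField κ β) := by
  have hs : HasCompactSupport (fun q => (κ q, -β q)) :=
    HasCompactSupport.intro hk (fun q hq => by simp [h q hq])
  obtain ⟨K, hK⟩ := ContDiff.lipschitzWith_of_hasCompactSupport hs (hκ.prodMk hβ.neg) (by simp)
  refine ⟨K, ?_⟩
  have : planarField κ β = fun q => (κ q, -β q) + (0, 1) := by
    ext q <;> simp [planarField]; ring
  rw [this]
  intro p q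
  simpa only [edist_add_right] using hK p q

theorem planarField_bounded {κ β : ℝ × ℝ → ℝ} (hκ : ContDiff ℝ ∞ κ) (hβ : ContDiff ℝ ∞ β)
    {k : Set (ℝ × ℝ)} (hk : IsCompact k) (h : ∀ q ∉ k, κ q = 0 ∧ β q = 0) :
    ∃ M : NNReal, ∀ q, ‖planarField κ β q‖ ≤ M := by
  have hs : HasCompactSupport (fun q => (κ q, -β q)) :=
    HasCompactSupport.intro hk (fun q hq => by simp [h q hq])
  obtain ⟨C, hC⟩ := hs.exists_bound_of_continuous (hκ.continuous.prodMk hβ.continuous.neg)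
  have hC0 : 0 ≤ C := (norm_nonneg _).trans (hC 0)
  refine ⟨⟨C + 1, by linarith⟩, fun q => ?_⟩
  have : planarField κ β q = (κ q, -β q) + (0, 1) := by
    ext <;> simp [planarField]; ring
  rw [this]
  refine (norm_add_le _ _).trans ?_
  change _ ≤ C + 1
  have h2 : ‖((0 : ℝ), (1 : ℝ))‖ = 1 := by simp
  rw [h2]
  linarith [hC q]

theorem planarField_complete {κ β : ℝ × ℝ → ℝ} (hκ : ContDiff ℝ ∞ κ) (hβ : ContDiff ℝ ∞ β)
    {k : Set (ℝ × ℝ)} (hk : IsCompact k) (h : ∀ q ∉ k, κ q = 0 ∧ β q = 0) (q : ℝ × ℝ) :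
    ∃ c : ℝ → ℝ × ℝ, c 0 = q ∧ ∀ t, HasDerivAt c (planarField κ β (c t)) t := by
  obtain ⟨K, hK⟩ := planarField_lipschitz hκ hβ hk h
  obtain ⟨M, hM⟩ := planarField_bounded hκ hβ hk h
  exact exists_ode_solution hK hM q

/-! ### The longitudinal profile -/

/-- A cut-off function, equal to `1` for `|y - 1/2| ≤ 3/20` and to `0` for `7/40 ≤ |y - 1/2|`. -/
noncomputable def profileCutoff : ContDiffBump (1 / 2 : ℝ) := ⟨3 / 20, 7 / 40, by norm_num, by norm_num⟩

/-- A bump which takes the value `1` at `3/8` and `5/8` only, transversally. -/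
noncomputable def profile (y : ℝ) : ℝ := profileCutoff y * (2 - 64 * (y - 1 / 2) ^ 2)

theorem profile_contDiff : ContDiff ℝ ∞ profile :=
  profileCutoff.contDiff.mul (by fun_prop)

theorem profile_eq_zero {y : ℝ} (h : 7 / 40 ≤ |y - 1 / 2|) : profile y = 0 := by
  have : profileCutoff y = 0 := profileCutoff.zero_of_le_dist (by rw [Real.dist_eq]; exact h)
  simp [profile, this]

theorem profile_eq_zero_of_le {y : ℝ} (h : y ≤ 1 / 4) : profile y = 0 :=
  profile_eq_zero (by rw [le_abs]; right; linarith)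

theorem profile_eq_zero_of_ge {y : ℝ} (h : 3 / 4 ≤ y) : profile y = 0 :=
  profile_eq_zero (by rw [le_abs]; left; linarith)

theorem profile_eq_of_abs_le {y : ℝ} (h : |y - 1 / 2| ≤ 3 / 20) :
    profile y = 2 - 64 * (y - 1 / 2) ^ 2 := by
  have : profileCutoff y = 1 :=
    profileCutoff.one_of_mem_closedBall (by simpa [Real.dist_eq, profileCutoff] using h)
  simp [profile, this]

/-- At the edge of the cut-off the quadratic factor is `2 - 64 * (7 / 40) ^ 2 = 1 / 25`, hence it is
positive wherever the cut-off does not vanish. -/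
theorem profile_nonneg (y : ℝ) : 0 ≤ profile y := by
  by_cases h : 7 / 40 ≤ |y - 1 / 2|
  · rw [profile_eq_zero h]
  · apply mul_nonneg profileCutoff.nonneg
    push Not at h
    rw [abs_lt] at h
    nlinarith

theorem profile_le (y : ℝ) :
    profile y ≤ max 0 (2 - 64 * (y - 1 / 2) ^ 2) := by
  have h1 := profileCutoff.le_one (x := y)
  have h0 := profileCutoff.nonneg (x := y)
  rcases le_total 0 (2 - 64 * (y - 1 / 2) ^ 2) with h2 | h2
  · exact le_max_of_le_right (by unfold profile; nlinarith)
  · exact le_max_of_le_left (by unfold profile; nlinarith)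

theorem profile_lt_one {y : ℝ} (h : 1 / 8 < |y - 1 / 2|) : profile y < 1 := by
  refine (profile_le y).trans_lt (max_lt one_pos ?_)
  have : (1 / 8 : ℝ) ^ 2 < |y - 1 / 2| ^ 2 := by gcongr
  rw [sq_abs] at this
  linarith

theorem profile_three_eighths : profile (3 / 8) = 1 := by
  rw [profile_eq_of_abs_le (by rw [abs_le]; norm_num)]; norm_num

theorem profile_five_eighths : profile (5 / 8) = 1 := by
  rw [profile_eq_of_abs_le (by rw [abs_le]; norm_num)]; norm_num

theorem profile_eq_near {y : ℝ} (h : |y - 1 / 2| < 3 / 20) :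
    profile =ᶠ[𝓝 y] fun y => 2 - 64 * (y - 1 / 2) ^ 2 := by
  have : ∀ᶠ z in 𝓝 y, |z - 1 / 2| < 3 / 20 :=
    (by fun_prop : Continuous fun z : ℝ => |z - 1 / 2|).continuousAt.eventually_lt_const h
  filter_upwards [this] with z hz using profile_eq_of_abs_le hz.le

theorem profile_hasDerivAt {y : ℝ} (h : |y - 1 / 2| < 3 / 20) :
    HasDerivAt profile (-128 * (y - 1 / 2)) y := by
  have h1 : HasDerivAt (fun y : ℝ => 2 - 64 * (y - 1 / 2) ^ 2) (-128 * (y - 1 / 2)) y := by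
    have := ((((hasDerivAt_id' y).sub_const (1 / 2)).pow 2).const_mul 64).const_sub 2
    exact this.congr_deriv (by norm_num; ring)
  exact h1.congr_of_eventuallyEq (profile_eq_near h)

theorem profile_one_lt_iff {y : ℝ} : 1 ≤ profile y ↔ |y - 1 / 2| ≤ 1 / 8 := by
  constructor
  · intro h
    by_contra! h'
    exact absurd (profile_lt_one h') (not_lt.2 h)
  · intro h
    rw [profile_eq_of_abs_le (by linarith)]
    have : |y - 1 / 2| ^ 2 ≤ (1 / 8 : ℝ) ^ 2 := by gcongr
    rw [sq_abs] at this
    linarith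

theorem profile_eq_one_iff {y : ℝ} : profile y = 1 ↔ y = 3 / 8 ∨ y = 5 / 8 := by
  constructor
  · intro h
    have h1 := profile_one_lt_iff.1 h.ge
    rw [profile_eq_of_abs_le (by linarith)] at h
    have : (y - 3 / 8) * (y - 5 / 8) = 0 := by linarith
    rcases mul_eq_zero.1 this with h | h
    · left; linarith
    · right; linarith
  · rintro (rfl | rfl)
    · exact profile_three_eighths
    · exact profile_five_eighths

/-- One minus the parabola is `64 * (3/8 - y) * (5/8 - y)`, and the last factor is at least `1/4`;
where the parabola is negative, the right side is at least `1` and the left side is at most `3/4`.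
This linear rate gives exponential convergence to `3/8`. -/
theorem profile_speed {y : ℝ} (h0 : 0 ≤ y) (h : y ≤ 3 / 8) : 2 * (3 / 8 - y) ≤ 1 - profile y := by
  rcases h.eq_or_lt with rfl | h
  · rw [profile_three_eighths]; norm_num
  have := profile_le y
  rcases le_total 0 (2 - 64 * (y - 1 / 2) ^ 2) with h2 | h2
  · rw [max_eq_right h2] at this
    nlinarith
  · rw [max_eq_left h2] at this
    linarith

theorem profile_lipschitz : ∃ K : NNReal, LipschitzWith K (fun y => 1 - profile y) := by
  have hs : HasCompactSupport profile :=
    HasCompactSupport.intro (isCompact_Icc (a := (1 / 4 : ℝ)) (b := 3 / 4)) (fun y hy => by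
      by_contra hne
      refine hy ⟨?_, ?_⟩ <;> by_contra! hlt
      · exact hne (profile_eq_zero_of_le hlt.le)
      · exact hne (profile_eq_zero_of_ge hlt.le))
  obtain ⟨K, hK⟩ := ContDiff.lipschitzWith_of_hasCompactSupport hs profile_contDiff (by simp)
  refine ⟨K, fun x y => ?_⟩
  simpa using hK x y

theorem exists_axis_solution (y₀ : ℝ) :
    ∃ y : ℝ → ℝ, y 0 = y₀ ∧ ∀ t, HasDerivAt y (1 - profile (y t)) t := by
  obtain ⟨K, hK⟩ := profile_lipschitz
  refine exists_ode_solution hK (M := 2) (fun y => ?_) y₀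
  have h0 := profile_nonneg y
  have h2 : profile y ≤ 2 := by
    unfold profile
    have h1 := profileCutoff.le_one (x := y)
    have h0 := profileCutoff.nonneg (x := y)
    nlinarith [sq_nonneg (y - 1 / 2)]
  rw [Real.norm_eq_abs, abs_le]
  constructor
  · push_cast; linarith
  · push_cast; linarith

/-- The solution on the axis which enters at `y = 0` tends to the equilibrium `3/8`. -/
theorem axis_solution_entering {y : ℝ → ℝ} (hy : ∀ t, HasDerivAt y (1 - profile (y t)) t)
    (h0 : y 0 = 0) : (∀ t ≤ 0, y t = t) ∧ (∀ t ≥ 0, 0 ≤ y t ∧ y t < 3 / 8) ∧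
      Tendsto y atTop (𝓝 (3 / 8)) := by
  obtain ⟨K, hK⟩ := profile_lipschitz
  have hne : ∀ t, y t ≠ 3 / 8 := by
    intro t ht
    have := ode_solution_const hK hy (t₀ := t) (by simp [ht, profile_three_eighths]) 0
    rw [h0, ht] at this
    norm_num at this
  have hcont : Continuous y := continuous_iff_continuousAt.2 fun t => (hy t).continuousAt
  have hlt : ∀ t, y t < 3 / 8 := by
    intro t
    by_contra! h
    have : (3 / 8 : ℝ) ∈ y '' univ := by
      apply (isPreconnected_univ).intermediate_value (mem_univ 0) (mem_univ t) hcont.continuousOn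
      exact ⟨by rw [h0]; norm_num, h⟩
    obtain ⟨s, -, hs⟩ := this
    exact hne s hs
  have hge : ∀ t ≥ 0, 0 ≤ y t := fun t ht => level_barrier hy (e := 0)
    (fun s hs => by rw [hs, profile_eq_zero_of_le (by norm_num)]; norm_num) ht h0.ge
  refine ⟨fun t ht => ?_, fun t ht => ⟨hge t ht, hlt t⟩, ?_⟩
  · refine ode_solution_unique_left hK (t₀ := 0) (fun s _ => hy s) (d := fun t => t)
      (fun s hs => ?_) h0 ht
    rw [profile_eq_zero_of_le (by linarith)]
    simpa using hasDerivAt_id' s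
  -- By `profile_speed` the gap to the equilibrium decays at rate at least two, which the
  -- exponential factor compensates.
  · have hanti : AntitoneOn (fun t => (3 / 8 - y t) * Real.exp (2 * t)) (Ici 0) := by
      have hd : ∀ t, HasDerivAt (fun t => (3 / 8 - y t) * Real.exp (2 * t))
          (-(1 - profile (y t)) * Real.exp (2 * t) + (3 / 8 - y t) * (Real.exp (2 * t) * 2)) t := by
        intro t
        have h2 : HasDerivAt (fun t : ℝ => Real.exp (2 * t)) (Real.exp (2 * t) * 2) t := by
          simpa using ((hasDerivAt_id t).const_mul 2).exp
        exact ((hy t).const_sub (3 / 8)).mul h2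
      apply antitoneOn_of_deriv_nonpos (convex_Ici 0)
      · exact fun s _ => (hd s).continuousAt.continuousWithinAt
      · exact fun s _ => (hd s).differentiableAt.differentiableWithinAt
      · intro s hs
        rw [interior_Ici] at hs
        rw [(hd s).deriv]
        have h1 := profile_speed (hge s (le_of_lt hs)) (hlt s).le
        have h2 := Real.exp_pos (2 * s)
        nlinarith
    have hbound : ∀ t ≥ 0, 3 / 8 - y t ≤ 3 / 8 * Real.exp (-(2 * t)) := by
      intro t ht
      have h1 := hanti (mem_Ici.2 le_rfl) (mem_Ici.2 ht) ht
      simp only [h0, mul_zero, Real.exp_zero, sub_zero, mul_one] at h1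
      rw [Real.exp_neg]
      have h2 := Real.exp_pos (2 * t)
      rw [← div_eq_mul_inv, le_div_iff₀ h2]
      exact h1
    have hz : Tendsto (fun t : ℝ => 3 / 8 - 3 / 8 * Real.exp (-(2 * t))) atTop (𝓝 (3 / 8)) := by
      have : Tendsto (fun t : ℝ => Real.exp (-(2 * t))) atTop (𝓝 0) :=
        Real.tendsto_exp_neg_atTop_nhds_zero.comp
          (tendsto_id.const_mul_atTop (by norm_num : (0 : ℝ) < 2))
      simpa using (this.const_mul (3 / 8)).const_sub (3 / 8)
    refine tendsto_of_tendsto_of_tendsto_of_le_of_le' hz tendsto_const_nhds ?_ ?_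
    · filter_upwards [eventually_ge_atTop 0] with t ht
      linarith [hbound t ht]
    · exact Eventually.of_forall fun t => (hlt t).le

/-- Both end points are equilibria; by uniqueness they are never reached, and continuity keeps the
solution between them. -/
theorem axis_solution_inside {y : ℝ → ℝ} (hy : ∀ t, HasDerivAt y (1 - profile (y t)) t)
    (h0 : y 0 ∈ Ioo (3 / 8 : ℝ) (5 / 8)) (t : ℝ) : y t ∈ Ioo (3 / 8 : ℝ) (5 / 8) := by
  obtain ⟨K, hK⟩ := profile_lipschitz
  have hcont : Continuous y := continuous_iff_continuousAt.2 fun t => (hy t).continuousAt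
  have hne : ∀ t, y t ≠ 3 / 8 ∧ y t ≠ 5 / 8 := by
    intro t
    constructor <;> intro ht <;>
    · have := ode_solution_const hK hy (t₀ := t)
        (by simp [ht, profile_three_eighths, profile_five_eighths]) 0
      rw [this, ht] at h0
      norm_num at h0
  constructor
  · by_contra! h
    obtain ⟨s, -, hs⟩ := (isPreconnected_univ).intermediate_value (mem_univ t) (mem_univ 0)
      hcont.continuousOn ⟨h, h0.1.le⟩
    exact (hne s).1 hs
  · by_contra! h
    obtain ⟨s, -, hs⟩ := (isPreconnected_univ).intermediate_value (mem_univ 0) (mem_univ t)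
      hcont.continuousOn ⟨h0.2.le, h⟩
    exact (hne s).2 hs

/-! ### The separatrix which enters a standard box -/

/-- `b` is an even smooth plateau: it is `1` for `|x| ≤ ρ` and `0` for `R ≤ |x|`. -/
structure IsPlateau (b : ℝ → ℝ) (ρ R : ℝ) : Prop where
  smooth : ContDiff ℝ ∞ b
  nonneg : ∀ x, 0 ≤ b x
  le_one : ∀ x, b x ≤ 1
  eq_one : ∀ x, |x| ≤ ρ → b x = 1
  eq_zero : ∀ x, R ≤ |x| → b x = 0
  even : ∀ x, b (-x) = b x
  pos : 0 < ρ
  lt : ρ < R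

/-- The right stable separatrix of the saddle `(0, 5/8)` of the field
`(-x b(x) c(y), 1 - b(x) c(y))`, where `c` is the profile. It enters along `x = w`. -/
structure IsEnteringSeparatrix (b : ℝ → ℝ) (ρ w : ℝ) (x y : ℝ → ℝ) (τ : ℝ) : Prop where
  deriv_x : ∀ t, HasDerivAt x (-x t * (b (x t) * profile (y t))) t
  deriv_y : ∀ t, HasDerivAt y (1 - b (x t) * profile (y t)) t
  before : ∀ t ≤ 0, x t = w ∧ y t = t
  mem : ∀ t ≥ 0, y t ∈ Icc (0 : ℝ) 1
  nonneg : 0 ≤ τ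
  after : ∀ t ≥ τ, x t = ρ * Real.exp (-(t - τ)) ∧ y t = 5 / 8

/-- The separatrix is followed backwards from `(ρ, 5/8)`, a point of the horizontal segment that
runs into the saddle. In the past `X` stays between `ρ` and `R`, while `Y - log X` grows at unit
speed; hence `Y` was zero at some moment, and `w` is the value of `X` then. Before that the field is
vertical. -/
theorem IsPlateau.exists_separatrix {b : ℝ → ℝ} {ρ R : ℝ} (hb : IsPlateau b ρ R) :
    ∃ (w : ℝ) (x y : ℝ → ℝ) (τ : ℝ), ρ ≤ w ∧ w < R ∧ IsEnteringSeparatrix b ρ w x y τ := by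
  set κ : ℝ × ℝ → ℝ := fun q => -q.1 * (b q.1 * profile q.2) with hκdef
  set β : ℝ × ℝ → ℝ := fun q => b q.1 * profile q.2 with hβdef
  have hβ : ContDiff ℝ ∞ β :=
    (hb.smooth.comp contDiff_fst).mul (profile_contDiff.comp contDiff_snd)
  have hκ : ContDiff ℝ ∞ κ := contDiff_fst.neg.mul hβ
  have hsupp : ∀ q ∉ Icc (-R) R ×ˢ Icc (1 / 4 : ℝ) (3 / 4), κ q = 0 ∧ β q = 0 := by
    intro q hq
    have : β q = 0 := by
      by_contra hne
      have hne' : b q.1 ≠ 0 ∧ profile q.2 ≠ 0 := mul_ne_zero_iff.1 hne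
      refine hq ⟨?_, ?_, ?_⟩
      · refine abs_le.1 ?_
        by_contra! h
        exact hne'.1 (hb.eq_zero _ h.le)
      · by_contra! h
        exact hne'.2 (profile_eq_zero_of_le h.le)
      · by_contra! h
        exact hne'.2 (profile_eq_zero_of_ge h.le)
    exact ⟨by simp only [hκdef]; simp only [hβdef] at this; rw [this, mul_zero], this⟩
  obtain ⟨K, hK⟩ := planarField_lipschitz hκ hβ (isCompact_Icc.prod isCompact_Icc) hsupp
  obtain ⟨c, hc0, hc⟩ := planarField_complete hκ hβ (isCompact_Icc.prod isCompact_Icc) hsupp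
    (ρ, 5 / 8)
  set X : ℝ → ℝ := fun t => (c t).1 with hX
  set Y : ℝ → ℝ := fun t => (c t).2 with hY
  have hX' : ∀ t, HasDerivAt X (-X t * (b (X t) * profile (Y t))) t := fun t =>
    (hasFDerivAt_fst.comp_hasDerivAt t (hc t) :)
  have hY' : ∀ t, HasDerivAt Y (1 - b (X t) * profile (Y t)) t := fun t =>
    (hasFDerivAt_snd.comp_hasDerivAt t (hc t) :)
  have hX0 : X 0 = ρ := by simp [hX, hc0]
  have hY0 : Y 0 = 5 / 8 := by simp [hY, hc0]
  have hXc : Continuous X := continuous_iff_continuousAt.2 fun t => (hX' t).continuousAt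
  have hYc : Continuous Y := continuous_iff_continuousAt.2 fun t => (hY' t).continuousAt
  have hρ := hb.pos
  have hρR := hb.lt
  -- the outer boundary is not reached
  have hXR : ∀ t, X t < R := by
    intro t
    by_contra! h
    have h1 := ode_solution_unique hK hc (d := fun s => (X t, Y t + (s - t))) (t₀ := t)
      (fun s => by
        have : planarField κ β (X t, Y t + (s - t)) = (0, 1) := by
          simp [planarField, hκdef, hβdef, hb.eq_zero (X t) (h.trans (le_abs_self _))]
        rw [this]
        exact (hasDerivAt_const s _).prodMk (((hasDerivAt_id s).sub_const t).const_add _))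
      (by simp [hX, hY])
    have h2 : X 0 = X t := by
      have := congrArg Prod.fst (congrFun h1 0)
      simpa using this
    linarith
  -- the first coordinate is at least `ρ` in the past
  have hXsq : ∀ t ≤ 0, ρ ^ 2 ≤ X t ^ 2 := by
    -- The square is monotone whatever the sign of `X`, which is not yet known to be positive.
    have hanti : Antitone fun t => X t ^ 2 := by
      apply antitone_of_deriv_nonpos
      · exact fun t => ((hX' t).pow 2).differentiableAt
      · intro t
        have h2 : deriv (fun t => X t ^ 2) t = _ := ((hX' t).pow 2).deriv
        rw [h2]
        have h3 : 0 ≤ X t ^ 2 * (b (X t) * profile (Y t)) :=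
          mul_nonneg (sq_nonneg _) (mul_nonneg (hb.nonneg _) (profile_nonneg _))
        norm_num
        nlinarith
    intro t ht
    have := hanti ht
    simpa [hX0] using this
  have hXpos : ∀ t ≤ 0, 0 < X t := by
    intro t ht
    by_contra! h
    obtain ⟨s, hs, hs0⟩ := (isPreconnected_Iic (a := (0 : ℝ))).intermediate_value (mem_Iic.2 ht)
      (mem_Iic.2 le_rfl) hXc.continuousOn ⟨h, by rw [hX0]; exact hρ.le⟩
    have := hXsq s hs
    rw [hs0] at this
    nlinarith
  have hXρ : ∀ t ≤ 0, ρ ≤ X t := fun t ht =>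
    le_of_sq_le_sq (hXsq t ht) (hXpos t ht).le
  -- the Lyapunov function
  have hL : ∀ t ≤ 0, Y t - Real.log (X t) = 5 / 8 - Real.log ρ + t := by
    intro t ht
    have hd : ∀ s ≤ 0, HasDerivAt (fun s => Y s - Real.log (X s) - s) 0 s := by
      intro s hs
      have h1 := ((hY' s).sub ((hX' s).log (hXpos s hs).ne')).sub (hasDerivAt_id s)
      refine h1.congr_deriv ?_
      have := (hXpos s hs).ne'
      field_simp
      ring
    have hcst : (fun s => Y s - Real.log (X s) - s) t = (fun s => Y s - Real.log (X s) - s) 0 := by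
      apply (convex_Iic (0 : ℝ)).is_const_of_fderivWithin_eq_zero (𝕜 := ℝ)
        (fun s hs => (hd s hs).differentiableAt.differentiableWithinAt) ?_ (mem_Iic.2 ht)
        (mem_Iic.2 le_rfl)
      intro s hs
      rw [((hd s hs).hasDerivWithinAt.hasFDerivWithinAt).fderivWithin
        (uniqueDiffOn_Iic 0 s hs)]
      ext
      simp
    simp only [hX0, hY0] at hcst
    linarith
  obtain ⟨t₁, ht₁, hYt₁⟩ : ∃ t₁ ≤ 0, Y t₁ = 0 := by
    -- At this moment `hL` reads `Y s = log (X s) - log R`, which is negative.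
    set s := -(5 / 8 + Real.log R - Real.log ρ) with hs
    have hlog : Real.log ρ < Real.log R := Real.log_lt_log hρ hρR
    have hs0 : s ≤ 0 := by rw [hs]; linarith
    have h1 : Y s ≤ 0 := by
      have := hL s hs0
      have h2 : Real.log (X s) < Real.log R := Real.log_lt_log (hXpos s hs0) (hXR s)
      linarith
    obtain ⟨t₁, ht, h⟩ := (isPreconnected_Iic (a := (0 : ℝ))).intermediate_value (mem_Iic.2 hs0)
      (mem_Iic.2 le_rfl) hYc.continuousOn ⟨h1, by rw [hY0]; norm_num⟩
    exact ⟨t₁, ht, h⟩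
  -- the explicit final part
  have hafter : ∀ t ≥ 0, c t = (ρ * Real.exp (-t), 5 / 8) := by
    intro t ht
    refine ode_solution_unique_right hK (fun s _ => hc s) (d := fun t => (ρ * Real.exp (-t), 5 / 8))
      (fun s hs => ?_) (by simp [hc0]) ht
    have hb1 : b (ρ * Real.exp (-s)) = 1 := by
      apply hb.eq_one
      rw [abs_of_nonneg (by positivity)]
      have : Real.exp (-s) ≤ 1 := Real.exp_le_one_iff.2 (by linarith)
      nlinarith
    have : planarField κ β (ρ * Real.exp (-s), 5 / 8) = (ρ * -Real.exp (-s), 0) := by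
      simp [planarField, hκdef, hβdef, hb1, profile_five_eighths]
    rw [this]
    refine HasDerivAt.prodMk ?_ (hasDerivAt_const s _)
    have := ((hasDerivAt_id s).neg.exp).const_mul ρ
    simpa using this
  have hYbar0 : ∀ s, Y s = 0 → 0 < 1 - b (X s) * profile (Y s) := fun s hs => by
    rw [hs, profile_eq_zero_of_le (by norm_num)]; norm_num
  have hYbar1 : ∀ s, Y s = 1 → 0 < 1 - b (X s) * profile (Y s) := fun s hs => by
    rw [hs, profile_eq_zero_of_ge (by norm_num)]; norm_num
  -- Time is counted from the crossing of the bottom, so the arrival at `(ρ, 5/8)` takes place at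
  -- `-t₁`.
  refine ⟨X t₁, fun t => X (t + t₁), fun t => Y (t + t₁), -t₁, hXρ t₁ ht₁, hXR t₁, ?_⟩
  refine ⟨fun t => (hX' (t + t₁)).comp_add_const t t₁, fun t => (hY' (t + t₁)).comp_add_const t t₁,
    fun t ht => ?_, fun t ht => ⟨?_, ?_⟩, by linarith, fun t ht => ?_⟩
  · have h1 : c (t + t₁) = (X t₁, (t + t₁) - t₁) := by
      refine ode_solution_unique_left hK (t₀ := t₁) (fun s _ => hc s)
        (d := fun s => (X t₁, s - t₁)) (fun s hs => ?_)
        (by ext <;> simp [hX]; exact hYt₁) (by linarith)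
      have : planarField κ β (X t₁, s - t₁) = (0, 1) := by
        simp [planarField, hκdef, hβdef, profile_eq_zero_of_le (y := s - t₁) (by linarith)]
      rw [this]
      exact (hasDerivAt_const s _).prodMk ((hasDerivAt_id s).sub_const t₁)
    constructor
    · simp [hX, h1]
    · simp [hY, h1]
  · exact level_barrier hY' hYbar0 (t₀ := t₁) (by linarith) hYt₁.ge
  · by_contra! h
    rcases le_total 0 (t + t₁) with h1 | h1
    · have : Y (t + t₁) = 5 / 8 := by simp [hY, hafter _ h1]
      linarith
    · have := level_barrier hY' hYbar1 h1 h.le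
      rw [hY0] at this
      norm_num at this
  · have h1 := hafter (t + t₁) (by linarith)
    constructor
    · simp only [hX, h1]
      ring_nf
    · simp [hY, h1]

theorem IsPlateau.rescale {b : ℝ → ℝ} {ρ R s : ℝ} (hb : IsPlateau b ρ R) (hs : 0 < s) :
    IsPlateau (fun x => b (x / s)) (ρ * s) (R * s) where
  smooth := hb.smooth.comp (by fun_prop)
  nonneg x := hb.nonneg _
  le_one x := hb.le_one _
  eq_one x hx := hb.eq_one _ (by rwa [abs_div, abs_of_pos hs, div_le_iff₀ hs])
  eq_zero x hx := hb.eq_zero _ (by rwa [abs_div, abs_of_pos hs, le_div_iff₀ hs])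
  even x := by rw [neg_div, hb.even]
  pos := mul_pos hb.pos hs
  lt := mul_lt_mul_of_pos_right hb.lt hs

/-- The transversal component is `x` times a function of `x / s` and `y`, and the longitudinal one
is a function of `x / s` and `y`, so stretching `x` by `s` sends solutions to solutions. -/
theorem IsEnteringSeparatrix.rescale {b : ℝ → ℝ} {ρ w τ s : ℝ} {x y : ℝ → ℝ}
    (h : IsEnteringSeparatrix b ρ w x y τ) (hs : 0 < s) :
    IsEnteringSeparatrix (fun x => b (x / s)) (ρ * s) (w * s) (fun t => x t * s) y τ where
  deriv_x t := by
    have := (h.deriv_x t).mul_const s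
    refine this.congr_deriv ?_
    rw [mul_div_cancel_right₀ _ hs.ne']
    ring
  deriv_y t := by
    have := h.deriv_y t
    rwa [mul_div_cancel_right₀ _ hs.ne']
  before t ht := ⟨by rw [(h.before t ht).1], (h.before t ht).2⟩
  mem := h.mem
  nonneg := h.nonneg
  after t ht := ⟨by rw [(h.after t ht).1]; ring, (h.after t ht).2⟩

theorem exists_plateau {ρ R : ℝ} (hρ : 0 < ρ) (h : ρ < R) : ∃ b, IsPlateau b ρ R := by
  let f : ContDiffBump (0 : ℝ) := ⟨ρ, R, hρ, h⟩
  exact ⟨f, f.contDiff, fun x => f.nonneg, fun x => f.le_one,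
    fun x hx => f.one_of_mem_closedBall (by simpa using hx),
    fun x hx => f.zero_of_le_dist (by simpa using hx), fun x => f.neg x, hρ, h⟩

/-- For every `r > 0` there is a plateau supported in a given neighbourhood of `[-r, r]`, for which
the separatrix enters along `x = r`. -/
theorem exists_plateau_separatrix {r R : ℝ} (hr : 0 < r) (hR : r < R) :
    ∃ (b : ℝ → ℝ) (ρ R' : ℝ) (x y : ℝ → ℝ) (τ : ℝ), R' ≤ R ∧ IsPlateau b ρ R' ∧
      IsEnteringSeparatrix b ρ r x y τ := by
  obtain ⟨b, hb⟩ := exists_plateau hr hR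
  obtain ⟨w, x, y, τ, hw, hwR, h⟩ := hb.exists_separatrix
  have hw0 : 0 < w := hr.trans_le hw
  -- A plateau with inner radius `r` has its separatrix at some `w ≥ r`; the contraction by `r / w ≤
  -- 1` moves it to `r` and does not enlarge the support.
  have hs : 0 < r / w := div_pos hr hw0
  refine ⟨_, _, _, fun t => x t * (r / w), y, τ, ?_, hb.rescale hs, ?_⟩
  · have : r / w ≤ 1 := (div_le_one hw0).2 hw
    nlinarith
  · have := h.rescale hs
    rwa [mul_div_cancel₀ _ hw0.ne'] at this

/-! ### Planar models -/

/-- `c` is a solution of the planar field `(κ, 1 - β)`. -/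
def IsPlanarSolution (κ β : ℝ × ℝ → ℝ) (c : ℝ → ℝ × ℝ) : Prop :=
  ∀ t, HasDerivAt c (planarField κ β (c t)) t

/-- A compactly supported perturbation of `(0, 1)` in the strip `0 < a < 1` with hyperbolic
singular points, without cycles and saddle connections, whose saddles have stable separatrices that
enter along prescribed lines. -/
structure PlanarModel where
  κ : ℝ × ℝ → ℝ
  β : ℝ × ℝ → ℝ
  κ_smooth : ContDiff ℝ ∞ κ
  β_smooth : ContDiff ℝ ∞ β
  margin : ℝ
  height : ℝ
  margin_pos : 0 < margin
  supp : ∀ q : ℝ × ℝ, q ∉ Icc margin (1 - margin) ×ˢ Icc 0 height → κ q = 0 ∧ β q = 0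
  nonpos : ∀ q : ℝ × ℝ, q.2 ≤ 0 → κ q = 0 ∧ β q = 0
  ι : Type
  saddle : ι → ℝ × ℝ
  label : ι → Set ℝ
  saddle_singular : ∀ i, κ (saddle i) = 0 ∧ β (saddle i) = 1
  -- The linearization of `(κ, 1 - β)` at a zero is diagonal with the eigenvalues `l₁` and `l₂`; the
  -- minus sign before `l₂` comes from `1 - β`.
  singular : ∀ q, κ q = 0 → β q = 1 → ∃ l₁ l₂ : ℝ, l₁ ≠ 0 ∧ l₂ ≠ 0 ∧
    HasDerivAt (fun s => κ (q.1 + s, q.2)) l₁ 0 ∧ HasDerivAt (fun s => κ (q.1, q.2 + s)) 0 0 ∧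
    HasDerivAt (fun s => β (q.1 + s, q.2)) 0 0 ∧ HasDerivAt (fun s => β (q.1, q.2 + s)) (-l₂) 0 ∧
    (l₁ * l₂ < 0 ↔ ∃ i, q = saddle i)
  no_periodic : ∀ c, IsPlanarSolution κ β c → ∀ T, 0 < T → c T = c 0 →
    κ (c 0) = 0 ∧ β (c 0) = 1
  entering : ∀ i, ∀ a ∈ label i, ∃ c, IsPlanarSolution κ β c ∧ (∀ t ≤ 0, c t = (a, t)) ∧
    Tendsto c atTop (𝓝 (saddle i))
  label_unique : ∀ i c, IsPlanarSolution κ β c → Tendsto c atTop (𝓝 (saddle i)) →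
    ∀ t, (c t).2 ≤ 0 → (c t).1 ∈ label i
  no_connection : ∀ i j c, IsPlanarSolution κ β c → Tendsto c atTop (𝓝 (saddle i)) →
    Tendsto c atBot (𝓝 (saddle j)) → ∃ t, c t = saddle i

/-! ### Systems of boxes -/

/-- A finite sequence of boxes. The `k`-th box lies in the slab `k ≤ t ≤ k + 1`; its saddle has one
entering separatrix, on the line `a = center k`, if `radius k = 0`, and two of them, on the lines
`a = center k ± radius k`, if `0 < radius k`. These lines avoid all the previous boxes. -/
structure BoxSystem where
  N : ℕ
  center : Fin N → ℝ
  radius : Fin N → ℝ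
  bump : Fin N → ℝ → ℝ
  inner : Fin N → ℝ
  outer : Fin N → ℝ
  radius_nonneg : ∀ k, 0 ≤ radius k
  plateau : ∀ k, IsPlateau (bump k) (inner k) (outer k)
  mem_unit : ∀ k, 0 < center k - outer k ∧ center k + outer k < 1
  avoid : ∀ j k, j < k → outer j ≤ |center k + radius k - center j| ∧
    outer j ≤ |center k - radius k - center j|
  separatrix : ∀ k, 0 < radius k → ∃ x y τ,
    IsEnteringSeparatrix (bump k) (inner k) (radius k) x y τ

namespace BoxSystem

variable (S : BoxSystem)

/-- The lower level of a slab. -/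
def lev (k : Fin S.N) : ℝ := ((k : ℕ) : ℝ)

theorem lev_nonneg (k : Fin S.N) : 0 ≤ S.lev k := Nat.cast_nonneg _

theorem lev_add_one_le {j k : Fin S.N} (h : j < k) : S.lev j + 1 ≤ S.lev k := by
  unfold lev
  exact_mod_cast (h : (j : ℕ) < k)

open Classical in
/-- The sign of the transversal eigenvalues in a box. -/
noncomputable def sgn (k : Fin S.N) : ℝ := if S.radius k = 0 then 1 else -1

theorem sgn_mul_self (k : Fin S.N) : S.sgn k * S.sgn k = 1 := by
  unfold sgn; split_ifs <;> norm_num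

noncomputable def box (k : Fin S.N) (q : ℝ × ℝ) : ℝ :=
  S.bump k (q.1 - S.center k) * profile (q.2 - S.lev k)

noncomputable def β (q : ℝ × ℝ) : ℝ := ∑ k, S.box k q

noncomputable def κ (q : ℝ × ℝ) : ℝ := ∑ k, S.sgn k * (q.1 - S.center k) * S.box k q

theorem box_contDiff (k : Fin S.N) : ContDiff ℝ ∞ (S.box k) :=
  ((S.plateau k).smooth.comp (contDiff_fst.sub contDiff_const)).mul
    (profile_contDiff.comp (contDiff_snd.sub contDiff_const))

theorem β_contDiff : ContDiff ℝ ∞ S.β := ContDiff.sum fun k _ => S.box_contDiff k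

theorem κ_contDiff : ContDiff ℝ ∞ S.κ := ContDiff.sum fun k _ =>
  (contDiff_const.mul (contDiff_fst.sub contDiff_const)).mul (S.box_contDiff k)

theorem box_eq_zero_of_le {k : Fin S.N} {q : ℝ × ℝ} (h : q.2 ≤ S.lev k) : S.box k q = 0 := by
  unfold box; rw [profile_eq_zero_of_le (by linarith), mul_zero]

theorem box_eq_zero_of_ge {k : Fin S.N} {q : ℝ × ℝ} (h : S.lev k + 1 ≤ q.2) : S.box k q = 0 := by
  unfold box; rw [profile_eq_zero_of_ge (by linarith), mul_zero]

theorem box_eq_zero_of_outer {k : Fin S.N} {q : ℝ × ℝ} (h : S.outer k ≤ |q.1 - S.center k|) :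
    S.box k q = 0 := by
  unfold box; rw [(S.plateau k).eq_zero _ h, zero_mul]

theorem fields_eq_zero {q : ℝ × ℝ} (h : ∀ k, S.box k q = 0) : S.κ q = 0 ∧ S.β q = 0 := by
  simp [κ, β, h]

/-- Distinct slabs meet at most in a common end level, where the profiles vanish, so only one box is
active in a slab. -/
theorem fields_slab {k : Fin S.N} {q : ℝ × ℝ} (h : S.lev k ≤ q.2) (h' : q.2 ≤ S.lev k + 1) :
    S.κ q = S.sgn k * (q.1 - S.center k) * S.box k q ∧ S.β q = S.box k q := by
  have hz : ∀ j, j ≠ k → S.box j q = 0 := by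
    intro j hj
    rcases lt_or_gt_of_ne hj with hlt | hgt
    · exact S.box_eq_zero_of_ge ((S.lev_add_one_le hlt).trans h)
    · exact S.box_eq_zero_of_le (h'.trans (S.lev_add_one_le hgt))
  constructor
  · exact Finset.sum_eq_single k (fun j _ hj => by rw [hz j hj, mul_zero]) (by simp)
  · exact Finset.sum_eq_single k (fun j _ hj => hz j hj) (by simp)

theorem exists_slab {q : ℝ × ℝ} (h : S.β q ≠ 0) :
    ∃ k, S.box k q ≠ 0 ∧ S.lev k < q.2 ∧ q.2 < S.lev k + 1 := by
  obtain ⟨k, -, hk⟩ := Finset.exists_ne_zero_of_sum_ne_zero h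
  refine ⟨k, hk, ?_, ?_⟩ <;> by_contra! hlt
  · exact hk (S.box_eq_zero_of_le hlt)
  · exact hk (S.box_eq_zero_of_ge hlt)

theorem β_lev (k : Fin S.N) {q : ℝ × ℝ} (h : q.2 = S.lev k) : S.β q = 0 := by
  rw [(S.fields_slab h.ge (by linarith)).2, S.box_eq_zero_of_le h.le]

theorem β_lev_add_one (k : Fin S.N) {q : ℝ × ℝ} (h : q.2 = S.lev k + 1) : S.β q = 0 := by
  rw [(S.fields_slab (by linarith) h.le).2, S.box_eq_zero_of_ge h.ge]

theorem fields_nonpos {q : ℝ × ℝ} (h : q.2 ≤ 0) : S.κ q = 0 ∧ S.β q = 0 :=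
  S.fields_eq_zero fun k => S.box_eq_zero_of_le (h.trans (S.lev_nonneg k))

/-- Below its own slab such a line can meet only earlier boxes, which it misses by `avoid`; the
later boxes are higher. -/
theorem fields_entering (k : Fin S.N) {q : ℝ × ℝ} (h : q.2 ≤ S.lev k)
    (h1 : q.1 = S.center k + S.radius k ∨ q.1 = S.center k - S.radius k) :
    S.κ q = 0 ∧ S.β q = 0 := by
  refine S.fields_eq_zero fun j => ?_
  rcases lt_or_ge j k with hlt | hge
  · apply S.box_eq_zero_of_outer
    rcases h1 with h1 | h1 <;> rw [h1]
    · exact (S.avoid j k hlt).1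
    · exact (S.avoid j k hlt).2
  · apply S.box_eq_zero_of_le
    rcases hge.eq_or_lt with rfl | hlt
    · exact h
    · linarith [S.lev_add_one_le hlt]

theorem exists_margin : ∃ m > 0, ∀ q : ℝ × ℝ, q ∉ Icc m (1 - m) ×ˢ Icc 0 (S.N : ℝ) →
    S.κ q = 0 ∧ S.β q = 0 := by
  have h1 : ∀ᶠ m : ℝ in 𝓝[>] 0, ∀ k, m ≤ S.center k - S.outer k ∧ m ≤ 1 - (S.center k + S.outer k) := by
    rw [eventually_all]
    intro k
    have h1 : ∀ᶠ m : ℝ in 𝓝[>] 0, m < S.center k - S.outer k :=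
      (eventually_lt_nhds (S.mem_unit k).1).filter_mono nhdsWithin_le_nhds
    have h2 : ∀ᶠ m : ℝ in 𝓝[>] 0, m < 1 - (S.center k + S.outer k) :=
      (eventually_lt_nhds (by linarith [(S.mem_unit k).2])).filter_mono nhdsWithin_le_nhds
    filter_upwards [h1, h2] with m h1 h2 using ⟨h1.le, h2.le⟩
  obtain ⟨m, hm, hm0⟩ := (h1.and self_mem_nhdsWithin).exists
  refine ⟨m, hm0, fun q hq => S.fields_eq_zero fun k => ?_⟩
  by_contra hne
  refine hq ⟨?_, ?_⟩
  · have : |q.1 - S.center k| < S.outer k := by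
      by_contra! h
      exact hne (S.box_eq_zero_of_outer h)
    rw [abs_lt] at this
    constructor
    · linarith [(hm k).1]
    · linarith [(hm k).2]
  · constructor
    · by_contra! h
      exact hne (S.box_eq_zero_of_le (h.le.trans (S.lev_nonneg k)))
    · by_contra! h
      refine hne (S.box_eq_zero_of_ge (le_trans ?_ h.le))
      unfold lev
      exact_mod_cast k.2

theorem exists_lipschitz : ∃ K : NNReal, LipschitzWith K (planarField S.κ S.β) := by
  obtain ⟨m, -, hm⟩ := S.exists_margin
  exact planarField_lipschitz S.κ_contDiff S.β_contDiff (isCompact_Icc.prod isCompact_Icc) hm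

/-! #### Singular points -/

-- For `radius k = 0` the transversal direction expands, so the saddle is the zero at `3/8`, where
-- the longitudinal direction contracts. Otherwise the transversal direction contracts, and the
-- saddle is the zero at `5/8`.
open Classical in
noncomputable def saddle (k : Fin S.N) : ℝ × ℝ :=
  (S.center k, S.lev k + if S.radius k = 0 then 3 / 8 else 5 / 8)

theorem bump_zero (k : Fin S.N) : S.bump k 0 = 1 :=
  (S.plateau k).eq_one 0 (by simpa using (S.plateau k).pos.le)

theorem saddle_slab (k : Fin S.N) : S.lev k < (S.saddle k).2 ∧ (S.saddle k).2 < S.lev k + 1 := by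
  unfold saddle; dsimp only; split_ifs <;> constructor <;> linarith

theorem fields_axis (k : Fin S.N) {y : ℝ} (h : 0 ≤ y) (h' : y ≤ 1) :
    S.κ (S.center k, S.lev k + y) = 0 ∧ S.β (S.center k, S.lev k + y) = profile y := by
  obtain ⟨h1, h2⟩ := S.fields_slab (k := k) (q := (S.center k, S.lev k + y)) (by simpa using h)
    (by simpa using h')
  simp [h1, h2, box, S.bump_zero]

theorem saddle_singular (k : Fin S.N) : S.κ (S.saddle k) = 0 ∧ S.β (S.saddle k) = 1 := by
  unfold saddle
  split_ifs
  · obtain ⟨h1, h2⟩ := S.fields_axis k (y := 3 / 8) (by norm_num) (by norm_num)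
    exact ⟨h1, h2.trans profile_three_eighths⟩
  · obtain ⟨h1, h2⟩ := S.fields_axis k (y := 5 / 8) (by norm_num) (by norm_num)
    exact ⟨h1, h2.trans profile_five_eighths⟩

theorem slab_unique {j k : Fin S.N} {y : ℝ} (hj : S.lev j < y) (hj' : y < S.lev j + 1)
    (hk : S.lev k < y) (hk' : y < S.lev k + 1) : j = k := by
  rcases lt_trichotomy j k with h | h | h
  · linarith [S.lev_add_one_le h]
  · exact h
  · linarith [S.lev_add_one_le h]

theorem exists_of_singular {q : ℝ × ℝ} (hκ : S.κ q = 0) (hβ : S.β q = 1) :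
    ∃ k, q.1 = S.center k ∧ (q.2 = S.lev k + 3 / 8 ∨ q.2 = S.lev k + 5 / 8) := by
  obtain ⟨k, -, h1, h2⟩ := S.exists_slab (q := q) (by rw [hβ]; norm_num)
  obtain ⟨e1, e2⟩ := S.fields_slab h1.le h2.le
  rw [e2] at hβ
  rw [e1, hβ, mul_one] at hκ
  have hs : S.sgn k ≠ 0 := fun h => by have := S.sgn_mul_self k; rw [h] at this; norm_num at this
  have hx : q.1 - S.center k = 0 := (mul_eq_zero.1 hκ).resolve_left hs
  rw [box, hx, S.bump_zero, one_mul, profile_eq_one_iff] at hβ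
  refine ⟨k, by linarith, ?_⟩
  rcases hβ with h | h
  · left; linarith
  · right; linarith

/-- Near a zero the bump equals one, so the variables separate up to the factor `x - center`: the
transversal eigenvalue is `sgn k`, the longitudinal one is `-16` at the level `3/8` and `16` at the
level `5/8`. -/
theorem singular {q : ℝ × ℝ} (hκ : S.κ q = 0) (hβ : S.β q = 1) : ∃ l₁ l₂ : ℝ, l₁ ≠ 0 ∧ l₂ ≠ 0 ∧
    HasDerivAt (fun s => S.κ (q.1 + s, q.2)) l₁ 0 ∧ HasDerivAt (fun s => S.κ (q.1, q.2 + s)) 0 0 ∧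
    HasDerivAt (fun s => S.β (q.1 + s, q.2)) 0 0 ∧
    HasDerivAt (fun s => S.β (q.1, q.2 + s)) (-l₂) 0 ∧ (l₁ * l₂ < 0 ↔ ∃ i, q = S.saddle i) := by
  obtain ⟨k, hx, hy⟩ := S.exists_of_singular hκ hβ
  have hs : S.sgn k ≠ 0 := fun h => by have := S.sgn_mul_self k; rw [h] at this; norm_num at this
  have hlow : S.lev k < q.2 := by rcases hy with h | h <;> linarith
  have hupp : q.2 < S.lev k + 1 := by rcases hy with h | h <;> linarith
  have hp : profile (q.2 - S.lev k) = 1 := by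
    rw [profile_eq_one_iff]
    rcases hy with h | h
    · left; linarith
    · right; linarith
  have hclose : |q.2 - S.lev k - 1 / 2| < 3 / 20 := by
    rcases hy with h | h <;> rw [h, abs_lt] <;> constructor <;> linarith
  have hslab : ∀ᶠ s : ℝ in 𝓝 0, S.lev k < q.2 + s ∧ q.2 + s < S.lev k + 1 := by
    have hc : ContinuousAt (fun s : ℝ => q.2 + s) 0 := by fun_prop
    exact (hc.eventually_const_lt (by simpa using hlow)).and
      (hc.eventually_lt_const (by simpa using hupp))
  have hb1 : S.bump k =ᶠ[𝓝 0] fun _ => 1 := by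
    have : ∀ᶠ s : ℝ in 𝓝 0, |s| < S.inner k :=
      continuous_abs.continuousAt.eventually_lt_const (by simpa using (S.plateau k).pos)
    filter_upwards [this] with s hs' using (S.plateau k).eq_one s hs'.le
  refine ⟨S.sgn k, 128 * (q.2 - S.lev k - 1 / 2), hs, ?_, ?_, ?_, ?_, ?_, ?_⟩
  · rcases hy with h | h <;> rw [h] <;> intro h' <;> linarith
  · have h1 : HasDerivAt (fun s : ℝ => S.sgn k * s) (S.sgn k) 0 := by
      simpa using (hasDerivAt_id' (0 : ℝ)).const_mul (S.sgn k)
    refine h1.congr_of_eventuallyEq ?_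
    filter_upwards [hb1] with s hs'
    rw [(S.fields_slab (k := k) (q := (q.1 + s, q.2)) hlow.le hupp.le).1]
    simp [box, hx, hs', hp]
  · refine (hasDerivAt_const (0 : ℝ) (0 : ℝ)).congr_of_eventuallyEq ?_
    filter_upwards [hslab] with s hs'
    rw [(S.fields_slab (k := k) (q := (q.1, q.2 + s)) hs'.1.le hs'.2.le).1]
    simp [hx]
  · refine (hasDerivAt_const (0 : ℝ) (1 : ℝ)).congr_of_eventuallyEq ?_
    filter_upwards [hb1] with s hs'
    rw [(S.fields_slab (k := k) (q := (q.1 + s, q.2)) hlow.le hupp.le).2]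
    simp [box, hx, hs', hp]
  · have h0 : HasDerivAt profile (-128 * (q.2 - S.lev k - 1 / 2)) (q.2 - S.lev k + 0) := by
      rw [add_zero]; exact profile_hasDerivAt hclose
    have h1 := h0.comp_const_add (q.2 - S.lev k) 0
    rw [← neg_mul]
    refine h1.congr_of_eventuallyEq ?_
    filter_upwards [hslab] with s hs'
    rw [(S.fields_slab (k := k) (q := (q.1, q.2 + s)) hs'.1.le hs'.2.le).2]
    simp only [box, hx, sub_self, S.bump_zero, one_mul]
    ring_nf
  · constructor
    · intro hneg
      refine ⟨k, Prod.ext hx ?_⟩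
      unfold saddle
      unfold sgn at hneg
      split_ifs with hr
      · rw [if_pos hr] at hneg
        rcases hy with h | h
        · exact h
        · rw [h] at hneg; linarith
      · rw [if_neg hr] at hneg
        rcases hy with h | h
        · rw [h] at hneg; linarith
        · exact h
    · rintro ⟨i, hi⟩
      have hik : i = k := by
        have := S.saddle_slab i
        rw [← hi] at this
        exact S.slab_unique this.1 this.2 hlow hupp
      subst hik
      rw [hi]
      unfold saddle sgn
      dsimp only
      split_ifs <;> linarith

/-! #### Absence of cycles -/

/-- The second coordinate has a critical time, which puts the orbit into a slab; slab boundaries are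
crossed upwards only, so a closed orbit stays there. If it meets the axis of the box, it lies on the
axis and contains a zero, hence is constant. Otherwise `y + sgn * log |x - center|` has derivative
one along it, which contradicts periodicity. -/
theorem no_periodic {c : ℝ → ℝ × ℝ} (hc : IsPlanarSolution S.κ S.β c) {T : ℝ} (hT : 0 < T)
    (hper : c T = c 0) : S.κ (c 0) = 0 ∧ S.β (c 0) = 1 := by
  obtain ⟨K, hK⟩ := S.exists_lipschitz
  have hper' : ∀ t, c (t + T) = c t := by
    intro t
    rw [ode_solution_shift hK hc hc (t₁ := T) (t₂ := 0) hper (t + T)]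
    simp
  have hpern : ∀ (n : ℕ) t, c (t + n * T) = c t := by
    intro n
    induction n with
    | zero => simp
    | succ n ih => intro t; rw [← ih t, ← hper' (t + n * T)]; push_cast; ring_nf
  -- Every point of the orbit recurs arbitrarily late, so estimates in forward time control the
  -- whole orbit.
  have hlate : ∀ s t : ℝ, ∃ s' ≥ t, c s' = c s := by
    intro s t
    obtain ⟨n, hn⟩ := exists_nat_ge ((t - s) / T)
    refine ⟨s + n * T, ?_, hpern n s⟩
    rw [div_le_iff₀ hT] at hn
    linarith
  have hX : ∀ t, HasDerivAt (fun t => (c t).1) (S.κ (c t)) t := fun t =>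
    (hasFDerivAt_fst.comp_hasDerivAt t (hc t) :)
  have hY : ∀ t, HasDerivAt (fun t => (c t).2) (1 - S.β (c t)) t := fun t =>
    (hasFDerivAt_snd.comp_hasDerivAt t (hc t) :)
  obtain ⟨t₁, ht₁⟩ := exists_deriv_eq_zero_of_periodic hT hY (by rw [hper])
  obtain ⟨k, -, hk1, hk2⟩ := S.exists_slab (q := c t₁) (by intro h; rw [h] at ht₁; norm_num at ht₁)
  have hge : ∀ t, S.lev k ≤ (c t).2 := by
    intro t
    obtain ⟨s, hs, hs'⟩ := hlate t t₁
    rw [← hs']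
    exact level_barrier hY (fun u hu => by rw [S.β_lev k hu]; norm_num) hs hk1.le
  have hle : ∀ t, (c t).2 ≤ S.lev k + 1 := by
    intro t
    by_contra! h
    obtain ⟨s, hs, hs'⟩ := hlate t₁ t
    have := level_barrier hY (fun u hu => by rw [S.β_lev_add_one k hu]; norm_num) hs h.le
    rw [hs'] at this
    linarith
  have hslab := fun t => S.fields_slab (hge t) (hle t)
  by_cases hx : ∃ t₂, (c t₂).1 - S.center k = 0
  · obtain ⟨t₂, ht₂⟩ := hx
    -- A linear bound on the derivative makes the axis invariant, by Grönwall's inequality.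
    have hbound : ∀ t, |S.κ (c t)| ≤ 2 * |(c t).1 - S.center k| := by
      intro t
      rw [(hslab t).1, abs_mul, abs_mul]
      have h1 : |S.sgn k| = 1 := by unfold sgn; split_ifs <;> norm_num
      have h2 : |S.box k (c t)| ≤ 2 := by
        have h3 := (S.plateau k).nonneg ((c t).1 - S.center k)
        have h4 := (S.plateau k).le_one ((c t).1 - S.center k)
        have h5 := profile_nonneg ((c t).2 - S.lev k)
        have h6 : profile ((c t).2 - S.lev k) ≤ 2 := (profile_le _).trans
          (max_le (by norm_num) (by nlinarith [sq_nonneg ((c t).2 - S.lev k - 1 / 2)]))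
        unfold box
        rw [abs_of_nonneg (mul_nonneg h3 h5)]
        nlinarith
      rw [h1, one_mul, mul_comm]
      exact mul_le_mul_of_nonneg_right h2 (abs_nonneg _)
    have hX' : ∀ t, HasDerivAt (fun t => (c t).1 - S.center k) (S.κ (c t)) t :=
      fun t => (hX t).sub_const _
    have hzero : ∀ t, (c t).1 - S.center k = 0 := by
      intro t
      obtain ⟨s, hs, hs'⟩ := hlate t t₂
      rw [← hs']
      exact eq_zero_of_abs_deriv_le_mul_abs_self_of_eq_zero_right (K := 2) (a := t₂) (b := s)
        (f := fun t => (c t).1 - S.center k) (f' := fun t => S.κ (c t))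
        (fun u _ => (hX' u).continuousAt.continuousWithinAt)
        (fun u _ => (hX' u).hasDerivWithinAt) ht₂ (fun u _ => hbound u) s ⟨hs, le_rfl⟩
    have hβ1 : S.β (c t₁) = 1 := by linarith
    have hκ1 : S.κ (c t₁) = 0 := by rw [(hslab t₁).1, hzero, mul_zero, zero_mul]
    have hconst := ode_solution_const hK hc (t₀ := t₁) (by simp [planarField, hβ1, hκ1]) 0
    rw [hconst]
    exact ⟨hκ1, hβ1⟩
  · push Not at hx
    exfalso
    -- `Real.log` is even, so both sides of the axis are treated at once.
    have hL : ∀ t, HasDerivAt (fun t => (c t).2 + S.sgn k * Real.log ((c t).1 - S.center k)) 1 t := by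
      intro t
      have h1 := (hY t).add ((((hX t).sub_const (S.center k)).log (hx t)).const_mul (S.sgn k))
      refine h1.congr_deriv ?_
      rw [(hslab t).1, (hslab t).2]
      have := hx t
      field_simp
      have h2 := S.sgn_mul_self k
      linear_combination (S.box k (c t)) * h2
    obtain ⟨t, ht⟩ := exists_deriv_eq_zero_of_periodic hT hL (by rw [hper])
    norm_num at ht

/-! #### Stable separatrices -/

/-- The entering separatrices of the saddles. -/
def label (k : Fin S.N) : Set ℝ := {S.center k + S.radius k, S.center k - S.radius k}

theorem fields_vertical {a t : ℝ} (h : S.κ (a, t) = 0 ∧ S.β (a, t) = 0) :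
    planarField S.κ S.β (a, t) = (0, 1) := by
  simp [planarField, h.1, h.2]

/-- The sign `e` selects the side. The bump is even, so the left separatrix is the mirror image of
the right one; below the slab both continue as vertical lines. -/
theorem entering_double {k : Fin S.N} (hk : 0 < S.radius k) {e : ℝ} (he : e = 1 ∨ e = -1) :
    ∃ c τ, IsPlanarSolution S.κ S.β c ∧
      (∀ t ≤ 0, c t = (S.center k + e * S.radius k, t + S.lev k)) ∧
      ∀ t ≥ τ, c t = (S.center k + e * (S.inner k * Real.exp (-(t - τ))), S.lev k + 5 / 8) := by
  obtain ⟨x, y, τ, h⟩ := S.separatrix k hk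
  refine ⟨fun t => (S.center k + e * x t, S.lev k + y t), τ, fun t => ?_, fun t ht => ?_,
    fun t ht => ?_⟩
  · have hd : HasDerivAt (fun t => (S.center k + e * x t, S.lev k + y t))
        (e * (-x t * (S.bump k (x t) * profile (y t))), 1 - S.bump k (x t) * profile (y t)) t :=
      (((h.deriv_x t).const_mul e).const_add _).prodMk ((h.deriv_y t).const_add _)
    refine hd.congr_deriv ?_
    rcases le_total 0 t with ht | ht
    · obtain ⟨h1, h2⟩ := S.fields_slab (k := k) (q := (S.center k + e * x t, S.lev k + y t))
        (by simpa using (h.mem t ht).1) (by simpa using (h.mem t ht).2)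
      have hb : S.bump k (e * x t) = S.bump k (x t) := by
        rcases he with rfl | rfl
        · rw [one_mul]
        · rw [neg_one_mul, (S.plateau k).even]
      have hs : S.sgn k = -1 := if_neg hk.ne'
      simp only [planarField, h1, h2, box, add_sub_cancel_left, hb, hs]
      ext
      · simp only; ring
      · rfl
    · change _ = planarField S.κ S.β (S.center k + e * x t, S.lev k + y t)
      rw [(h.before t ht).1, (h.before t ht).2]
      rw [S.fields_vertical (S.fields_entering k (by simpa using ht) ?_)]
      · rw [profile_eq_zero_of_le (by linarith)]; simp
      · rcases he with rfl | rfl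
        · left; simp
        · right; simp; ring
  · simp only [(h.before t ht).1, (h.before t ht).2, add_comm]
  · simp only [(h.after t ht).1, (h.after t ht).2]

theorem entering_single {k : Fin S.N} (hk : S.radius k = 0) :
    ∃ y : ℝ → ℝ, IsPlanarSolution S.κ S.β (fun t => (S.center k, S.lev k + y t)) ∧
      (∀ t ≤ 0, y t = t) ∧ Continuous y ∧ Tendsto y atTop (𝓝 (3 / 8)) := by
  obtain ⟨y, h0, hy⟩ := exists_axis_solution 0
  obtain ⟨h1, h2, h3⟩ := axis_solution_entering hy h0
  refine ⟨y, fun t => ?_, h1, continuous_iff_continuousAt.2 fun t => (hy t).continuousAt, h3⟩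
  have hd : HasDerivAt (fun t => (S.center k, S.lev k + y t)) (0, 1 - profile (y t)) t :=
    (hasDerivAt_const t _).prodMk ((hy t).const_add _)
  refine hd.congr_deriv ?_
  rcases le_total 0 t with ht | ht
  · obtain ⟨e1, e2⟩ := S.fields_axis k (h2 t ht).1 (by linarith [(h2 t ht).2])
    simp [planarField, e1, e2]
  · change _ = planarField S.κ S.β (S.center k, S.lev k + y t)
    rw [h1 t ht, S.fields_vertical (S.fields_entering k (by simpa using ht) (by simp [hk])),
      profile_eq_zero_of_le (by linarith), sub_zero]

/-- When `radius k = 0`, this is the remaining stable separatrix of the saddle: it comes from the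
source of the same box, never leaves the box, and contributes no label. -/
theorem inside_single {k : Fin S.N} {y : ℝ → ℝ}
    (hy : ∀ t, HasDerivAt y (1 - profile (y t)) t) (h0 : y 0 ∈ Ioo (3 / 8 : ℝ) (5 / 8)) :
    IsPlanarSolution S.κ S.β (fun t => (S.center k, S.lev k + y t)) := by
  intro t
  have hd : HasDerivAt (fun t => (S.center k, S.lev k + y t)) (0, 1 - profile (y t)) t :=
    (hasDerivAt_const t _).prodMk ((hy t).const_add _)
  refine hd.congr_deriv ?_
  have hin := axis_solution_inside hy h0 t
  obtain ⟨e1, e2⟩ := S.fields_axis k (y := y t) (by linarith [hin.1]) (by linarith [hin.2])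
  simp [planarField, e1, e2]

theorem entering {k : Fin S.N} {a : ℝ} (ha : a ∈ S.label k) :
    ∃ c, IsPlanarSolution S.κ S.β c ∧ (∀ t ≤ 0, c t = (a, t)) ∧
      Tendsto c atTop (𝓝 (S.saddle k)) := by
  rcases (S.radius_nonneg k).eq_or_lt with hk | hk
  · obtain ⟨y, h1, h2, -, h3⟩ := S.entering_single hk.symm
    have ha' : a = S.center k := by
      rcases ha with h | h
      · rw [h, ← hk, add_zero]
      · rw [mem_singleton_iff.1 h, ← hk, sub_zero]
    refine ⟨fun t => (S.center k, S.lev k + y (t + -S.lev k)),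
      fun t => hasDerivAt_time_shift h1 (-S.lev k) t, fun t ht => ?_, ?_⟩
    · change (S.center k, S.lev k + y (t + -S.lev k)) = _
      rw [h2 _ (by linarith [S.lev_nonneg k]), ha']
      simp
    · unfold saddle
      rw [if_pos hk.symm]
      exact tendsto_const_nhds.prodMk_nhds
        ((h3.comp (tendsto_atTop_add_const_right _ _ tendsto_id)).const_add _)
  · obtain ⟨e, he, hae⟩ : ∃ e : ℝ, (e = 1 ∨ e = -1) ∧ a = S.center k + e * S.radius k := by
      rcases ha with h | h
      · exact ⟨1, Or.inl rfl, by rw [h, one_mul]⟩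
      · exact ⟨-1, Or.inr rfl, by rw [mem_singleton_iff.1 h]; ring⟩
    obtain ⟨c, τ, h1, h2, h3⟩ := S.entering_double hk he
    refine ⟨fun t => c (t + -S.lev k), fun t => hasDerivAt_time_shift h1 (-S.lev k) t,
      fun t ht => ?_, ?_⟩
    · change c (t + -S.lev k) = _
      rw [h2 _ (by linarith [S.lev_nonneg k]), hae]
      simp
    · have hlim : Tendsto c atTop (𝓝 (S.saddle k)) := by
        have h4 : Tendsto (fun t => (S.center k + e * (S.inner k * Real.exp (-(t - τ))),
            S.lev k + 5 / 8)) atTop (𝓝 (S.saddle k)) := by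
          unfold saddle
          rw [if_neg hk.ne']
          refine Tendsto.prodMk_nhds ?_ tendsto_const_nhds
          have h5 : Tendsto (fun t : ℝ => Real.exp (-(t - τ))) atTop (𝓝 0) :=
            Real.tendsto_exp_neg_atTop_nhds_zero.comp (tendsto_atTop_add_const_right _ _ tendsto_id)
          simpa using ((h5.const_mul (S.inner k)).const_mul e).const_add (S.center k)
        refine h4.congr' ?_
        filter_upwards [eventually_ge_atTop τ] with t ht using (h3 t ht).symm
      exact hlim.comp (tendsto_atTop_add_const_right _ _ tendsto_id)

/-- Classification of the orbits which tend to a saddle in positive time. -/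
theorem stable_cases {k : Fin S.N} {c : ℝ → ℝ × ℝ} (hc : IsPlanarSolution S.κ S.β c)
    (hlim : Tendsto c atTop (𝓝 (S.saddle k))) :
    (∃ t, c t = S.saddle k) ∨
    (∃ a ∈ S.label k, ∃ r, ∀ t ≤ r, c t = (a, S.lev k + (t - r))) ∨
    (S.radius k = 0 ∧ ∃ y : ℝ → ℝ, (∀ t, HasDerivAt y (1 - profile (y t)) t) ∧
      y 0 ∈ Ioo (3 / 8 : ℝ) (5 / 8) ∧ ∃ r, ∀ t, c t = (S.center k, S.lev k + y (t - r))) := by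
  obtain ⟨K, hK⟩ := S.exists_lipschitz
  have hX : ∀ t, HasDerivAt (fun t => (c t).1) (S.κ (c t)) t := fun t =>
    (hasFDerivAt_fst.comp_hasDerivAt t (hc t) :)
  have hY : ∀ t, HasDerivAt (fun t => (c t).2) (1 - S.β (c t)) t := fun t =>
    (hasFDerivAt_snd.comp_hasDerivAt t (hc t) :)
  have hlimX : Tendsto (fun t => (c t).1 - S.center k) atTop (𝓝 0) := by
    have := ((continuous_fst.tendsto _).comp hlim).sub_const (S.center k)
    simpa [saddle] using this
  have hlimY : Tendsto (fun t => (c t).2) atTop (𝓝 (S.saddle k).2) :=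
    (continuous_snd.tendsto _).comp hlim
  have hevX : ∀ᶠ t in atTop, |(c t).1 - S.center k| < S.inner k := by
    have := (continuous_abs.tendsto _).comp hlimX
    exact this.eventually_lt_const (by simpa using (S.plateau k).pos)
  -- Since `1/8 + 1/40 = 3/20`, this close to the saddle the profile is still given by its parabola.
  have hevY : ∀ᶠ t in atTop, |(c t).2 - (S.saddle k).2| < 1 / 40 := by
    have := (continuous_abs.tendsto _).comp (hlimY.sub_const (S.saddle k).2)
    exact this.eventually_lt_const (by simp)
  obtain ⟨t₀, ht₀⟩ := eventually_atTop.1 (hevX.and hevY)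
  rcases (S.radius_nonneg k).eq_or_lt with hk | hk
  · have hs2 : (S.saddle k).2 = S.lev k + 3 / 8 := by unfold saddle; rw [if_pos hk.symm]
    rw [hs2] at ht₀
    have hfields : ∀ t ≥ t₀, S.κ (c t) = profile ((c t).2 - S.lev k) * ((c t).1 - S.center k) := by
      intro t ht
      have h2 := abs_lt.1 (ht₀ t ht).2
      rw [(S.fields_slab (k := k) (q := c t) (by linarith) (by linarith)).1]
      unfold box sgn
      rw [(S.plateau k).eq_one _ (ht₀ t ht).1.le, if_pos hk.symm]
      ring
    -- The transversal coordinate expands near this saddle, so only orbits on the axis can converge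
    -- to it.
    have hx0 : (c t₀).1 - S.center k = 0 :=
      eq_zero_of_tendsto_of_expanding (f := fun t => (c t).1 - S.center k)
        (g := fun t => profile ((c t).2 - S.lev k))
        (fun t ht => by rw [← hfields t ht]; exact (hX t).sub_const _)
        (fun t _ => profile_nonneg _) hlimX le_rfl
    have hx1 : (c t₀).1 = S.center k := by linarith
    have hy1 := abs_lt.1 (ht₀ t₀ le_rfl).2
    rcases lt_trichotomy (c t₀).2 (S.lev k + 3 / 8) with h | h | h
    · right; left
      obtain ⟨y, e1, e2, e3, e4⟩ := S.entering_single hk.symm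
      obtain ⟨s, hs⟩ : ∃ s, y s = (c t₀).2 - S.lev k := by
        have h5 : ∃ s ≥ 0, (c t₀).2 - S.lev k ≤ y s :=
          ((e4.eventually_const_le (by linarith)).and (eventually_ge_atTop 0)).exists.imp
            fun s hs => ⟨hs.2, hs.1⟩
        obtain ⟨s, hs, hs'⟩ := h5
        obtain ⟨u, -, hu⟩ := (isPreconnected_univ).intermediate_value (mem_univ 0) (mem_univ s)
          e3.continuousOn ⟨by rw [e2 0 le_rfl]; linarith, hs'⟩
        exact ⟨u, hu⟩
      have hshift := ode_solution_shift hK hc e1 (t₁ := t₀) (t₂ := s)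
        (Prod.ext hx1 (by simp [hs]))
      refine ⟨S.center k, Or.inl (by rw [← hk, add_zero]), t₀ - s, fun t ht => ?_⟩
      rw [hshift t, e2 _ (by linarith)]
      ring_nf
    · left
      refine ⟨t₀, Prod.ext hx1 ?_⟩
      rw [hs2, h]
    · right; right
      obtain ⟨y, h0, hy⟩ := exists_axis_solution ((c t₀).2 - S.lev k)
      have hin : y 0 ∈ Ioo (3 / 8 : ℝ) (5 / 8) := by
        rw [h0]; constructor <;> linarith
      refine ⟨hk.symm, y, hy, hin, t₀, fun t => ?_⟩
      have := ode_solution_shift hK hc (S.inside_single (k := k) hy hin) (t₁ := t₀) (t₂ := 0)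
        (Prod.ext hx1 (by simp [h0])) t
      simpa using this
  · have hs2 : (S.saddle k).2 = S.lev k + 5 / 8 := by unfold saddle; rw [if_neg hk.ne']
    rw [hs2] at ht₀ hlimY
    have hfields : ∀ t ≥ t₀, 1 - S.β (c t) =
        64 * ((c t).2 - S.lev k - 3 / 8) * ((c t).2 - (S.lev k + 5 / 8)) := by
      intro t ht
      have h2 := abs_lt.1 (ht₀ t ht).2
      rw [(S.fields_slab (k := k) (q := c t) (by linarith) (by linarith)).2]
      unfold box
      rw [(S.plateau k).eq_one _ (ht₀ t ht).1.le,
        profile_eq_of_abs_le (by rw [abs_le]; constructor <;> linarith)]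
      ring
    -- Now the longitudinal coordinate is the expanding one, which puts the orbit on the level of
    -- the saddle.
    have hy0 : (c t₀).2 - (S.lev k + 5 / 8) = 0 :=
      eq_zero_of_tendsto_of_expanding (f := fun t => (c t).2 - (S.lev k + 5 / 8))
        (g := fun t => 64 * ((c t).2 - S.lev k - 3 / 8))
        (fun t ht => by rw [← hfields t ht]; exact (hY t).sub_const _)
        (fun t ht => by have h2 := abs_lt.1 (ht₀ t ht).2; linarith)
        (by simpa using hlimY.sub_const (S.lev k + 5 / 8)) le_rfl
    have hy1 : (c t₀).2 = S.lev k + 5 / 8 := by linarith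
    by_cases hx : (c t₀).1 - S.center k = 0
    · left
      refine ⟨t₀, Prod.ext (by simp [saddle]; linarith) ?_⟩
      rw [hs2, hy1]
    · right; left
      obtain ⟨e, he, hex⟩ : ∃ e : ℝ, (e = 1 ∨ e = -1) ∧
          (c t₀).1 - S.center k = e * |(c t₀).1 - S.center k| := by
        rcases le_total 0 ((c t₀).1 - S.center k) with h | h
        · exact ⟨1, Or.inl rfl, by rw [abs_of_nonneg h, one_mul]⟩
        · exact ⟨-1, Or.inr rfl, by rw [abs_of_nonpos h]; ring⟩
      obtain ⟨d, τ, h1, h2, h3⟩ := S.entering_double hk he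
      have hpos := abs_pos.2 hx
      have hρ := (S.plateau k).pos
      -- On its last segment the known separatrix is at distance `inner k * exp (-(t - τ))` from the
      -- saddle; `u` is the delay after which this equals the distance of `c t₀`.
      set u := Real.log (S.inner k / |(c t₀).1 - S.center k|) with hu
      have hu0 : 0 ≤ u := Real.log_nonneg ((one_le_div hpos).2 (ht₀ t₀ le_rfl).1.le)
      have hexp : S.inner k * Real.exp (-u) = |(c t₀).1 - S.center k| := by
        rw [Real.exp_neg, hu, Real.exp_log (div_pos hρ hpos)]
        field_simp
      have hmatch : c t₀ = d (τ + u) := by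
        rw [h3 _ (by linarith), add_sub_cancel_left, hexp, ← hex]
        exact Prod.ext (by simp) hy1
      have hshift := ode_solution_shift hK hc h1 hmatch
      refine ⟨S.center k + e * S.radius k, ?_, t₀ - (τ + u), fun t ht => ?_⟩
      · rcases he with rfl | rfl
        · left; rw [one_mul]
        · right; rw [mem_singleton_iff]; ring
      · rw [hshift t, h2 _ (by linarith)]
        ring_nf

theorem vertical_before {c : ℝ → ℝ × ℝ} (hc : IsPlanarSolution S.κ S.β c) {t₀ : ℝ}
    (h : (c t₀).2 ≤ 0) {t : ℝ} (ht : t ≤ t₀) : c t = ((c t₀).1, (c t₀).2 + (t - t₀)) := by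
  obtain ⟨K, hK⟩ := S.exists_lipschitz
  refine ode_solution_unique_left hK (fun s _ => hc s)
    (d := fun t => ((c t₀).1, (c t₀).2 + (t - t₀))) (fun s hs => ?_) (by simp) ht
  rw [S.fields_vertical (S.fields_nonpos (by simp only; linarith))]
  exact (hasDerivAt_const s _).prodMk (((hasDerivAt_id' s).sub_const t₀).const_add _)

theorem constant_of_saddle {k : Fin S.N} {c : ℝ → ℝ × ℝ} (hc : IsPlanarSolution S.κ S.β c)
    {t : ℝ} (h : c t = S.saddle k) (s : ℝ) : c s = S.saddle k := by
  obtain ⟨K, hK⟩ := S.exists_lipschitz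
  rw [← h]
  refine ode_solution_const hK hc ?_ s
  simp [h, planarField, S.saddle_singular k]

/-- An orbit at a nonpositive level was vertical at all earlier times, so its line can be compared
in the distant past with the lines of `stable_cases`. -/
theorem label_unique {k : Fin S.N} {c : ℝ → ℝ × ℝ} (hc : IsPlanarSolution S.κ S.β c)
    (hlim : Tendsto c atTop (𝓝 (S.saddle k))) {t : ℝ} (ht : (c t).2 ≤ 0) :
    (c t).1 ∈ S.label k := by
  rcases S.stable_cases hc hlim with ⟨s, hs⟩ | ⟨a, ha, r, hr⟩ | ⟨-, y, hy, h0, r, hr⟩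
  · rw [S.constant_of_saddle hc hs t] at ht
    linarith [(S.saddle_slab k).1, S.lev_nonneg k]
  · have h1 := S.vertical_before hc ht (min_le_left t r)
    have h2 := hr _ (min_le_right t r)
    rw [h1] at h2
    have h3 : (c t).1 = a := congrArg Prod.fst h2
    rwa [h3]
  · rw [hr t] at ht
    have := (axis_solution_inside hy h0 (t - r)).1
    have := S.lev_nonneg k
    simp only at ht
    linarith

/-- Backwards, an entering separatrix descends to level `-∞`. The separatrix inside a box rises
backwards from above the level `3/8` of its slab, and this slab has no other saddle to converge to.
-/
theorem no_connection {j k : Fin S.N} {c : ℝ → ℝ × ℝ} (hc : IsPlanarSolution S.κ S.β c)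
    (hlim : Tendsto c atTop (𝓝 (S.saddle k))) (hlim' : Tendsto c atBot (𝓝 (S.saddle j))) :
    ∃ t, c t = S.saddle k := by
  have hlimY : Tendsto (fun t => (c t).2) atBot (𝓝 (S.saddle j).2) :=
    (continuous_snd.tendsto _).comp hlim'
  rcases S.stable_cases hc hlim with h | ⟨a, ha, r, hr⟩ | ⟨hk, y, hy, h0, r, hr⟩
  · exact h
  · exfalso
    have h1 : Tendsto (fun t => (c t).2) atBot atBot := by
      have h2 : Tendsto (fun t : ℝ => S.lev k + (t - r)) atBot atBot :=
        tendsto_atBot_add_const_left _ _ (tendsto_atBot_add_const_right _ _ tendsto_id)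
      refine h2.congr' ?_
      filter_upwards [eventually_le_atBot r] with t ht
      rw [hr t ht]
    exact not_tendsto_nhds_of_tendsto_atBot h1 _ hlimY
  · exfalso
    have hin := axis_solution_inside hy h0
    have hanti : Antitone y := by
      apply antitone_of_deriv_nonpos (fun t => (hy t).differentiableAt)
      intro t
      rw [(hy t).deriv]
      have : 1 ≤ profile (y t) := profile_one_lt_iff.2 (by
        rw [abs_le]; constructor <;> linarith [(hin t).1, (hin t).2])
      linarith
    have hlow : S.lev k + y 0 ≤ (S.saddle j).2 := by
      refine ge_of_tendsto hlimY ?_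
      filter_upwards [eventually_le_atBot r] with t ht
      rw [hr t]
      have := hanti (show t - r ≤ 0 by linarith)
      simpa using this
    have hupp : (S.saddle j).2 ≤ S.lev k + 5 / 8 := by
      refine le_of_tendsto hlimY (Eventually.of_forall fun t => ?_)
      rw [hr t]
      simpa using (hin (t - r)).2.le
    have hjk : j = k := S.slab_unique (S.saddle_slab j).1 (S.saddle_slab j).2
      (by linarith [h0.1]) (by linarith)
    subst hjk
    unfold saddle at hlow
    simp only [if_pos hk] at hlow
    linarith [h0.1]

/-- The planar model given by a system of boxes. -/
noncomputable def toPlanarModel : PlanarModel where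
  κ := S.κ
  β := S.β
  κ_smooth := S.κ_contDiff
  β_smooth := S.β_contDiff
  margin := S.exists_margin.choose
  height := S.N
  margin_pos := S.exists_margin.choose_spec.1
  supp := S.exists_margin.choose_spec.2
  nonpos := fun _ => S.fields_nonpos
  ι := Fin S.N
  saddle := S.saddle
  label := S.label
  saddle_singular := S.saddle_singular
  singular := fun _ => S.singular
  no_periodic := fun _ hc _ => S.no_periodic hc
  entering := fun _ _ => S.entering
  label_unique := fun _ _ hc hlim _ => S.label_unique hc hlim
  no_connection := fun _ _ _ => S.no_connection

end BoxSystem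

/-! ### Planar models with prescribed entering separatrices -/

/-- `(l, l + w)` are the end points of a class of the relation `r` on `F`. -/
structure IsClassInterval (F : Finset ℝ) (r : ℝ → ℝ → Prop) (l w : ℝ) : Prop where
  left_mem : l ∈ F
  right_mem : l + w ∈ F
  nonneg : 0 ≤ w
  rel : r l (l + w)
  eq_or_eq : ∀ z ∈ F, r l z → z = l ∨ z = l + w

-- The lexicographic order on pairs (width, left end point) lists each class once, with
-- nondecreasing width. This is the order in which the boxes are stacked.
open Classical in
theorem exists_sorted_classes (F : Finset ℝ) (r : ℝ → ℝ → Prop) :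
    ∃ (N : ℕ) (l w : Fin N → ℝ), (∀ k, IsClassInterval F r (l k) (w k)) ∧
      (∀ l' w', IsClassInterval F r l' w' → ∃ k, l k = l' ∧ w k = w') ∧
      (∀ j k, j < k → w j ≤ w k) ∧ ∀ j k, l j = l k → w j = w k → j = k := by
  set D : Finset (ℝ ×ₗ ℝ) := ((F ×ˢ F).image fun p => toLex (p.2 - p.1, p.1)).filter
    fun p => IsClassInterval F r (ofLex p).2 (ofLex p).1 with hD
  set e := D.orderEmbOfFin rfl
  have hmem : ∀ k, e k ∈ D := fun k => D.orderEmbOfFin_mem rfl k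
  refine ⟨D.card, fun k => (ofLex (e k)).2, fun k => (ofLex (e k)).1,
    fun k => (Finset.mem_filter.1 (hmem k)).2, fun l' w' h => ?_, fun j k h => ?_,
    fun j k h1 h2 => ?_⟩
  · have h1 : toLex (w', l') ∈ D := by
      rw [hD, Finset.mem_filter]
      refine ⟨Finset.mem_image.2 ⟨(l', l' + w'), Finset.mk_mem_product h.left_mem h.right_mem, ?_⟩, h⟩
      simp
    have h2 : toLex (w', l') ∈ Set.range e := by
      rw [Finset.range_orderEmbOfFin]; exact h1
    obtain ⟨k, hk⟩ := h2
    exact ⟨k, by simp [hk], by simp [hk]⟩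
  · have h1 : e j < e k := e.strictMono h
    rw [Prod.Lex.lt_iff] at h1
    rcases h1 with h1 | h1
    · exact h1.le
    · exact h1.1.le
  · apply e.injective
    apply ofLex.injective
    exact Prod.ext h2 h1

/-- The point is `avoid`. If a line of a later class met an earlier box, it would lie strictly
between the end points of the earlier class. As classes do not cross, the whole later class would
lie there and be strictly narrower, against the ordering by width. -/
theorem exists_planarModel (F : Finset ℝ) (hF : ∀ x ∈ F, 0 < x ∧ x < 1) (r : ℝ → ℝ → Prop)
    (hrefl : ∀ x ∈ F, r x x) (hsymm : ∀ x ∈ F, ∀ y ∈ F, r x y → r y x)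
    (htrans : ∀ x ∈ F, ∀ y ∈ F, ∀ z ∈ F, r x y → r y z → r x z)
    (hcard : ∀ x ∈ F, ∀ y ∈ F, ∀ z ∈ F, r x y → r x z → x = y ∨ x = z ∨ y = z)
    (hnc : ∀ x ∈ F, ∀ y ∈ F, ∀ u ∈ F, ∀ v ∈ F, r x y → r u v → u ≠ v → ¬ r x u →
      x < u → u < y → x < v ∧ v < y) :
    ∃ M : PlanarModel, (∀ i, M.label i ⊆ F) ∧
      (∀ i, ∀ x ∈ M.label i, ∀ y ∈ M.label i, r x y) ∧
      ∀ x ∈ F, ∀ y ∈ F, r x y → ∃ i, x ∈ M.label i ∧ y ∈ M.label i := by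
  obtain ⟨N, l, w, hcls, hsurj, hmono, hinj⟩ := exists_sorted_classes F r
  -- `ε` is less than all gaps between the points and than their distances to `0` and `1`: a box
  -- that exceeds its class interval by at most `ε` stays in the strip and reaches no point of `F`
  -- outside this interval.
  obtain ⟨ε, hgap, hε⟩ : ∃ ε : ℝ, (∀ x ∈ F, (ε < x ∧ ε < 1 - x) ∧ ∀ y ∈ F, x ≠ y → ε < |x - y|) ∧
      0 < ε := by
    have h1 : ∀ᶠ ε : ℝ in 𝓝[>] 0, ∀ x ∈ F, (ε < x ∧ ε < 1 - x) ∧ ∀ y ∈ F, x ≠ y → ε < |x - y| := by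
      rw [Finset.eventually_all]
      intro x hx
      have a1 : ∀ᶠ ε : ℝ in 𝓝[>] 0, ε < x :=
        (eventually_lt_nhds (hF x hx).1).filter_mono nhdsWithin_le_nhds
      have a2 : ∀ᶠ ε : ℝ in 𝓝[>] 0, ε < 1 - x :=
        (eventually_lt_nhds (by linarith [(hF x hx).2])).filter_mono nhdsWithin_le_nhds
      refine (a1.and a2).and ?_
      rw [Finset.eventually_all]
      intro y hy
      by_cases hxy : x = y
      · exact Eventually.of_forall fun _ h => absurd hxy h
      · have a3 : ∀ᶠ ε : ℝ in 𝓝[>] 0, ε < |x - y| :=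
          (eventually_lt_nhds (abs_pos.2 (sub_ne_zero.2 hxy))).filter_mono nhdsWithin_le_nhds
        filter_upwards [a3] with ε h _ using h
    exact (h1.and self_mem_nhdsWithin).exists
  have hbump : ∀ k : Fin N, ∃ (b : ℝ → ℝ) (ρ R : ℝ), R ≤ w k / 2 + ε ∧ IsPlateau b ρ R ∧
      (0 < w k / 2 → ∃ x y τ, IsEnteringSeparatrix b ρ (w k / 2) x y τ) := by
    intro k
    rcases (div_nonneg (hcls k).nonneg zero_le_two).eq_or_lt with h | h
    · obtain ⟨b, hb⟩ := exists_plateau (half_pos hε) (half_lt_self hε)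
      exact ⟨b, _, _, by rw [← h, zero_add], hb, fun h' => absurd h h'.ne⟩
    · obtain ⟨b, ρ, R, x, y, τ, hR, hb, hsep⟩ := exists_plateau_separatrix h (lt_add_of_pos_right _ hε)
      exact ⟨b, ρ, R, hR, hb, fun _ => ⟨x, y, τ, hsep⟩⟩
  choose b ρ R hR hb hsep using hbump
  -- Two indices with a related point in common describe the same class, so they have the same left
  -- end and the same width.
  have hne : ∀ j k : Fin N, j ≠ k → ∀ e ∈ F, r (l k) e → ¬ r (l j) e := by
    intro j k hjk e he h1 h2
    have cj := hcls j
    have ck := hcls k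
    have h3 : r (l j) (l k) := htrans _ cj.left_mem _ he _ ck.left_mem h2
      (hsymm _ ck.left_mem _ he h1)
    have h4 := hsymm _ cj.left_mem _ ck.left_mem h3
    have h5 := cj.eq_or_eq _ ck.left_mem h3
    have h6 := ck.eq_or_eq _ cj.left_mem h4
    have h7 := cj.eq_or_eq _ ck.right_mem
      (htrans _ cj.left_mem _ ck.left_mem _ ck.right_mem h3 ck.rel)
    have h8 := ck.eq_or_eq _ cj.right_mem
      (htrans _ ck.left_mem _ cj.left_mem _ cj.right_mem h4 cj.rel)
    have n1 := cj.nonneg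
    have n2 := ck.nonneg
    have h9 : l j = l k := by
      rcases h5 with h5 | h5
      · exact h5.symm
      · rcases h6 with h6 | h6
        · exact h6
        · linarith
    refine hjk (hinj j k h9 ?_)
    rcases h7 with h7 | h7 <;> rcases h8 with h8 | h8 <;> linarith
  have havoid : ∀ j k : Fin N, j < k → ∀ e ∈ F, (e = l k ∨ e = l k + w k) →
      R j ≤ |e - (l j + w j / 2)| := by
    intro j k hjk e he hek
    have cj := hcls j
    have ck := hcls k
    have hke : r (l k) e := by
      rcases hek with rfl | rfl
      · exact hrefl _ ck.left_mem
      · exact ck.rel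
    have hje := hne j k hjk.ne e he hke
    have d1 : ε < |e - l j| := (hgap e he).2 _ cj.left_mem (by
      rintro rfl; exact hje (hrefl _ he))
    have d2 : ε < |e - (l j + w j)| := (hgap e he).2 _ cj.right_mem (by
      rintro h; rw [h] at hje; exact hje cj.rel)
    by_contra! hlt
    have hlt' := abs_lt.1 (hlt.trans_le (hR j))
    have i1 : l j < e := by
      rcases lt_abs.1 d1 with h | h <;> linarith
    have i2 : e < l j + w j := by
      rcases lt_abs.1 d2 with h | h <;> linarith
    have hw := hmono j k hjk
    -- `v` is the other end point of the later class. It differs from `e` because the width of the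
    -- earlier class is positive and does not exceed that of the later one.
    obtain ⟨v, hv, hev, hvw, huv⟩ : ∃ v ∈ F, r e v ∧ |v - e| = w k ∧ e ≠ v := by
      have hwk : w k ≠ 0 := by linarith
      rcases hek with rfl | rfl
      · exact ⟨_, ck.right_mem, ck.rel, by simp [abs_of_nonneg ck.nonneg], by simpa using hwk⟩
      · exact ⟨_, ck.left_mem, hsymm _ ck.left_mem _ he ck.rel, by simp [abs_of_nonneg ck.nonneg],
          by simpa using hwk⟩
    obtain ⟨v1, v2⟩ := hnc _ cj.left_mem _ cj.right_mem e he v hv cj.rel hev huv hje i1 i2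
    have : |v - e| < w j := abs_lt.2 ⟨by linarith, by linarith⟩
    linarith
  let S : BoxSystem :=
    { N := N
      center := fun k => l k + w k / 2
      radius := fun k => w k / 2
      bump := b
      inner := ρ
      outer := R
      radius_nonneg := fun k => div_nonneg (hcls k).nonneg zero_le_two
      plateau := hb
      mem_unit := fun k => by
        have h1 := hgap _ (hcls k).left_mem
        have h2 := hgap _ (hcls k).right_mem
        constructor <;> linarith [hR k, h1.1.1, h2.1.2]
      avoid := fun j k hjk => by
        refine ⟨havoid j k hjk _ ?_ (Or.inr (by ring)), havoid j k hjk _ ?_ (Or.inl (by ring))⟩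
        · have : l k + w k / 2 + w k / 2 = l k + w k := by ring
          rw [this]; exact (hcls k).right_mem
        · have : l k + w k / 2 - w k / 2 = l k := by ring
          rw [this]; exact (hcls k).left_mem
      separatrix := hsep }
  have hlabel : ∀ k, S.label k = {l k + w k, l k} := by
    intro k
    change ({l k + w k / 2 + w k / 2, l k + w k / 2 - w k / 2} : Set ℝ) = _
    congr 1
    · ring
    · rw [add_sub_cancel_right]
  have hlab : ∀ k x, x ∈ S.label k ↔ x = l k + w k ∨ x = l k := fun k x => by
    rw [hlabel]; simp
  refine ⟨S.toPlanarModel, fun k x hx => ?_, fun k x hx y hy => ?_, fun x hx y hy hxy => ?_⟩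
  · rcases (hlab k x).1 hx with rfl | rfl
    · exact (hcls k).right_mem
    · exact (hcls k).left_mem
  · have ck := hcls k
    rcases (hlab k x).1 hx with rfl | rfl <;> rcases (hlab k y).1 hy with rfl | rfl
    · exact hrefl _ ck.right_mem
    · exact hsymm _ ck.left_mem _ ck.right_mem ck.rel
    · exact ck.rel
    · exact hrefl _ ck.left_mem
  · have key : ∃ l' w', IsClassInterval F r l' w' ∧ (x = l' + w' ∨ x = l') ∧ (y = l' + w' ∨ y = l') := by
      by_cases hz : ∃ z ∈ F, r x z ∧ x ≠ z
      · obtain ⟨z, hz, hxz, hne⟩ := hz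
        have hcl : ∀ u ∈ F, r x u → u = x ∨ u = z := by
          intro u hu hxu
          rcases hcard x hx u hu z hz hxu hxz with h | h | h
          · exact Or.inl h.symm
          · exact absurd h hne
          · exact Or.inr h
        have hzx := hsymm x hx z hz hxz
        rcases lt_or_gt_of_ne hne with hlt | hgt
        · refine ⟨x, z - x, ⟨hx, by simpa using hz, by linarith, by simpa using hxz, fun u hu h => ?_⟩,
            Or.inr rfl, ?_⟩
          · simpa using hcl u hu h
          · simpa [or_comm] using hcl y hy hxy
        · refine ⟨z, x - z, ⟨hz, by simpa using hx, by linarith, by simpa using hzx, fun u hu h => ?_⟩,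
            Or.inl (by ring), ?_⟩
          · simpa [or_comm] using hcl u hu (htrans x hx z hz u hu hxz h)
          · simpa using hcl y hy hxy
      · push Not at hz
        refine ⟨x, 0, ⟨hx, by simpa using hx, le_rfl, by simpa using hrefl x hx, fun u hu h => ?_⟩,
          Or.inr rfl, Or.inr (hz y hy hxy).symm⟩
        exact Or.inl (hz u hu h).symm
    obtain ⟨l', w', hc, h1, h2⟩ := key
    obtain ⟨k, rfl, rfl⟩ := hsurj l' w' hc
    exact ⟨k, (hlab k x).2 h1, (hlab k y).2 h2⟩

/-! ### Coordinates in `ℝ³` -/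

/-- The point with given coordinates. -/
noncomputable def pt (x y z : ℝ) : E3 := !₂[x, y, z]

@[simp] theorem pt_zero (x y z : ℝ) : pt x y z 0 = x := rfl
@[simp] theorem pt_one (x y z : ℝ) : pt x y z 1 = y := rfl
@[simp] theorem pt_two (x y z : ℝ) : pt x y z 2 = z := rfl

theorem E3.ext' {p q : E3} (h0 : p 0 = q 0) (h1 : p 1 = q 1) (h2 : p 2 = q 2) : p = q := by
  ext i; fin_cases i <;> assumption

theorem inner_E3 (p q : E3) : ⟪p, q⟫ = p 0 * q 0 + p 1 * q 1 + p 2 * q 2 := by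
  rw [PiLp.inner_apply, Fin.sum_univ_three]
  simp [mul_comm]

theorem mem_S2_iff {p : E3} : p ∈ S2 ↔ p 0 ^ 2 + p 1 ^ 2 + p 2 ^ 2 = 1 := by
  rw [mem_sphere_zero_iff_norm, EuclideanSpace.norm_eq, Real.sqrt_eq_one, Fin.sum_univ_three]
  simp

theorem contDiff_pt {E : Type*} [NormedAddCommGroup E] [NormedSpace ℝ E] {x y z : E → ℝ}
    (hx : ContDiff ℝ ∞ x) (hy : ContDiff ℝ ∞ y) (hz : ContDiff ℝ ∞ z) :
    ContDiff ℝ ∞ fun e => pt (x e) (y e) (z e) := by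
  rw [contDiff_euclidean]
  intro i
  fin_cases i <;> assumption

theorem contDiff_coord (i : Fin 3) : ContDiff ℝ ∞ fun p : E3 => p i :=
  (EuclideanSpace.proj i : E3 →L[ℝ] ℝ).contDiff

theorem hasDerivAt_coord {c : ℝ → E3} {c' : E3} {t : ℝ} (h : HasDerivAt c c' t) (i : Fin 3) :
    HasDerivAt (fun t => c t i) (c' i) t :=
  ((EuclideanSpace.proj i : E3 →L[ℝ] ℝ).hasFDerivAt.comp_hasDerivAt t h :)

theorem hasDerivAt_pt {x y z : ℝ → ℝ} {x' y' z' t : ℝ} (hx : HasDerivAt x x' t)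
    (hy : HasDerivAt y y' t) (hz : HasDerivAt z z' t) :
    HasDerivAt (fun t => pt (x t) (y t) (z t)) (pt x' y' z') t := by
  have h : HasDerivAt (fun t => ![x t, y t, z t]) ![x', y', z'] t := by
    rw [hasDerivAt_pi]
    intro i
    fin_cases i <;> assumption
  exact ((EuclideanSpace.equiv (Fin 3) ℝ).symm.toContinuousLinearMap.hasFDerivAt.comp_hasDerivAt
    t h :)

/-! ### The rotation field and the unperturbed field -/

/-- The rotation around the vertical axis. -/
noncomputable def rotField (p : E3) : E3 := pt (-p 1) (p 0) 0

/-- The unperturbed field: its parabolic cycle is the equator, its singular points are the poles. -/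
noncomputable def baseField (p : E3) : E3 :=
  pt (-(2 * Real.pi * (1 - p 2 ^ 2) * p 1) - p 2 ^ 3 * p 0)
    (2 * Real.pi * (1 - p 2 ^ 2) * p 0 - p 2 ^ 3 * p 1) (p 2 ^ 2 * (1 - p 2 ^ 2))

theorem rotField_contDiff : ContDiff ℝ ∞ rotField :=
  contDiff_pt (contDiff_coord 1).neg (contDiff_coord 0) contDiff_const

theorem baseField_contDiff : ContDiff ℝ ∞ baseField := by
  have h0 := contDiff_coord 0
  have h1 := contDiff_coord 1
  have h2 := contDiff_coord 2
  apply contDiff_pt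
  · exact ((contDiff_const.mul (contDiff_const.sub (h2.pow 2))).mul h1).neg.sub ((h2.pow 3).mul h0)
  · exact ((contDiff_const.mul (contDiff_const.sub (h2.pow 2))).mul h0).sub ((h2.pow 3).mul h1)
  · exact (h2.pow 2).mul (contDiff_const.sub (h2.pow 2))

theorem inner_rotField (p : E3) : ⟪p, rotField p⟫ = 0 := by
  rw [inner_E3]; simp [rotField]; ring

theorem inner_baseField {p : E3} (hp : p ∈ S2) : ⟪p, baseField p⟫ = 0 := by
  rw [mem_S2_iff] at hp
  rw [inner_E3]; simp only [baseField, pt_zero, pt_one, pt_two]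
  linear_combination (-p 2 ^ 3) * hp

/-! ### The time function of the height -/

/-- The time of the unperturbed flow as a function of the height `z` and of `ρ = x² + y²`. -/
noncomputable def flowTime (z ρ : ℝ) : ℝ := -(1 / z) + Real.log (1 + z) - Real.log ρ / 2

noncomputable def heightTime (z : ℝ) : ℝ := flowTime z (1 - z ^ 2)

/-- This is the partial fraction decomposition of $1/(z^2(1-z^2))$ as $1/z^2+1/(1-z^2)$. -/
theorem heightTime_hasDerivAt {z : ℝ} (h0 : 0 < z) (h1 : z < 1) :
    HasDerivAt heightTime (z ^ 2 * (1 - z ^ 2))⁻¹ z := by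
  have hz : (1 : ℝ) - z ^ 2 ≠ 0 := by nlinarith
  have hz' : (1 : ℝ) + z ≠ 0 := by linarith
  have e1 := ((hasDerivAt_id' z).inv h0.ne').neg
  have e2 := ((hasDerivAt_id' z).const_add 1).log hz'
  have e3 := ((((hasDerivAt_id' z).pow 2).const_sub 1).log hz).div_const 2
  have e4 := (e1.add e2).sub e3
  have : heightTime = ((-(fun y : ℝ => y)⁻¹ + fun y => Real.log (1 + y)) -
      fun y => Real.log (1 - y ^ 2) / 2) := by
    funext y; simp [heightTime, flowTime]
  rw [this]
  refine e4.congr_deriv ?_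
  have h3 : (1 - z : ℝ) ≠ 0 := by linarith
  have h4 : (1 : ℝ) - z ^ 2 = (1 - z) * (1 + z) := by ring
  simp only [Pi.pow_apply, h4]
  field_simp
  norm_num
  ring

theorem heightTime_strictMonoOn : StrictMonoOn heightTime (Ioo 0 1) := by
  apply strictMonoOn_of_deriv_pos (convex_Ioo 0 1)
  · exact fun z hz => (heightTime_hasDerivAt hz.1 hz.2).continuousAt.continuousWithinAt
  · intro z hz
    rw [interior_Ioo] at hz
    rw [(heightTime_hasDerivAt hz.1 hz.2).deriv]
    have : 0 < 1 - z ^ 2 := by nlinarith [hz.1, hz.2]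
    have := hz.1
    positivity

/-- The inequality `log x ≤ x - 1` suffices: the value is at most `-2 + 1/2 + 1/6`. This places the
times `t ≥ 0`, hence all perturbations, above the height `1/2`. -/
theorem heightTime_half_neg : heightTime (1 / 2) < 0 := by
  unfold heightTime flowTime
  have h1 : Real.log (1 + 1 / 2) ≤ 1 / 2 := by
    have := Real.log_le_sub_one_of_pos (show (0 : ℝ) < 1 + 1 / 2 by norm_num)
    linarith
  have h2 : Real.log (4 / 3) ≤ 1 / 3 := by
    have := Real.log_le_sub_one_of_pos (show (0 : ℝ) < 4 / 3 by norm_num)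
    linarith
  have h3 : Real.log (1 - (1 / 2) ^ 2) = -Real.log (4 / 3) := by
    rw [← Real.log_inv]; norm_num
  rw [h3]
  norm_num at h1 h2 ⊢
  linarith

theorem heightTime_neg {z : ℝ} (h0 : 0 < z) (h1 : z ≤ 1 / 2) : heightTime z < 0 :=
  (heightTime_strictMonoOn.monotoneOn ⟨h0, by linarith⟩ ⟨by norm_num, by norm_num⟩ h1).trans_lt
    heightTime_half_neg

theorem heightTime_le {z : ℝ} (h0 : 0 < z) (h1 : z ≤ 1 / 2) : heightTime z ≤ -(1 / z) + 1 := by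
  unfold heightTime flowTime
  have e1 : Real.log (1 + z) ≤ 1 / 2 := by
    have := Real.log_le_sub_one_of_pos (show (0 : ℝ) < 1 + z by linarith)
    linarith
  have hz : 3 / 4 ≤ 1 - z ^ 2 := by nlinarith
  have e2 : Real.log (1 / (1 - z ^ 2)) ≤ 1 / 3 := by
    have := Real.log_le_sub_one_of_pos (show (0 : ℝ) < 1 / (1 - z ^ 2) by positivity)
    have h3 : 1 / (1 - z ^ 2) ≤ 1 / (3 / 4) := one_div_le_one_div_of_le (by norm_num) hz
    norm_num at h3 this ⊢
    linarith
  rw [one_div, Real.log_inv] at e2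
  linarith

theorem le_heightTime {z : ℝ} (h0 : 1 / 2 ≤ z) (h1 : z < 1) :
    -2 - Real.log (2 * (1 - z)) / 2 ≤ heightTime z := by
  unfold heightTime flowTime
  have e1 : 0 ≤ Real.log (1 + z) := Real.log_nonneg (by linarith)
  have e2 : 1 / z ≤ 2 := by
    have := one_div_le_one_div_of_le (by norm_num : (0 : ℝ) < 1 / 2) h0
    norm_num at this ⊢
    linarith
  have e3 : Real.log (1 - z ^ 2) ≤ Real.log (2 * (1 - z)) :=
    Real.log_le_log (by nlinarith) (by nlinarith)
  linarith

theorem heightTime_surj (t : ℝ) : ∃ z ∈ Ioo (0 : ℝ) 1, heightTime z = t := by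
  have hcont : ContinuousOn heightTime (Ioo 0 1) := fun z hz =>
    (heightTime_hasDerivAt hz.1 hz.2).continuousAt.continuousWithinAt
  obtain ⟨z₁, h1, h1'⟩ : ∃ z ∈ Ioo (0 : ℝ) 1, heightTime z ≤ t := by
    have hpos : 0 < 1 / (|t| + 2) := by positivity
    have hle : 1 / (|t| + 2) ≤ 1 / 2 :=
      one_div_le_one_div_of_le (by norm_num) (by linarith [abs_nonneg t])
    refine ⟨1 / (|t| + 2), ⟨hpos, by linarith⟩, ?_⟩
    have := heightTime_le hpos hle
    rw [one_div_one_div] at this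
    linarith [neg_abs_le t]
  obtain ⟨z₂, h2, h2'⟩ : ∃ z ∈ Ioo (0 : ℝ) 1, t ≤ heightTime z := by
    set u := Real.exp (-2 * (|t| + 2)) with hu
    have hu0 : 0 < u := Real.exp_pos _
    have hu1 : u ≤ 1 := Real.exp_le_one_iff.2 (by linarith [abs_nonneg t])
    refine ⟨1 - u / 2, ⟨by linarith, by linarith⟩, ?_⟩
    have := le_heightTime (z := 1 - u / 2) (by linarith) (by linarith)
    have h3 : 2 * (1 - (1 - u / 2)) = u := by ring
    rw [h3, hu, Real.log_exp] at this
    linarith [le_abs_self t]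
  obtain ⟨z, hz, h⟩ := isPreconnected_Ioo.intermediate_value h1 h2 hcont ⟨h1', h2'⟩
  exact ⟨z, hz, h⟩

/-- The height as a function of the time of the unperturbed flow. -/
noncomputable def height (t : ℝ) : ℝ := (heightTime_surj t).choose

theorem height_mem (t : ℝ) : height t ∈ Ioo (0 : ℝ) 1 := (heightTime_surj t).choose_spec.1

theorem heightTime_height (t : ℝ) : heightTime (height t) = t :=
  (heightTime_surj t).choose_spec.2

theorem height_heightTime {z : ℝ} (hz : z ∈ Ioo (0 : ℝ) 1) : height (heightTime z) = z :=
  heightTime_strictMonoOn.injOn (height_mem _) hz (heightTime_height _)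

theorem height_strictMono : StrictMono height := by
  intro s t hst
  by_contra! h
  have := heightTime_strictMonoOn.monotoneOn (height_mem t) (height_mem s) h
  rw [heightTime_height, heightTime_height] at this
  linarith

theorem height_continuousAt (t : ℝ) : ContinuousAt height t := by
  refine continuousAt_of_monotoneOn_of_image_mem_nhds (s := univ) (height_strictMono.monotone.monotoneOn _)
    univ_mem ?_
  have : height '' univ = Ioo 0 1 := by
    ext z
    simp only [image_univ, mem_range]
    exact ⟨fun ⟨t, ht⟩ => ht ▸ height_mem t, fun hz => ⟨_, height_heightTime hz⟩⟩
  rw [this]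
  exact Ioo_mem_nhds (height_mem t).1 (height_mem t).2

theorem height_hasDerivAt (t : ℝ) :
    HasDerivAt height (height t ^ 2 * (1 - height t ^ 2)) t := by
  have h := height_mem t
  have h1 : 0 < 1 - height t ^ 2 := by nlinarith [h.1, h.2]
  have h2 := h.1
  have := HasDerivAt.of_local_left_inverse (height_continuousAt t)
    (heightTime_hasDerivAt h.1 h.2) (by positivity) (Eventually.of_forall heightTime_height)
  rwa [inv_inv] at this

theorem height_tendsto_atBot : Tendsto height atBot (𝓝 0) := by
  rw [tendsto_order]
  refine ⟨fun a ha => Eventually.of_forall fun t => ha.trans (height_mem t).1, fun a ha => ?_⟩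
  have hm : min a (1 / 2) ∈ Ioo (0 : ℝ) 1 :=
    ⟨lt_min ha (by norm_num), (min_le_right _ _).trans_lt (by norm_num)⟩
  filter_upwards [eventually_lt_atBot (heightTime (min a (1 / 2)))] with t ht
  have := height_strictMono ht
  rw [height_heightTime hm] at this
  exact this.trans_le (min_le_left _ _)

/-! ### Flow coordinates on the upper hemisphere -/

/-- The point of the upper hemisphere with the flow coordinates `(a, t)`: here `a` labels an orbit
of the unperturbed field and `t` is the time. -/
noncomputable def flowPt (q : ℝ × ℝ) : E3 :=
  pt (√(1 - height q.2 ^ 2) * Real.cos (2 * Real.pi * (q.1 - 1 / height q.2)))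
    (√(1 - height q.2 ^ 2) * Real.sin (2 * Real.pi * (q.1 - 1 / height q.2))) (height q.2)

theorem one_sub_height_sq_pos (t : ℝ) : 0 < 1 - height t ^ 2 := by
  have h := height_mem t
  nlinarith [h.1, h.2]

theorem flowPt_mem_S2 (q : ℝ × ℝ) : flowPt q ∈ S2 := by
  rw [mem_S2_iff]
  simp only [flowPt, pt_zero, pt_one, pt_two, mul_pow, Real.sq_sqrt (one_sub_height_sq_pos q.2).le]
  have := Real.cos_sq_add_sin_sq (2 * Real.pi * (q.1 - 1 / height q.2))
  linear_combination (1 - height q.2 ^ 2) * this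

/-- Varying the label rotates the sphere, by a full turn per unit. Along the time, $1/z$ decreases
at the rate $1-z^2$, so the longitude $2\pi(a-1/z)$ acquires the angular speed of the unperturbed
field. -/
theorem flowPt_hasDerivAt {c : ℝ → ℝ × ℝ} {v : ℝ × ℝ} {t : ℝ} (hc : HasDerivAt c v t) :
    HasDerivAt (fun t => flowPt (c t))
      (v.1 • (2 * Real.pi) • rotField (flowPt (c t)) + v.2 • baseField (flowPt (c t))) t := by
  have h1 : HasDerivAt (fun t => (c t).1) v.1 t := (hasFDerivAt_fst.comp_hasDerivAt t hc :)
  have h2 : HasDerivAt (fun t => (c t).2) v.2 t := (hasFDerivAt_snd.comp_hasDerivAt t hc :)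
  set z := height (c t).2 with hz
  have hzm := height_mem (c t).2
  have hpos := one_sub_height_sq_pos (c t).2
  rw [← hz] at hzm hpos
  have hz0 : z ≠ 0 := hzm.1.ne'
  have e1 : HasDerivAt (fun t => height (c t).2) (z ^ 2 * (1 - z ^ 2) * v.2) t :=
    (height_hasDerivAt (c t).2).comp (h := fun t => (c t).2) t h2
  set r := √(1 - z ^ 2) with hr
  have hr0 : 0 < r := Real.sqrt_pos.2 hpos
  have hrr : r * r = 1 - z ^ 2 := Real.mul_self_sqrt hpos.le
  have e2 : HasDerivAt (fun t => √(1 - height (c t).2 ^ 2)) (-(z ^ 3 * r * v.2)) t := by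
    refine (((e1.pow 2).const_sub 1).sqrt hpos.ne').congr_deriv ?_
    simp only [Pi.pow_apply, ← hz, ← hr]
    field_simp
    rw [pow_two r, hrr]
    norm_num
    ring
  set θ := 2 * Real.pi * ((c t).1 - 1 / z) with hθ
  have e3 : HasDerivAt (fun t => 2 * Real.pi * ((c t).1 - 1 / height (c t).2))
      (2 * Real.pi * (v.1 + (1 - z ^ 2) * v.2)) t := by
    have e4 := (h1.sub (e1.inv hz0)).const_mul (2 * Real.pi)
    have e5 : (fun t => 2 * Real.pi * ((c t).1 - 1 / height (c t).2)) = fun y =>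
      2 * Real.pi * ((fun t => (c t).1) - (fun t => height (c t).2)⁻¹) y := by
      funext s; simp
    rw [e5]
    refine e4.congr_deriv ?_
    simp only [← hz]
    field_simp
    ring
  have hd := hasDerivAt_pt (e2.mul e3.cos) (e2.mul e3.sin) e1
  refine hd.congr_deriv ?_
  simp only [← hz, ← hr, ← hθ]
  apply E3.ext' <;> simp only [flowPt, rotField, baseField, pt_zero, pt_one, pt_two, PiLp.add_apply,
    PiLp.smul_apply, smul_eq_mul, ← hz, ← hr, ← hθ] <;> ring

/-! ### The inverse coordinates -/

/-- A complex number whose argument, divided by `2π`, is the label of the orbit. -/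
noncomputable def labelCplx (p : E3) : ℂ :=
  ⟨p 0 * Real.cos (2 * Real.pi / p 2) - p 1 * Real.sin (2 * Real.pi / p 2),
    p 0 * Real.sin (2 * Real.pi / p 2) + p 1 * Real.cos (2 * Real.pi / p 2)⟩

/-- The label of the orbit, with values in `(0, 1]`. -/
noncomputable def orbitLabel (p : E3) : ℝ := ((-labelCplx p).arg + Real.pi) / (2 * Real.pi)

/-- The rotation by `2π / z` in `labelCplx` cancels the dependence of the longitude on the height.
The minus sign in `orbitLabel` puts the cut of the argument at the label `0 = 1`. -/
theorem orbitLabel_flowPt {a t : ℝ} (h0 : 0 < a) (h1 : a ≤ 1) : orbitLabel (flowPt (a, t)) = a := by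
  have hz := height_mem t
  have hr : 0 < √(1 - height t ^ 2) := Real.sqrt_pos.2 (one_sub_height_sq_pos t)
  have h2 : -labelCplx (flowPt (a, t)) = (√(1 - height t ^ 2) : ℝ) *
      (Complex.cos ((2 * Real.pi * a - Real.pi : ℝ) : ℂ) +
        Complex.sin ((2 * Real.pi * a - Real.pi : ℝ) : ℂ) * Complex.I) := by
    have e : 2 * Real.pi * (a - 1 / height t) = 2 * Real.pi * a - 2 * Real.pi / height t := by ring
    rw [← Complex.ofReal_cos, ← Complex.ofReal_sin, Real.cos_sub_pi, Real.sin_sub_pi]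
    have e1 := Real.cos_add (2 * Real.pi * a - 2 * Real.pi / height t) (2 * Real.pi / height t)
    have e2 := Real.sin_add (2 * Real.pi * a - 2 * Real.pi / height t) (2 * Real.pi / height t)
    rw [sub_add_cancel] at e1 e2
    apply Complex.ext
    · simp only [labelCplx, flowPt, pt_zero, pt_one, pt_two, e, Complex.neg_re, Complex.re_ofReal_mul,
        Complex.add_re, Complex.ofReal_re, Complex.mul_I_re, Complex.ofReal_im]
      rw [e1]; ring
    · simp only [labelCplx, flowPt, pt_zero, pt_one, pt_two, e, Complex.neg_im, Complex.im_ofReal_mul,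
        Complex.add_im, Complex.ofReal_re, Complex.mul_I_im, Complex.ofReal_im]
      rw [e2]; ring
  have hpi := Real.pi_pos
  unfold orbitLabel
  rw [h2, Complex.arg_mul_cos_add_sin_mul_I hr ⟨by nlinarith, by nlinarith⟩]
  field_simp
  ring

theorem flowPt_add_one (q : ℝ × ℝ) : flowPt (q.1 + 1, q.2) = flowPt q := by
  have : 2 * Real.pi * (q.1 + 1 - 1 / height q.2) =
      2 * Real.pi * (q.1 - 1 / height q.2) + 2 * Real.pi := by ring
  simp only [flowPt, this, Real.cos_add_two_pi, Real.sin_add_two_pi]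

theorem orbitLabel_flowPt_zero (t : ℝ) : orbitLabel (flowPt (0, t)) = 1 := by
  rw [← flowPt_add_one (0, t)]
  simpa using orbitLabel_flowPt (a := 1) (t := t) one_pos le_rfl

/-- Every point of the open upper hemisphere, except for the pole, has flow coordinates. -/
theorem exists_flowPt {p : E3} (hp : p ∈ S2) (h0 : 0 < p 2) (h1 : p 2 < 1) :
    ∃ q : ℝ × ℝ, q.1 ∈ Ico (0 : ℝ) 1 ∧ flowPt q = p := by
  rw [mem_S2_iff] at hp
  have hz : height (heightTime (p 2)) = p 2 := height_heightTime ⟨h0, h1⟩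
  set w : ℂ := ⟨p 0, p 1⟩ with hw
  have hnorm : ‖w‖ = √(1 - p 2 ^ 2) := by
    rw [Complex.norm_eq_sqrt_sq_add_sq]
    congr 1
    simp only [hw]
    linarith
  have hw0 : w ≠ 0 := by
    intro h
    rw [h, norm_zero] at hnorm
    have : 0 < √(1 - p 2 ^ 2) := Real.sqrt_pos.2 (by nlinarith)
    linarith
  have hpi := Real.pi_pos
  refine ⟨(Int.fract (w.arg / (2 * Real.pi) + 1 / p 2), heightTime (p 2)),
    ⟨Int.fract_nonneg _, Int.fract_lt_one _⟩, ?_⟩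
  have hang : 2 * Real.pi * (Int.fract (w.arg / (2 * Real.pi) + 1 / p 2) - 1 / p 2) =
      w.arg - ⌊w.arg / (2 * Real.pi) + 1 / p 2⌋ * (2 * Real.pi) := by
    rw [Int.fract]
    field_simp
    ring
  simp only [flowPt, hz, hang, Real.cos_sub_int_mul_two_pi, Real.sin_sub_int_mul_two_pi, ← hnorm]
  apply E3.ext'
  · rw [pt_zero, Complex.norm_mul_cos_arg]
  · rw [pt_one, Complex.norm_mul_sin_arg]
  · rfl

/-! ### Lifting planar functions to `ℝ³` -/

/-- `f` vanishes outside of the rectangle `[m, 1 - m] × [0, h]`. -/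
def SupportedInStrip (f : ℝ × ℝ → ℝ) (m h : ℝ) : Prop :=
  0 < m ∧ ∀ q : ℝ × ℝ, q ∉ Icc m (1 - m) ×ˢ Icc 0 h → f q = 0

open Classical in
/-- The function on `ℝ³` which is given by `f` in flow coordinates on the upper hemisphere. -/
noncomputable def liftFun (f : ℝ × ℝ → ℝ) (p : E3) : ℝ :=
  if 0 < p 2 ∧ 0 < p 0 ^ 2 + p 1 ^ 2 then
    -- This factor is one on the sphere and vanishes in the ball of radius `1/2`, which removes the
    -- singularity of the coordinates at the origin.
    Real.smoothTransition (4 * (p 0 ^ 2 + p 1 ^ 2 + p 2 ^ 2) - 1) *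
      f (orbitLabel p, flowTime (p 2) (p 0 ^ 2 + p 1 ^ 2))
  else 0

section Lift

variable {f : ℝ × ℝ → ℝ} {m h : ℝ}

theorem liftFun_eq_zero (hf : SupportedInStrip f m h) {p : E3}
    (hp : 0 < p 2 → 0 < p 0 ^ 2 + p 1 ^ 2 → 1 / 4 < p 0 ^ 2 + p 1 ^ 2 + p 2 ^ 2 →
      orbitLabel p ∈ Icc m (1 - m) → flowTime (p 2) (p 0 ^ 2 + p 1 ^ 2) ∈ Icc 0 h → False) :
    liftFun f p = 0 := by
  unfold liftFun
  split_ifs with h1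
  · by_cases h2 : 1 / 4 < p 0 ^ 2 + p 1 ^ 2 + p 2 ^ 2
    · rw [hf.2 _ (fun h3 => hp h1.1 h1.2 h2 h3.1 h3.2), mul_zero]
    · rw [Real.smoothTransition.zero_of_nonpos (by linarith), zero_mul]
  · rfl

theorem liftFun_of_nonpos {p : E3} (hp : p 2 ≤ 0) : liftFun f p = 0 :=
  if_neg fun h => absurd h.1 (not_lt.2 hp)

/-- On the sphere these heights correspond to negative times, where the planar function vanishes. -/
theorem liftFun_of_low (hf : SupportedInStrip f m h) {p : E3} (hp : p ∈ S2) (h1 : p 2 ≤ 1 / 2) :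
    liftFun f p = 0 := by
  refine liftFun_eq_zero hf fun h2 _ _ _ h3 => ?_
  rw [mem_S2_iff] at hp
  have := heightTime_neg h2 h1
  unfold heightTime at this
  rw [show 1 - p 2 ^ 2 = p 0 ^ 2 + p 1 ^ 2 by linarith] at this
  linarith [h3.1]

/-- Labels are read in `(0, 1]`, so `0` is read as `1`; this is harmless since `f` vanishes on both
edges of the strip. -/
theorem liftFun_flowPt (hf : SupportedInStrip f m h) {q : ℝ × ℝ} (hq : q.1 ∈ Icc (0 : ℝ) 1) :
    liftFun f (flowPt q) = f q := by
  have hS := mem_S2_iff.1 (flowPt_mem_S2 q)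
  have hz : flowPt q 2 = height q.2 := rfl
  have hm := height_mem q.2
  have hpos := one_sub_height_sq_pos q.2
  have hρ : flowPt q 0 ^ 2 + flowPt q 1 ^ 2 = 1 - height q.2 ^ 2 := by rw [← hz]; linarith
  unfold liftFun
  rw [hρ, hz, if_pos ⟨hm.1, hpos⟩, Real.smoothTransition.one_of_one_le (by linarith), one_mul]
  have hT : flowTime (height q.2) (1 - height q.2 ^ 2) = q.2 := heightTime_height q.2
  rw [hT]
  rcases hq.1.eq_or_lt with h0 | h0
  · have h1 : q = (0, q.2) := Prod.ext h0.symm rfl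
    rw [h1, orbitLabel_flowPt_zero]
    rw [hf.2 _ fun h3 => ?_, hf.2 _ fun h3 => ?_]
    · have := h3.1.1; simp only at this; linarith [hf.1]
    · have := h3.1.2; simp only at this; linarith [hf.1]
  · have h1 : q = (q.1, q.2) := rfl
    rw [h1, orbitLabel_flowPt h0 hq.2]

/-! ### Smoothness of lifted functions. -/

theorem contDiff_horiz : ContDiff ℝ ∞ fun p : E3 => p 0 ^ 2 + p 1 ^ 2 :=
  ((contDiff_coord 0).pow 2).add ((contDiff_coord 1).pow 2)

/-- Near the positive half-axis `log ρ` tends to `-∞` and pushes the time beyond `h`. This is why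
`flowTime` takes `ρ` as an argument of its own: the support avoids a neighbourhood in space, not
only in the sphere. -/
theorem liftFun_eventually_zero_of_axis (hf : SupportedInStrip f m h) {p : E3}
    (hp : p 0 ^ 2 + p 1 ^ 2 = 0) : ∀ᶠ q in 𝓝 p, liftFun f q = 0 := by
  have hcz : Continuous fun q : E3 => q 2 := (contDiff_coord 2).continuous
  have hcρ : Continuous fun q : E3 => q 0 ^ 2 + q 1 ^ 2 := contDiff_horiz.continuous
  rcases lt_trichotomy (p 2) 0 with hz | hz | hz
  · filter_upwards [hcz.continuousAt.eventually_lt_const hz] with q hq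
    exact liftFun_of_nonpos hq.le
  · have hc : Continuous fun q : E3 => q 0 ^ 2 + q 1 ^ 2 + q 2 ^ 2 := hcρ.add (hcz.pow 2)
    have : ∀ᶠ q in 𝓝 p, q 0 ^ 2 + q 1 ^ 2 + q 2 ^ 2 < 1 / 4 :=
      hc.continuousAt.eventually_lt_const (by simp only [hp, hz]; norm_num)
    filter_upwards [this] with q hq
    exact liftFun_eq_zero hf fun _ _ h3 _ _ => by linarith
  · have h1 : ∀ᶠ q in 𝓝 p, p 2 / 2 < q 2 := hcz.continuousAt.eventually_const_lt (by linarith)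
    have h2 : ∀ᶠ q in 𝓝 p, q 0 ^ 2 + q 1 ^ 2 < Real.exp (-2 * (2 / p 2 + |h| + 1)) :=
      hcρ.continuousAt.eventually_lt_const (by simp only [hp]; exact Real.exp_pos _)
    filter_upwards [h1, h2] with q hq1 hq2
    refine liftFun_eq_zero hf fun h3 h4 _ _ h5 => ?_
    have e1 : Real.log (q 0 ^ 2 + q 1 ^ 2) < -2 * (2 / p 2 + |h| + 1) :=
      (Real.log_lt_iff_lt_exp h4).2 hq2
    have e2 : 0 ≤ Real.log (1 + q 2) := Real.log_nonneg (by linarith)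
    have e3 : 1 / q 2 ≤ 2 / p 2 := by
      rw [div_le_div_iff₀ h3 hz]; linarith
    have e4 := h5.2
    unfold flowTime at e4
    linarith [le_abs_self h]

/-- From above, the term `-(1 / z)` tends to `-∞` while the logarithms stay bounded below in `ρ`, so
the time becomes negative. -/
theorem liftFun_eventually_zero_of_equator (hf : SupportedInStrip f m h) {p : E3}
    (hz : p 2 = 0) (hp : 0 < p 0 ^ 2 + p 1 ^ 2) : ∀ᶠ q in 𝓝 p, liftFun f q = 0 := by
  have hcz : Continuous fun q : E3 => q 2 := (contDiff_coord 2).continuous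
  have hcρ : Continuous fun q : E3 => q 0 ^ 2 + q 1 ^ 2 := contDiff_horiz.continuous
  set r := (p 0 ^ 2 + p 1 ^ 2) / 2 with hr
  have hr0 : 0 < r := half_pos hp
  have hpos : 0 < 1 / (|Real.log r| + 2) := by positivity
  have h1 : ∀ᶠ q in 𝓝 p, q 2 < 1 / (|Real.log r| + 2) :=
    hcz.continuousAt.eventually_lt_const (by simp only [hz]; exact hpos)
  have h2 : ∀ᶠ q in 𝓝 p, r < q 0 ^ 2 + q 1 ^ 2 :=
    hcρ.continuousAt.eventually_const_lt (by linarith)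
  filter_upwards [h1, h2] with q hq1 hq2
  refine liftFun_eq_zero hf fun h3 h4 _ _ h5 => ?_
  have e1 : Real.log r < Real.log (q 0 ^ 2 + q 1 ^ 2) := Real.log_lt_log hr0 hq2
  have e2 : |Real.log r| + 2 < 1 / q 2 := by
    rw [lt_div_iff₀ h3]
    rw [lt_div_iff₀ (by positivity)] at hq1
    linarith
  have e3 : Real.log (1 + q 2) ≤ q 2 := by
    have := Real.log_le_sub_one_of_pos (show (0 : ℝ) < 1 + q 2 by linarith)
    linarith
  have e4 : q 2 < 1 := hq1.trans_le (by
    rw [div_le_one (by positivity)]; linarith [abs_nonneg (Real.log r)])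
  have e5 := h5.1
  unfold flowTime at e5
  linarith [neg_abs_le (Real.log r), abs_nonneg (Real.log r)]

theorem labelCplx_contDiffAt {p : E3} (hz : p 2 ≠ 0) : ContDiffAt ℝ ∞ labelCplx p := by
  have h0 := (contDiff_coord 0).contDiffAt (x := p)
  have h1 := (contDiff_coord 1).contDiffAt (x := p)
  have h2 : ContDiffAt ℝ ∞ (fun p : E3 => 2 * Real.pi / p 2) p :=
    contDiffAt_const.div (contDiff_coord 2).contDiffAt hz
  have e : labelCplx = fun p : E3 => (Complex.equivRealProdCLM.symm : ℝ × ℝ →L[ℝ] ℂ)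
      (p 0 * Real.cos (2 * Real.pi / p 2) - p 1 * Real.sin (2 * Real.pi / p 2),
        p 0 * Real.sin (2 * Real.pi / p 2) + p 1 * Real.cos (2 * Real.pi / p 2)) := by
    funext p
    apply Complex.ext <;> simp [labelCplx]
  rw [e]
  exact (Complex.equivRealProdCLM.symm : ℝ × ℝ →L[ℝ] ℂ).contDiff.contDiffAt.comp p
    (((h0.mul h2.cos).sub (h1.mul h2.sin)).prodMk ((h0.mul h2.sin).add (h1.mul h2.cos)))

theorem labelCplx_normSq (p : E3) : Complex.normSq (labelCplx p) = p 0 ^ 2 + p 1 ^ 2 := by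
  rw [Complex.normSq_apply]
  simp only [labelCplx]
  have := Real.cos_sq_add_sin_sq (2 * Real.pi / p 2)
  linear_combination (p 0 ^ 2 + p 1 ^ 2) * this

theorem orbitLabel_contDiffAt {p : E3} (hz : p 2 ≠ 0) (hs : -labelCplx p ∈ Complex.slitPlane) :
    ContDiffAt ℝ ∞ orbitLabel p := by
  have h1 : ContDiffAt ℝ ∞ (fun p => Complex.log (-labelCplx p)) p :=
    ContDiffAt.comp (g := Complex.log) (f := fun p => -labelCplx p) p
      ((Complex.contDiffAt_log hs).restrict_scalars ℝ) (labelCplx_contDiffAt hz).neg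
  have h2 : ContDiffAt ℝ ∞ (fun p => (Complex.log (-labelCplx p)).im) p :=
    Complex.imCLM.contDiff.contDiffAt.comp p h1
  simp only [Complex.log_im] at h2
  exact (h2.add contDiffAt_const).div_const _

/-- Near the cut of the label the lifted functions vanish. -/
theorem liftFun_eventually_zero_of_cut (hf : SupportedInStrip f m h) {p : E3} (hz : p 2 ≠ 0)
    (hp : 0 < p 0 ^ 2 + p 1 ^ 2) (hs : -labelCplx p ∉ Complex.slitPlane) :
    ∀ᶠ q in 𝓝 p, liftFun f q = 0 := by
  by_cases hm : 1 - m < m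
  · refine Eventually.of_forall fun q => liftFun_eq_zero hf fun _ _ _ h4 _ => ?_
    linarith [h4.1, h4.2]
  push Not at hm
  have hm0 := hf.1
  have hpi := Real.pi_pos
  rw [Complex.mem_slitPlane_iff] at hs
  push Not at hs
  simp only [Complex.neg_re, Complex.neg_im, neg_eq_zero] at hs
  have hre : ‖labelCplx p‖ = (labelCplx p).re := by
    rw [Complex.norm_eq_sqrt_sq_add_sq, hs.2]
    simpa using Real.sqrt_sq (by linarith [hs.1] : 0 ≤ (labelCplx p).re)
  have hne : 0 < ‖labelCplx p‖ := by
    rw [norm_pos_iff]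
    intro h0
    have := labelCplx_normSq p
    rw [h0, map_zero] at this
    linarith
  have hcos : Real.cos (2 * Real.pi * m) < 1 := by
    rw [← Real.cos_zero]
    exact Real.cos_lt_cos_of_nonneg_of_le_pi le_rfl (by nlinarith) (by positivity)
  have hc := (labelCplx_contDiffAt hz).continuousAt
  -- At `p` the number `labelCplx p` is real and positive, so nearby its argument is less than `2πm`
  -- in absolute value; labels in `[m, 1 - m]` need at least `2πm`.
  have hev : ∀ᶠ q in 𝓝 p, Real.cos (2 * Real.pi * m) * ‖labelCplx q‖ < (labelCplx q).re := by
    refine ContinuousAt.eventually_lt (hc.norm.const_mul _)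
      (Complex.continuous_re.continuousAt.comp hc) ?_
    simp only [← hre]
    nlinarith
  filter_upwards [hev] with q hq
  refine liftFun_eq_zero hf fun _ _ _ h4 _ => ?_
  set θ := (-labelCplx q).arg with hθ
  have h5 : m * (2 * Real.pi) ≤ θ + Real.pi := (le_div_iff₀ (by positivity)).1 h4.1
  have h6 : θ + Real.pi ≤ (1 - m) * (2 * Real.pi) := (div_le_iff₀ (by positivity)).1 h4.2
  have habs : |θ| ≤ Real.pi - 2 * Real.pi * m := by
    rw [abs_le]; constructor <;> nlinarith
  have h7 : -Real.cos (2 * Real.pi * m) ≤ Real.cos θ := by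
    rw [← Real.cos_pi_sub, ← Real.cos_abs θ]
    exact Real.cos_le_cos_of_nonneg_of_le_pi (abs_nonneg _) (by nlinarith) habs
  have h8 : ‖labelCplx q‖ * Real.cos θ = -(labelCplx q).re := by
    have := Complex.norm_mul_cos_arg (-labelCplx q)
    rwa [norm_neg, Complex.neg_re, ← hθ] at this
  nlinarith [norm_nonneg (labelCplx q)]

theorem liftFun_contDiff (hf : SupportedInStrip f m h) (hsm : ContDiff ℝ ∞ f) :
    ContDiff ℝ ∞ (liftFun f) := by
  rw [contDiff_iff_contDiffAt]
  intro p
  have hzero : (∀ᶠ q in 𝓝 p, liftFun f q = 0) → ContDiffAt ℝ ∞ (liftFun f) p := fun h0 =>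
    (contDiffAt_const (c := (0 : ℝ))).congr_of_eventuallyEq h0
  have hcz : Continuous fun q : E3 => q 2 := (contDiff_coord 2).continuous
  have hcρ : Continuous fun q : E3 => q 0 ^ 2 + q 1 ^ 2 := contDiff_horiz.continuous
  rcases (add_nonneg (sq_nonneg (p 0)) (sq_nonneg (p 1))).eq_or_lt with hρ | hρ
  · exact hzero (liftFun_eventually_zero_of_axis hf hρ.symm)
  rcases lt_trichotomy (p 2) 0 with hz | hz | hz
  · apply hzero
    filter_upwards [hcz.continuousAt.eventually_lt_const hz] with q hq
    exact liftFun_of_nonpos hq.le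
  · exact hzero (liftFun_eventually_zero_of_equator hf hz hρ)
  by_cases hs : -labelCplx p ∈ Complex.slitPlane
  · have h1 : liftFun f =ᶠ[𝓝 p] fun q =>
        Real.smoothTransition (4 * (q 0 ^ 2 + q 1 ^ 2 + q 2 ^ 2) - 1) *
          f (orbitLabel q, flowTime (q 2) (q 0 ^ 2 + q 1 ^ 2)) := by
      filter_upwards [hcz.continuousAt.eventually_const_lt hz,
        hcρ.continuousAt.eventually_const_lt hρ] with q hq1 hq2
      exact if_pos ⟨hq1, hq2⟩
    refine ContDiffAt.congr_of_eventuallyEq ?_ h1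
    have e1 : ContDiffAt ℝ ∞ (fun q : E3 =>
        Real.smoothTransition (4 * (q 0 ^ 2 + q 1 ^ 2 + q 2 ^ 2) - 1)) p :=
      (Real.smoothTransition.contDiff.comp ((contDiff_const.mul
        (contDiff_horiz.add ((contDiff_coord 2).pow 2))).sub contDiff_const)).contDiffAt
    have e2 : ContDiffAt ℝ ∞ (fun q : E3 => flowTime (q 2) (q 0 ^ 2 + q 1 ^ 2)) p := by
      unfold flowTime
      have h2 := (contDiff_coord 2).contDiffAt (x := p)
      exact ((contDiffAt_const.div h2 hz.ne').neg.add
        ((contDiffAt_const.add h2).log (by linarith))).sub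
        ((contDiff_horiz.contDiffAt.log hρ.ne').div_const 2)
    exact e1.mul (hsm.contDiffAt.comp p ((orbitLabel_contDiffAt hz.ne' hs).prodMk e2))
  · exact hzero (liftFun_eventually_zero_of_cut hf hz.ne' hρ hs)

end Lift

/-! ### Singular points with a diagonal linearization -/

namespace SphereField

/-- The derivative of `V` at `p` is diagonal in a basis of the tangent plane. -/
def IsDiagonalAt (V : SphereField) (p : E3) (l₁ l₂ : ℝ) : Prop :=
  ∃ u₁ u₂ : E3, ⟪p, u₁⟫ = 0 ∧ ⟪p, u₂⟫ = 0 ∧ LinearIndependent ℝ ![u₁, u₂] ∧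
    fderiv ℝ V.toFun p u₁ = l₁ • u₁ ∧ fderiv ℝ V.toFun p u₂ = l₂ • u₂

theorem linearization_eq_smul {V : SphereField} {p u : E3} {l : ℝ} (hu : u ∈ (ℝ ∙ p)ᗮ)
    (h : fderiv ℝ V.toFun p u = l • u) : V.linearization p ⟨u, hu⟩ = l • ⟨u, hu⟩ := by
  have h1 : V.linearization p ⟨u, hu⟩ =
      ((ℝ ∙ p)ᗮ).orthogonalProjectionOnto (fderiv ℝ V.toFun p u) := rfl
  rw [h1, h, map_smul]
  congr 1
  exact Submodule.orthogonalProjectionOnto_mem_subspace_eq_self (⟨u, hu⟩ : (ℝ ∙ p)ᗮ)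

theorem IsDiagonalAt.exists_basis {V : SphereField} {p : E3} {l₁ l₂ : ℝ}
    (h : V.IsDiagonalAt p l₁ l₂) (hp : p ∈ S2) :
    ∃ b : Module.Basis (Fin 2) ℝ ((ℝ ∙ p)ᗮ : Submodule ℝ E3),
      V.linearization p (b 0) = l₁ • b 0 ∧ V.linearization p (b 1) = l₂ • b 1 := by
  obtain ⟨u₁, u₂, h1, h2, hli, e1, e2⟩ := h
  have m1 : u₁ ∈ (ℝ ∙ p)ᗮ := Submodule.mem_orthogonal_singleton_iff_inner_right.2 h1
  have m2 : u₂ ∈ (ℝ ∙ p)ᗮ := Submodule.mem_orthogonal_singleton_iff_inner_right.2 h2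
  have hli' : LinearIndependent ℝ ![(⟨u₁, m1⟩ : (ℝ ∙ p)ᗮ), ⟨u₂, m2⟩] := by
    rw [LinearIndependent.pair_iff] at hli ⊢
    exact fun s t hst => hli s t (congrArg Subtype.val hst)
  have hp0 : p ≠ 0 := by
    rintro rfl
    simp at hp
  have : Fact (Module.finrank ℝ E3 = 2 + 1) := ⟨by simp⟩
  have hrank : Fintype.card (Fin 2) = Module.finrank ℝ ((ℝ ∙ p)ᗮ : Submodule ℝ E3) := by
    rw [Submodule.finrank_orthogonal_span_singleton (n := 2) hp0, Fintype.card_fin]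
  refine ⟨basisOfLinearIndependentOfCardEqFinrank hli' hrank, ?_, ?_⟩
  · simpa using linearization_eq_smul m1 e1
  · simpa using linearization_eq_smul m2 e2

theorem IsDiagonalAt.charpoly {V : SphereField} {p : E3} {l₁ l₂ : ℝ}
    (h : V.IsDiagonalAt p l₁ l₂) (hp : p ∈ S2) : (V.linearization p).charpoly =
      (Polynomial.X - Polynomial.C l₁) * (Polynomial.X - Polynomial.C l₂) := by
  obtain ⟨b, h1, h2⟩ := h.exists_basis hp
  have hm : LinearMap.toMatrix b b (V.linearization p) = Matrix.diagonal ![l₁, l₂] := by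
    ext i j
    rw [LinearMap.toMatrix_apply]
    fin_cases j
    · fin_cases i <;> simp [h1]
    · fin_cases i <;> simp [h2]
  rw [← LinearMap.charpoly_toMatrix (V.linearization p) b, hm, Matrix.charpoly_diagonal,
    Fin.prod_univ_two]
  rfl

theorem IsDiagonalAt.isHyperbolicPoint {V : SphereField} {p : E3} {l₁ l₂ : ℝ}
    (h : V.IsDiagonalAt p l₁ l₂) (hp : V.IsSingularPoint p) (h1 : l₁ ≠ 0) (h2 : l₂ ≠ 0) :
    V.IsHyperbolicPoint p := by
  refine ⟨hp, fun z hz => ?_⟩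
  rw [h.charpoly hp.1] at hz
  simp only [map_mul, map_sub, Polynomial.aeval_X, Polynomial.aeval_C, mul_eq_zero, sub_eq_zero] at hz
  rcases hz with rfl | rfl
  · simpa using h1
  · simpa using h2

theorem IsDiagonalAt.isSaddle_iff {V : SphereField} {p : E3} {l₁ l₂ : ℝ}
    (h : V.IsDiagonalAt p l₁ l₂) (hp : V.IsSingularPoint p) : V.IsSaddle p ↔ l₁ * l₂ < 0 := by
  have hev : ∀ μ : ℝ, (V.linearization p).HasEigenvalue μ ↔ μ = l₁ ∨ μ = l₂ := by
    intro μ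
    rw [Module.End.hasEigenvalue_iff_isRoot_charpoly, h.charpoly hp.1, Polynomial.IsRoot.def]
    simp [sub_eq_zero]
  constructor
  · rintro ⟨-, a, b, ha, hb, ea, eb⟩
    rcases (hev a).1 ea with rfl | rfl <;> rcases (hev b).1 eb with rfl | rfl <;> nlinarith
  · intro hneg
    rcases mul_neg_iff.1 hneg with ⟨h1, h2⟩ | ⟨h1, h2⟩
    · exact ⟨hp, l₂, l₁, h2, h1, (hev _).2 (Or.inr rfl), (hev _).2 (Or.inl rfl)⟩
    · exact ⟨hp, l₁, l₂, h1, h2, (hev _).2 (Or.inl rfl), (hev _).2 (Or.inr rfl)⟩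

/-- The derivative of a field may be computed along curves. -/
theorem fderiv_eq_of_curve (V : SphereField) {e : ℝ → E3} {u v : E3} {t : ℝ}
    (he : HasDerivAt e u t) (hv : HasDerivAt (fun s => V.toFun (e s)) v t) :
    fderiv ℝ V.toFun (e t) u = v := by
  have h1 : HasFDerivAt V.toFun (fderiv ℝ V.toFun (e t)) (e t) :=
    (V.smooth.differentiable (by simp) _).hasFDerivAt
  exact (h1.comp_hasDerivAt t he).unique hv

/-! ### Uniqueness of solutions -/

/-- The field need not be globally Lipschitz, but it is Lipschitz on the closed unit ball, which is
compact, convex and contains the sphere. -/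
theorem IsSolution.unique {V : SphereField} {c d : ℝ → E3} (hc : V.IsSolution c)
    (hd : V.IsSolution d) {t : ℝ} (h : c t = d t) : c = d := by
  obtain ⟨K, hK⟩ := (V.smooth.contDiffOn (s := Metric.closedBall (0 : E3) 1)).exists_lipschitzOnWith
    (by simp) (convex_closedBall 0 1) (isCompact_closedBall 0 1)
  refine ODE_solution_unique_univ (v := fun _ => V.toFun) (s := fun _ => S2) (K := K)
    (fun _ => hK.mono Metric.sphere_subset_closedBall) (fun t => ⟨hc.2 t, hc.1 t⟩)
    (fun t => ⟨hd.2 t, hd.1 t⟩) h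

theorem IsSolution.shift {V : SphereField} {c : ℝ → E3} (hc : V.IsSolution c) (r : ℝ) :
    V.IsSolution fun t => c (t + r) :=
  ⟨fun _ => hc.1 _, fun t => hasDerivAt_time_shift hc.2 r t⟩

theorem IsSolution.eq_shift {V : SphereField} {c d : ℝ → E3} (hc : V.IsSolution c)
    (hd : V.IsSolution d) {s t : ℝ} (h : c s = d t) (r : ℝ) : c r = d (r + (t - s)) :=
  congrFun (hc.unique (hd.shift (t - s)) (t := s) (by simpa using h)) r

theorem isSolution_const {V : SphereField} {p : E3} (hp : V.IsSingularPoint p) :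
    V.IsSolution fun _ => p :=
  ⟨fun _ => hp.1, fun t => by rw [hp.2]; exact hasDerivAt_const t p⟩

theorem IsSolution.const {V : SphereField} {c : ℝ → E3} (hc : V.IsSolution c) {t : ℝ}
    (h : V.toFun (c t) = 0) (s : ℝ) : c s = c t :=
  congrFun (hc.unique (isSolution_const ⟨hc.1 t, h⟩) (t := t) rfl) s

end SphereField

/-! ### The half-turn -/

/-- The half-turn around the first axis. -/
noncomputable def turn (p : E3) : E3 := pt (p 0) (-p 1) (-p 2)

@[simp] theorem turn_turn (p : E3) : turn (turn p) = p := by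
  apply E3.ext' <;> simp [turn]

@[simp] theorem turn_apply_two (p : E3) : turn p 2 = -p 2 := rfl

theorem turn_contDiff : ContDiff ℝ ∞ turn :=
  contDiff_pt (contDiff_coord 0) (contDiff_coord 1).neg (contDiff_coord 2).neg

theorem turn_continuous : Continuous turn := turn_contDiff.continuous

theorem turn_injective : Function.Injective turn := Function.Involutive.injective turn_turn

theorem turn_smul (a : ℝ) (p : E3) : turn (a • p) = a • turn p := by
  apply E3.ext' <;> simp [turn]

theorem turn_add (p q : E3) : turn (p + q) = turn p + turn q := by
  apply E3.ext' <;> simp [turn] <;> ring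

theorem turn_neg (p : E3) : turn (-p) = -turn p := by
  apply E3.ext' <;> simp [turn]

theorem turn_zero : turn 0 = 0 := by
  apply E3.ext' <;> simp [turn]

theorem turn_mem_S2 {p : E3} : turn p ∈ S2 ↔ p ∈ S2 := by
  rw [mem_S2_iff, mem_S2_iff]; simp [turn]

theorem inner_turn (p q : E3) : ⟪turn p, turn q⟫ = ⟪p, q⟫ := by
  rw [inner_E3, inner_E3]; simp [turn]

theorem turn_hasDerivAt {c : ℝ → E3} {v : E3} {t : ℝ} (h : HasDerivAt c v t) :
    HasDerivAt (fun t => turn (c t)) (turn v) t :=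
  hasDerivAt_pt (hasDerivAt_coord h 0) (hasDerivAt_coord h 1).neg (hasDerivAt_coord h 2).neg

theorem turn_rotField (p : E3) : turn (rotField p) = -rotField (turn p) := by
  apply E3.ext' <;> simp [turn, rotField]

theorem turn_baseField (p : E3) : turn (baseField p) = -baseField (turn p) := by
  apply E3.ext' <;> simp [turn, baseField] <;> ring

namespace SphereField

/-- `W` is conjugate to the field `V`, with time reversed, by the half-turn. -/
def IsTurnOf (W V : SphereField) : Prop := ∀ p, W.toFun (turn p) = -turn (V.toFun p)

section Turn

variable {V W : SphereField}

theorem IsTurnOf.symm (h : W.IsTurnOf V) : V.IsTurnOf W := fun p => by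
  have h1 := h (turn p)
  rw [turn_turn] at h1
  rw [h1, turn_neg, turn_turn, neg_neg]

theorem IsTurnOf.isSolution (h : W.IsTurnOf V) {c : ℝ → E3} (hc : V.IsSolution c) :
    W.IsSolution fun t => turn (c (-t)) := by
  refine ⟨fun t => turn_mem_S2.2 (hc.1 _), fun t => ?_⟩
  rw [h]
  have h1 : HasDerivAt (fun t => c (-t)) (-V.toFun (c (-t))) t := by
    have := (hc.2 (-t)).scomp t (hasDerivAt_neg t)
    exact this.congr_deriv (by simp)
  have h2 := turn_hasDerivAt h1
  rwa [turn_neg] at h2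

theorem IsTurnOf.isSingularPoint (h : W.IsTurnOf V) {p : E3} (hp : V.IsSingularPoint p) :
    W.IsSingularPoint (turn p) :=
  ⟨turn_mem_S2.2 hp.1, by rw [h, hp.2, turn_zero, neg_zero]⟩

/-- Time reversal changes the sign of both eigenvalues; their product is preserved, so saddles
correspond to saddles. -/
theorem IsTurnOf.isDiagonalAt (h : W.IsTurnOf V) {p : E3} {l₁ l₂ : ℝ}
    (hd : V.IsDiagonalAt p l₁ l₂) : W.IsDiagonalAt (turn p) (-l₁) (-l₂) := by
  obtain ⟨u₁, u₂, h1, h2, hli, e1, e2⟩ := hd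
  have key : ∀ (u : E3) (l : ℝ), fderiv ℝ V.toFun p u = l • u →
      fderiv ℝ W.toFun (turn p) (turn u) = -l • turn u := by
    intro u l hu
    have hc : HasDerivAt (fun s : ℝ => p + s • u) u 0 := by
      simpa using ((hasDerivAt_id' (0 : ℝ)).smul_const u).const_add p
    have hV : HasFDerivAt V.toFun (fderiv ℝ V.toFun p) (p + (0 : ℝ) • u) := by
      rw [zero_smul, add_zero]
      exact (V.smooth.differentiable (by simp) _).hasFDerivAt
    have hVc : HasDerivAt (fun s : ℝ => V.toFun (p + s • u)) (l • u) 0 := by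
      rw [← hu]; exact hV.comp_hasDerivAt 0 hc
    have hW : HasDerivAt (fun s : ℝ => W.toFun (turn (p + s • u))) (-l • turn u) 0 := by
      simp only [h _]
      rw [neg_smul, ← turn_smul]
      exact (turn_hasDerivAt hVc).neg
    have := W.fderiv_eq_of_curve (turn_hasDerivAt hc) hW
    simpa using this
  refine ⟨turn u₁, turn u₂, by rwa [inner_turn], by rwa [inner_turn], ?_, key _ _ e1, key _ _ e2⟩
  rw [LinearIndependent.pair_iff] at hli ⊢
  intro s t hst
  apply hli
  apply turn_injective
  rw [turn_add, turn_smul, turn_smul, turn_zero, hst]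

theorem IsTurnOf.isStableSeparatrix (h : W.IsTurnOf V) {p : E3} {c : ℝ → E3}
    (hc : V.IsStableSeparatrix p c) : W.IsUnstableSeparatrix (turn p) fun t => turn (c (-t)) :=
  ⟨h.isSolution hc.1, fun _ ht => hc.2.1 _ (turn_injective ht),
    (turn_continuous.tendsto p).comp (hc.2.2.comp tendsto_neg_atBot_atTop)⟩

theorem IsTurnOf.isUnstableSeparatrix (h : W.IsTurnOf V) {p : E3} {c : ℝ → E3}
    (hc : V.IsUnstableSeparatrix p c) : W.IsStableSeparatrix (turn p) fun t => turn (c (-t)) :=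
  ⟨h.isSolution hc.1, fun _ ht => hc.2.1 _ (turn_injective ht),
    (turn_continuous.tendsto p).comp (hc.2.2.comp tendsto_neg_atTop_atBot)⟩

theorem IsTurnOf.isSeparatrix (h : W.IsTurnOf V) {p : E3} {c : ℝ → E3}
    (hc : V.IsSeparatrix p c) : W.IsSeparatrix (turn p) fun t => turn (c (-t)) :=
  hc.elim (fun hc => Or.inr (h.isStableSeparatrix hc)) fun hc => Or.inl (h.isUnstableSeparatrix hc)

/-- Time reversal exchanges the ends of the orbit arc, so on a symmetric section the return map is
conjugated to its inverse. -/
theorem IsTurnOf.firstReturn (h : W.IsTurnOf V) {G : Set E3} (hG : ∀ p ∈ G, turn p ∈ G) {x y : E3}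
    (hx : x ∈ G) (hr : V.FirstReturn G x y) : W.FirstReturn G (turn y) (turn x) := by
  obtain ⟨c, τ, hc, hτ, h0, h1, -, hav⟩ := hr
  refine ⟨fun t => turn (c (-(t + -τ))), τ, (h.isSolution hc).shift (-τ), hτ, by simp [h1],
    by simp [h0], hG x hx, fun t ht hmem => ?_⟩
  refine hav (-(t + -τ)) ⟨by linarith [ht.2], by linarith [ht.1]⟩ ?_
  simpa using hG _ hmem

end Turn

end SphereField

/-! ### Planar models: invariance of the strip -/

namespace PlanarModel

variable (M : PlanarModel)

theorem β_strip : SupportedInStrip M.β M.margin M.height := ⟨M.margin_pos, fun q hq => (M.supp q hq).2⟩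

theorem κ_strip : SupportedInStrip M.κ M.margin M.height := ⟨M.margin_pos, fun q hq => (M.supp q hq).1⟩

theorem exists_lipschitz : ∃ K : NNReal, LipschitzWith K (planarField M.κ M.β) :=
  planarField_lipschitz M.κ_smooth M.β_smooth (isCompact_Icc.prod isCompact_Icc) M.supp

theorem exists_solution (q : ℝ × ℝ) : ∃ c, c 0 = q ∧ IsPlanarSolution M.κ M.β c :=
  planarField_complete M.κ_smooth M.β_smooth (isCompact_Icc.prod isCompact_Icc) M.supp q

theorem fields_outside {q : ℝ × ℝ} (hq : q.1 ∉ Ioo (0 : ℝ) 1) : M.κ q = 0 ∧ M.β q = 0 :=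
  M.supp q fun h => hq ⟨by linarith [M.margin_pos, h.1.1], by linarith [M.margin_pos, h.1.2]⟩

theorem mem_Ioo_of_singular {q : ℝ × ℝ} (h : M.β q = 1) : q.1 ∈ Ioo (0 : ℝ) 1 := by
  by_contra hq
  rw [(M.fields_outside hq).2] at h
  norm_num at h

/-- Off the open strip the solutions are vertical lines, so a solution that is outside at one moment
has the same first coordinate at all times. -/
theorem strip_invariant {c : ℝ → ℝ × ℝ} (hc : IsPlanarSolution M.κ M.β c) {s : ℝ}
    (hs : (c s).1 ∈ Ico (0 : ℝ) 1) (t : ℝ) : (c t).1 ∈ Ico (0 : ℝ) 1 := by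
  by_contra ht
  have hout : (c t).1 ∉ Ioo (0 : ℝ) 1 := fun h => ht (Ioo_subset_Ico_self h)
  obtain ⟨K, hK⟩ := M.exists_lipschitz
  have h1 := ode_solution_unique hK hc (d := fun r => ((c t).1, (c t).2 + (r - t))) (t₀ := t)
    (fun r => by
      have h2 := M.fields_outside (q := ((c t).1, (c t).2 + (r - t))) hout
      have : planarField M.κ M.β ((c t).1, (c t).2 + (r - t)) = (0, 1) := by
        simp [planarField, h2.1, h2.2]
      rw [this]
      exact (hasDerivAt_const r _).prodMk (((hasDerivAt_id' r).sub_const t).const_add _))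
    (by simp)
  have h3 : (c s).1 = (c t).1 := by rw [congrFun h1 s]
  rw [h3] at hs
  exact ht hs

/-- The solution which is vertical up to the time `0`. -/
theorem exists_vertical (a : ℝ) : ∃ c, IsPlanarSolution M.κ M.β c ∧ ∀ t ≤ 0, c t = (a, t) := by
  obtain ⟨K, hK⟩ := M.exists_lipschitz
  obtain ⟨c, h0, hc⟩ := M.exists_solution (a, 0)
  refine ⟨c, hc, fun t ht => ?_⟩
  refine ode_solution_unique_left hK (t₀ := 0) (fun s _ => hc s) (d := fun t => (a, t))
    (fun s hs => ?_) h0 ht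
  have h2 := M.nonpos (a, s) hs
  have : planarField M.κ M.β (a, s) = (0, 1) := by simp [planarField, h2.1, h2.2]
  rw [this]
  exact (hasDerivAt_const s _).prodMk (hasDerivAt_id' s)

end PlanarModel

/-! ### Flow coordinates: injectivity and continuity -/

theorem flowPt_injective {q q' : ℝ × ℝ} (hq : q.1 ∈ Ico (0 : ℝ) 1) (hq' : q'.1 ∈ Ico (0 : ℝ) 1)
    (h : flowPt q = flowPt q') : q = q' := by
  have h2 : height q.2 = height q'.2 := congrArg (fun p : E3 => p 2) h
  have ht : q.2 = q'.2 := height_strictMono.injective h2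
  have hl : orbitLabel (flowPt q) = orbitLabel (flowPt q') := by rw [h]
  refine Prod.ext ?_ ht
  have key : ∀ r : ℝ × ℝ, r.1 ∈ Ico (0 : ℝ) 1 →
      (r.1 = 0 ∧ orbitLabel (flowPt r) = 1) ∨ (0 < r.1 ∧ orbitLabel (flowPt r) = r.1) := by
    intro r hr
    rcases hr.1.eq_or_lt with h0 | h0
    · left
      have h1 : r = (0, r.2) := Prod.ext h0.symm rfl
      refine ⟨h0.symm, ?_⟩
      rw [h1]
      exact orbitLabel_flowPt_zero _
    · exact Or.inr ⟨h0, orbitLabel_flowPt h0 hr.2.le⟩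
  rcases key q hq with ⟨e1, e2⟩ | ⟨e1, e2⟩ <;> rcases key q' hq' with ⟨e3, e4⟩ | ⟨e3, e4⟩
  · rw [e1, e3]
  · rw [e2, e4] at hl; linarith [hq'.2]
  · rw [e2, e4] at hl; linarith [hq.2]
  · rwa [e2, e4] at hl

theorem height_continuous : Continuous height := continuous_iff_continuousAt.2 height_continuousAt

theorem flowPt_continuous : Continuous flowPt := by
  have h : ContDiff ℝ 0 (fun p : ℝ × ℝ × ℝ => pt p.1 p.2.1 p.2.2) :=
    (contDiff_pt contDiff_fst (contDiff_fst.comp contDiff_snd)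
      (contDiff_snd.comp contDiff_snd)).of_le (by simp)
  have h1 : Continuous fun q : ℝ × ℝ => height q.2 := height_continuous.comp continuous_snd
  have h2 : Continuous fun q : ℝ × ℝ => 2 * Real.pi * (q.1 - 1 / height q.2) :=
    continuous_const.mul (continuous_fst.sub
      (continuous_const.div h1 fun q => (height_mem q.2).1.ne'))
  have h3 : Continuous fun q : ℝ × ℝ => √(1 - height q.2 ^ 2) :=
    (continuous_const.sub (h1.pow 2)).sqrt
  exact h.continuous.comp ((h3.mul (Real.continuous_cos.comp h2)).prodMk
    ((h3.mul (Real.continuous_sin.comp h2)).prodMk h1))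

theorem orbitLabel_continuousAt {q : ℝ × ℝ} (hq : q.1 ∈ Ioo (0 : ℝ) 1) :
    ContinuousAt orbitLabel (flowPt q) := by
  have hpi := Real.pi_pos
  refine (orbitLabel_contDiffAt (height_mem q.2).1.ne' ?_).continuousAt
  rw [Complex.mem_slitPlane_iff_arg]
  constructor
  · intro h
    have h1 : orbitLabel (flowPt q) = q.1 := orbitLabel_flowPt hq.1 hq.2.le
    unfold orbitLabel at h1
    rw [h] at h1
    have : (Real.pi + Real.pi) / (2 * Real.pi) = 1 := by field_simp; norm_num
    linarith [hq.2]
  · intro h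
    have h1 := labelCplx_normSq (flowPt q)
    rw [neg_eq_zero.1 h, map_zero] at h1
    have h2 := mem_S2_iff.1 (flowPt_mem_S2 q)
    have h3 : flowPt q 2 = height q.2 := rfl
    have := one_sub_height_sq_pos q.2
    rw [h3] at h2
    linarith

/-- The inverse coordinates are continuous away from the cut. Points with label `0` are read as `1`,
and a limit label below `1` excludes them eventually. -/
theorem tendsto_of_tendsto_flowPt {ψ : ℝ → ℝ × ℝ} {l : Filter ℝ} {q : ℝ × ℝ}
    (hψ : ∀ t, (ψ t).1 ∈ Ico (0 : ℝ) 1) (hq : q.1 ∈ Ioo (0 : ℝ) 1)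
    (h : Tendsto (fun t => flowPt (ψ t)) l (𝓝 (flowPt q))) : Tendsto ψ l (𝓝 q) := by
  have h1 : Tendsto (fun t => (ψ t).1) l (𝓝 q.1) := by
    have h2 := (orbitLabel_continuousAt hq).tendsto.comp h
    have h3 : orbitLabel (flowPt q) = q.1 := orbitLabel_flowPt hq.1 hq.2.le
    rw [h3] at h2
    refine h2.congr' ?_
    filter_upwards [h2.eventually_lt_const hq.2] with t ht
    have h4 := hψ t
    rcases h4.1.eq_or_lt with h0 | h0
    · exfalso
      have h5 : ψ t = (0, (ψ t).2) := Prod.ext h0.symm rfl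
      have h6 : orbitLabel (flowPt (ψ t)) = 1 := by rw [h5]; exact orbitLabel_flowPt_zero _
      exact absurd ht (by simp [h6])
    · exact orbitLabel_flowPt h0 h4.2.le
  have h2 : Tendsto (fun t => (ψ t).2) l (𝓝 q.2) := by
    have h3 : Tendsto (fun t => flowPt (ψ t) 2) l (𝓝 (flowPt q 2)) :=
      ((contDiff_coord 2).continuous.tendsto _).comp h
    have hm := height_mem q.2
    have h4 := (heightTime_hasDerivAt hm.1 hm.2).continuousAt.tendsto.comp h3
    rw [heightTime_height] at h4
    refine h4.congr fun t => ?_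
    exact heightTime_height _
  exact h1.prodMk_nhds h2

/-! ### The vector field of a pair of planar models -/

/-- The field which is given by the models `M` and `N` on the upper and the lower hemisphere. -/
noncomputable def modelField (M N : PlanarModel) : SphereField where
  toFun p := (1 - liftFun M.β p - liftFun N.β (turn p)) • baseField p +
    (liftFun M.κ p + liftFun N.κ (turn p)) • (2 * Real.pi) • rotField p
  smooth := by
    have h1 := liftFun_contDiff M.β_strip M.β_smooth
    have h2 := liftFun_contDiff M.κ_strip M.κ_smooth
    have h3 := (liftFun_contDiff N.β_strip N.β_smooth).comp turn_contDiff
    have h4 := (liftFun_contDiff N.κ_strip N.κ_smooth).comp turn_contDiff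
    have h5 : ContDiff ℝ ∞ fun p => (2 * Real.pi) • rotField p :=
      rotField_contDiff.const_smul (2 * Real.pi)
    exact (((contDiff_const.sub h1).sub h3).smul baseField_contDiff).add
      ((h2.add h4).smul h5)
  tangent p hp := by
    rw [inner_add_right, inner_smul_right, inner_smul_right, inner_smul_right, inner_rotField,
      inner_baseField hp]
    simp

/-- The equator. -/
def equator : Set E3 := {p | p ∈ S2 ∧ p 2 = 0}

theorem turn_mem_equator {p : E3} : turn p ∈ equator ↔ p ∈ equator := by
  simp only [equator, mem_ofPred_eq, turn_mem_S2, turn_apply_two, neg_eq_zero]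

section ModelField

variable (M N : PlanarModel)

/-- The half-turn reverses the unperturbed and the rotation fields and exchanges the two
perturbations, so the lower hemisphere of `(M, N)` is the time-reversed upper hemisphere of `(N,
M)`. -/
theorem modelField_turn : (modelField N M).IsTurnOf (modelField M N) := by
  intro p
  simp only [modelField, turn_turn, turn_add, turn_smul, turn_baseField, turn_rotField]
  module

theorem modelField_flowPt {q : ℝ × ℝ} (hq : q.1 ∈ Icc (0 : ℝ) 1) :
    (modelField M N).toFun (flowPt q) =
      M.κ q • (2 * Real.pi) • rotField (flowPt q) + (1 - M.β q) • baseField (flowPt q) := by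
  have h : turn (flowPt q) 2 ≤ 0 := by
    rw [turn_apply_two]
    have : flowPt q 2 = height q.2 := rfl
    rw [this]
    linarith [(height_mem q.2).1]
  simp only [modelField, liftFun_flowPt M.β_strip hq, liftFun_flowPt M.κ_strip hq,
    liftFun_of_nonpos h]
  module

theorem modelField_low {p : E3} (hp : p ∈ S2) (h : |p 2| ≤ 1 / 2) :
    (modelField M N).toFun p = baseField p := by
  have h' := abs_le.1 h
  have hp' := turn_mem_S2.2 hp
  have h2 : turn p 2 ≤ 1 / 2 := by rw [turn_apply_two]; linarith
  simp only [modelField, liftFun_of_low M.β_strip hp h'.2, liftFun_of_low M.κ_strip hp h'.2,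
    liftFun_of_low N.β_strip hp' h2, liftFun_of_low N.κ_strip hp' h2]
  simp

theorem modelField_axis {p : E3} (hp : p 0 ^ 2 + p 1 ^ 2 = 0) :
    ∀ᶠ q in 𝓝 p, (modelField M N).toFun q = baseField q := by
  have hp' : turn p 0 ^ 2 + turn p 1 ^ 2 = 0 := by simpa [turn] using hp
  have ht := turn_continuous.tendsto p
  filter_upwards [liftFun_eventually_zero_of_axis M.β_strip hp,
    liftFun_eventually_zero_of_axis M.κ_strip hp,
    ht.eventually (liftFun_eventually_zero_of_axis N.β_strip hp'),
    ht.eventually (liftFun_eventually_zero_of_axis N.κ_strip hp')] with q h1 h2 h3 h4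
  simp only [modelField, h1, h2, h3, h4]
  simp

/-! ### Singular points of the model field. -/

theorem baseField_ne_zero {p : E3} (hp : p ∈ S2) (h : |p 2| < 1) : baseField p ≠ 0 := by
  intro h0
  rw [mem_S2_iff] at hp
  have hsq : p 2 ^ 2 < 1 := by rwa [sq_lt_one_iff_abs_lt_one]
  have e2 : p 2 ^ 2 * (1 - p 2 ^ 2) = 0 := congrArg (fun q : E3 => q 2) h0
  have hz : p 2 = 0 := by
    rcases mul_eq_zero.1 e2 with h | h
    · exact pow_eq_zero_iff two_ne_zero |>.1 h
    · linarith
  have e0 : -(2 * Real.pi * (1 - p 2 ^ 2) * p 1) - p 2 ^ 3 * p 0 = 0 :=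
    congrArg (fun q : E3 => q 0) h0
  have e1 : 2 * Real.pi * (1 - p 2 ^ 2) * p 0 - p 2 ^ 3 * p 1 = 0 :=
    congrArg (fun q : E3 => q 1) h0
  rw [hz] at e0 e1 hp
  have hpi := Real.pi_pos.ne'
  have h1 : p 1 = 0 := by
    have : Real.pi * p 1 = 0 := by linarith
    exact (mul_eq_zero.1 this).resolve_left hpi
  have h2 : p 0 = 0 := by
    have : Real.pi * p 0 = 0 := by linarith
    exact (mul_eq_zero.1 this).resolve_left hpi
  rw [h1, h2] at hp
  norm_num at hp

theorem singular_height_ne_zero {p : E3} (hp : (modelField M N).IsSingularPoint p) : p 2 ≠ 0 := by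
  intro h
  have h1 := hp.2
  rw [modelField_low M N hp.1 (by rw [h]; norm_num)] at h1
  exact baseField_ne_zero hp.1 (by rw [h]; norm_num) h1

theorem height_le_one {p : E3} (hp : p ∈ S2) : p 2 ≤ 1 := by
  rw [mem_S2_iff] at hp
  nlinarith [sq_nonneg (p 0), sq_nonneg (p 1)]

theorem eq_pole {p : E3} (hp : p ∈ S2) (h : p 2 = 1) : p = pt 0 0 1 := by
  rw [mem_S2_iff, h] at hp
  have h0 : p 0 = 0 := by nlinarith [sq_nonneg (p 0), sq_nonneg (p 1)]
  have h1 : p 1 = 0 := by nlinarith [sq_nonneg (p 0), sq_nonneg (p 1)]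
  exact E3.ext' h0 h1 h

theorem combination_eq_zero {q : ℝ × ℝ} {s t : ℝ}
    (h : s • (2 * Real.pi) • rotField (flowPt q) + t • baseField (flowPt q) = 0) : s = 0 ∧ t = 0 := by
  have hm := height_mem q.2
  have hpos := one_sub_height_sq_pos q.2
  have ht : t = 0 := by
    have e : s * (2 * Real.pi * 0) + t * (height q.2 ^ 2 * (1 - height q.2 ^ 2)) = 0 :=
      congrArg (fun p : E3 => p 2) h
    have h1 : height q.2 ^ 2 * (1 - height q.2 ^ 2) ≠ 0 := by
      have := hm.1
      positivity
    have : t * (height q.2 ^ 2 * (1 - height q.2 ^ 2)) = 0 := by linarith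
    exact (mul_eq_zero.1 this).resolve_right h1
  refine ⟨?_, ht⟩
  by_contra hs
  rw [ht, zero_smul, add_zero, smul_eq_zero, smul_eq_zero] at h
  have hpi := Real.pi_pos
  rcases h with h | h | h
  · exact hs h
  · linarith
  · have e0 : -flowPt q 1 = 0 := congrArg (fun p : E3 => p 0) h
    have e1 : flowPt q 0 = 0 := congrArg (fun p : E3 => p 1) h
    have h2 := mem_S2_iff.1 (flowPt_mem_S2 q)
    have h3 : flowPt q 2 = height q.2 := rfl
    rw [neg_eq_zero.1 e0, e1, h3] at h2
    linarith

/-- Both coefficients of the field vanish at a zero, so derivatives of the rotation and unperturbed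
fields do not contribute. In the basis of these two vectors the linearization is the planar one. -/
theorem diagonal_flowPt {q : ℝ × ℝ} (hκ : M.κ q = 0) (hβ : M.β q = 1) {l₁ l₂ : ℝ}
    (d1 : HasDerivAt (fun s => M.κ (q.1 + s, q.2)) l₁ 0)
    (d2 : HasDerivAt (fun s => M.κ (q.1, q.2 + s)) 0 0)
    (d3 : HasDerivAt (fun s => M.β (q.1 + s, q.2)) 0 0)
    (d4 : HasDerivAt (fun s => M.β (q.1, q.2 + s)) (-l₂) 0) :
    (modelField M N).IsDiagonalAt (flowPt q) l₁ l₂ := by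
  have hq := M.mem_Ioo_of_singular hβ
  have hrot : Differentiable ℝ rotField := rotField_contDiff.differentiable (by simp)
  have hbase : Differentiable ℝ baseField := baseField_contDiff.differentiable (by simp)
  have key : ∀ (e : ℝ → ℝ × ℝ) (v : ℝ × ℝ) (a b : ℝ), e 0 = q → HasDerivAt e v 0 →
      HasDerivAt (fun s => M.κ (e s)) a 0 → HasDerivAt (fun s => M.β (e s)) b 0 →
      fderiv ℝ (modelField M N).toFun (flowPt q)
        (v.1 • (2 * Real.pi) • rotField (flowPt q) + v.2 • baseField (flowPt q)) =
        a • (2 * Real.pi) • rotField (flowPt q) + (-b) • baseField (flowPt q) := by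
    intro e v a b h0 he ha hb
    have hf := flowPt_hasDerivAt he
    have hR := (hrot (flowPt (e 0))).hasFDerivAt.comp_hasDerivAt 0 hf
    have hB := (hbase (flowPt (e 0))).hasFDerivAt.comp_hasDerivAt 0 hf
    have h1 := (ha.smul (hR.const_smul (2 * Real.pi))).add ((hb.const_sub 1).smul hB)
    have hev : ∀ᶠ s in 𝓝 (0 : ℝ), (e s).1 ∈ Ioo (0 : ℝ) 1 := by
      have hc : ContinuousAt (fun s => (e s).1) 0 := continuous_fst.continuousAt.comp he.continuousAt
      exact hc.eventually_mem (by rw [h0]; exact Ioo_mem_nhds hq.1 hq.2)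
    have h2 : HasDerivAt (fun s => (modelField M N).toFun (flowPt (e s)))
        (a • (2 * Real.pi) • rotField (flowPt q) + (-b) • baseField (flowPt q)) 0 := by
      refine (h1.congr_deriv (by simp [h0, hκ, hβ])).congr_of_eventuallyEq ?_
      filter_upwards [hev] with s hs
      rw [modelField_flowPt M N (Ioo_subset_Icc_self hs)]
      rfl
    have h3 := (modelField M N).fderiv_eq_of_curve hf h2
    rwa [h0] at h3
  refine ⟨(2 * Real.pi) • rotField (flowPt q), baseField (flowPt q), ?_,
    inner_baseField (flowPt_mem_S2 q), ?_, ?_, ?_⟩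
  · rw [inner_smul_right, inner_rotField, mul_zero]
  · rw [LinearIndependent.pair_iff]
    exact fun s t h => combination_eq_zero h
  · have := key (fun s => (q.1 + s, q.2)) (1, 0) l₁ 0 (by simp)
      (((hasDerivAt_id' _).const_add _).prodMk (hasDerivAt_const _ _)) d1 d3
    simpa using this
  · have := key (fun s => (q.1, q.2 + s)) (0, 1) 0 (-l₂) (by simp)
      ((hasDerivAt_const _ _).prodMk ((hasDerivAt_id' _).const_add _)) d2 d4
    simpa using this

theorem diagonal_pole : (modelField M N).IsDiagonalAt (pt 0 0 1) (-1) (-1) := by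
  have key : ∀ a b : ℝ, fderiv ℝ (modelField M N).toFun (pt 0 0 1) (pt a b 0) =
      (-1 : ℝ) • pt a b 0 := by
    intro a b
    -- This curve leaves the sphere but keeps the height one, where the unperturbed field has no
    -- rotation term and is exactly minus the horizontal position.
    have he : HasDerivAt (fun s : ℝ => pt (s * a) (s * b) 1) (pt a b 0) 0 := by
      have h1 := (hasDerivAt_id' (0 : ℝ)).mul_const a
      have h2 := (hasDerivAt_id' (0 : ℝ)).mul_const b
      rw [one_mul] at h1 h2
      exact hasDerivAt_pt h1 h2 (hasDerivAt_const _ _)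
    have h0 : pt ((0 : ℝ) * a) (0 * b) 1 = pt 0 0 1 := by simp
    have hV : HasDerivAt (fun s : ℝ => (modelField M N).toFun (pt (s * a) (s * b) 1))
        ((-1 : ℝ) • pt a b 0) 0 := by
      have h1 : HasDerivAt (fun s : ℝ => (-s) • pt a b 0) ((-1 : ℝ) • pt a b 0) 0 :=
        (hasDerivAt_neg (0 : ℝ)).smul_const _
      refine h1.congr_of_eventuallyEq ?_
      have hax := modelField_axis M N (p := pt 0 0 1) (by simp)
      rw [← h0] at hax
      filter_upwards [he.continuousAt.eventually hax] with s hs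
      rw [hs]
      apply E3.ext' <;> simp [baseField]
    have := (modelField M N).fderiv_eq_of_curve he hV
    rwa [h0] at this
  refine ⟨pt 1 0 0, pt 0 1 0, ?_, ?_, ?_, key _ _, key _ _⟩
  · rw [inner_E3]; simp
  · rw [inner_E3]; simp
  · rw [LinearIndependent.pair_iff]
    intro s t h
    constructor
    · have := congrArg (fun p : E3 => p 0) h
      simpa using this
    · have := congrArg (fun p : E3 => p 1) h
      simpa using this

theorem isSingularPoint_flowPt {q : ℝ × ℝ} (hκ : M.κ q = 0) (hβ : M.β q = 1) :
    (modelField M N).IsSingularPoint (flowPt q) := by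
  refine ⟨flowPt_mem_S2 q, ?_⟩
  rw [modelField_flowPt M N (Ioo_subset_Icc_self (M.mem_Ioo_of_singular hβ)), hκ, hβ]
  simp

/-- The singular points of the upper hemisphere. -/
theorem singular_upper {p : E3} (hp : (modelField M N).IsSingularPoint p) (h0 : 0 < p 2) :
    ∃ l₁ l₂ : ℝ, l₁ ≠ 0 ∧ l₂ ≠ 0 ∧ (modelField M N).IsDiagonalAt p l₁ l₂ ∧
      (l₁ * l₂ < 0 ↔ ∃ i, p = flowPt (M.saddle i)) := by
  rcases (height_le_one hp.1).eq_or_lt with h1 | h1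
  · have hpole := eq_pole hp.1 h1
    refine ⟨-1, -1, by norm_num, by norm_num, hpole ▸ diagonal_pole M N, ?_⟩
    constructor
    · intro h; norm_num at h
    · rintro ⟨i, hi⟩
      have h2 : flowPt (M.saddle i) 2 = height (M.saddle i).2 := rfl
      rw [← hi, h1] at h2
      linarith [(height_mem (M.saddle i).2).2]
  · obtain ⟨q, hq, rfl⟩ := exists_flowPt hp.1 h0 h1
    have h2 := hp.2
    rw [modelField_flowPt M N (Ico_subset_Icc_self hq)] at h2
    obtain ⟨hκ, hβ⟩ := combination_eq_zero h2
    have hβ' : M.β q = 1 := by linarith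
    obtain ⟨l₁, l₂, n1, n2, d1, d2, d3, d4, hs⟩ := M.singular q hκ hβ'
    refine ⟨l₁, l₂, n1, n2, diagonal_flowPt M N hκ hβ' d1 d2 d3 d4, hs.trans ?_⟩
    constructor
    · rintro ⟨i, rfl⟩
      exact ⟨i, rfl⟩
    · rintro ⟨i, hi⟩
      exact ⟨i, flowPt_injective hq
        (Ioo_subset_Ico_self (M.mem_Ioo_of_singular (M.saddle_singular i).2)) hi⟩

theorem isSaddle_upper {p : E3} (h0 : 0 < p 2) :
    (modelField M N).IsSaddle p ↔ ∃ i, p = flowPt (M.saddle i) := by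
  constructor
  · intro hp
    obtain ⟨l₁, l₂, -, -, hd, hs⟩ := singular_upper M N hp.1 h0
    exact hs.1 ((hd.isSaddle_iff hp.1).1 hp)
  · rintro ⟨i, rfl⟩
    have hp := isSingularPoint_flowPt M N (M.saddle_singular i).1 (M.saddle_singular i).2
    obtain ⟨l₁, l₂, -, -, hd, hs⟩ := singular_upper M N hp h0
    exact (hd.isSaddle_iff hp).2 (hs.2 ⟨i, rfl⟩)

theorem isHyperbolicPoint_upper {p : E3} (hp : (modelField M N).IsSingularPoint p) (h0 : 0 < p 2) :
    (modelField M N).IsHyperbolicPoint p := by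
  obtain ⟨l₁, l₂, n1, n2, hd, -⟩ := singular_upper M N hp h0
  exact hd.isHyperbolicPoint hp n1 n2

/-! ### Solutions on the upper hemisphere -/

theorem isSolution_flowPt {ψ : ℝ → ℝ × ℝ} (hψ : IsPlanarSolution M.κ M.β ψ)
    (h : ∀ t, (ψ t).1 ∈ Ico (0 : ℝ) 1) : (modelField M N).IsSolution fun t => flowPt (ψ t) :=
  ⟨fun t => flowPt_mem_S2 _, fun t => by
    rw [modelField_flowPt M N (Ico_subset_Icc_self (h t))]
    exact flowPt_hasDerivAt (hψ t)⟩

/-- Planar solutions are defined for all times and stay in the strip, so by uniqueness their images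
are the full orbits. -/
theorem exists_planar_of_upper {c : ℝ → E3} (hc : (modelField M N).IsSolution c) {s : ℝ}
    (h0 : 0 < c s 2) (h1 : c s 2 < 1) : ∃ ψ, IsPlanarSolution M.κ M.β ψ ∧
      (∀ t, (ψ t).1 ∈ Ico (0 : ℝ) 1) ∧ ∀ t, c t = flowPt (ψ t) := by
  obtain ⟨q, hq, hqs⟩ := exists_flowPt (hc.1 s) h0 h1
  obtain ⟨φ, hφ0, hφ⟩ := M.exists_solution q
  have hψ : IsPlanarSolution M.κ M.β fun t => φ (t + -s) := fun t => hasDerivAt_time_shift hφ (-s) t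
  have hstrip := M.strip_invariant hψ (s := s) (by simpa [hφ0] using hq)
  exact ⟨_, hψ, hstrip, fun t => congrFun
    (hc.unique (isSolution_flowPt M N hψ hstrip) (t := s) (by simp [hφ0, hqs])) t⟩

theorem const_of_pole {c : ℝ → E3} (hc : (modelField M N).IsSolution c) {s : ℝ} (h1 : c s 2 = 1)
    (t : ℝ) : c t = pt 0 0 1 := by
  have hp := eq_pole (hc.1 s) h1
  rw [← hp]
  refine hc.const ?_ t
  rw [hp, (modelField_axis M N (p := pt 0 0 1) (by simp)).self_of_nhds]
  apply E3.ext' <;> simp [baseField]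

theorem upper_invariant {c : ℝ → E3} (hc : (modelField M N).IsSolution c) {s : ℝ}
    (h0 : 0 < c s 2) (t : ℝ) : 0 < c t 2 := by
  rcases (height_le_one (hc.1 s)).eq_or_lt with h1 | h1
  · rw [const_of_pole M N hc h1]; simp
  · obtain ⟨ψ, -, -, h⟩ := exists_planar_of_upper M N hc h0 h1
    rw [h t]
    exact (height_mem _).1

theorem periodic_upper {c : ℝ → E3} (hc : (modelField M N).IsSolution c) {T : ℝ} (hT : 0 < T)
    (hper : c T = c 0) (h0 : 0 < c 0 2) : (modelField M N).toFun (c 0) = 0 := by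
  rcases (height_le_one (hc.1 0)).eq_or_lt with h1 | h1
  · rw [const_of_pole M N hc h1, (modelField_axis M N (p := pt 0 0 1) (by simp)).self_of_nhds]
    apply E3.ext' <;> simp [baseField]
  · obtain ⟨ψ, hψ, hstrip, h⟩ := exists_planar_of_upper M N hc h0 h1
    rw [h, h] at hper
    have h2 := M.no_periodic ψ hψ T hT (flowPt_injective (hstrip T) (hstrip 0) hper)
    rw [h]
    exact (isSingularPoint_flowPt M N h2.1 h2.2).2

theorem periodic_lower {c : ℝ → E3} (hc : (modelField M N).IsSolution c) {T : ℝ} (hT : 0 < T)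
    (hper : c T = c 0) (h0 : c 0 2 < 0) : (modelField M N).toFun (c 0) = 0 := by
  -- The shift by `-T` makes the reversed solution run over the same period, at whose ends the
  -- values are known to agree.
  have h1 := periodic_upper N M (((modelField_turn M N).isSolution hc).shift (-T)) hT
    (by simp [hper]) (by simpa [hper] using h0)
  have h2 : (modelField N M).toFun (turn (c 0)) = 0 := by simpa [hper] using h1
  rw [modelField_turn M N, neg_eq_zero] at h2
  exact turn_injective (h2.trans turn_zero.symm)

/-- The limit has nonnegative height, and there are no singular points on the equator. -/
theorem saddle_of_limit {p : E3} (hp : (modelField M N).IsSaddle p) {c : ℝ → E3} {l : Filter ℝ}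
    [l.NeBot] (hpos : ∀ t, 0 < c t 2) (hlim : Tendsto c l (𝓝 p)) : ∃ i, p = flowPt (M.saddle i) := by
  refine (isSaddle_upper M N (lt_of_le_of_ne ?_ (singular_height_ne_zero M N hp.1).symm)).1 hp
  exact ge_of_tendsto (((contDiff_coord 2).continuous.tendsto p).comp hlim)
    (Eventually.of_forall fun t => (hpos t).le)

theorem saddle_mem (i : M.ι) : (M.saddle i).1 ∈ Ioo (0 : ℝ) 1 :=
  M.mem_Ioo_of_singular (M.saddle_singular i).2

theorem no_connection_upper {p q : E3} {c : ℝ → E3} (hp : (modelField M N).IsSaddle p)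
    (hq : (modelField M N).IsSaddle q) (hpc : (modelField M N).IsUnstableSeparatrix p c)
    (hqc : (modelField M N).IsStableSeparatrix q c) (h0 : 0 < c 0 2) : False := by
  have hpos := upper_invariant M N hpc.1 h0
  obtain ⟨i, rfl⟩ := saddle_of_limit M N hq hpos hqc.2.2
  obtain ⟨j, rfl⟩ := saddle_of_limit M N hp hpos hpc.2.2
  rcases (height_le_one (hpc.1.1 0)).eq_or_lt with h1 | h1
  · have hconst := const_of_pole M N hpc.1 h1
    have h2 : Tendsto c atTop (𝓝 (pt 0 0 1)) :=
      tendsto_const_nhds.congr fun t => (hconst t).symm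
    exact hqc.2.1 0 ((hconst 0).trans (tendsto_nhds_unique h2 hqc.2.2))
  · obtain ⟨ψ, hψ, hstrip, h⟩ := exists_planar_of_upper M N hpc.1 h0 h1
    have e1 := hqc.2.2
    have e2 := hpc.2.2
    have hcψ : c = fun t => flowPt (ψ t) := funext h
    rw [hcψ] at e1 e2
    obtain ⟨t, ht⟩ := M.no_connection i j ψ hψ
      (tendsto_of_tendsto_flowPt hstrip (saddle_mem M i) e1)
      (tendsto_of_tendsto_flowPt hstrip (saddle_mem M j) e2)
    exact hqc.2.1 t (by rw [h t, ht])

end ModelField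

/-! ### The parabolic cycle -/

/-- The point of the equator with longitude `2πθ`. -/
noncomputable def equatorPt (θ : ℝ) : E3 :=
  pt (Real.cos (2 * Real.pi * θ)) (Real.sin (2 * Real.pi * θ)) 0

theorem equatorPt_mem_S2 (θ : ℝ) : equatorPt θ ∈ S2 := by
  rw [mem_S2_iff]
  simp [equatorPt, Real.cos_sq_add_sin_sq]

theorem range_equatorPt : range equatorPt = equator := by
  ext p
  constructor
  · rintro ⟨θ, rfl⟩
    exact ⟨equatorPt_mem_S2 θ, rfl⟩
  · rintro ⟨hp, h2⟩
    rw [mem_S2_iff, h2] at hp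
    set w : ℂ := ⟨p 0, p 1⟩ with hw
    have hnorm : ‖w‖ = 1 := by
      rw [Complex.norm_eq_sqrt_sq_add_sq, Real.sqrt_eq_one]
      simp only [hw]
      linarith
    have hpi := Real.pi_pos
    have h1 := Complex.norm_mul_cos_arg w
    have h3 := Complex.norm_mul_sin_arg w
    rw [hnorm, one_mul] at h1 h3
    refine ⟨w.arg / (2 * Real.pi), E3.ext' ?_ ?_ h2.symm⟩
    · rw [equatorPt, mul_div_cancel₀ _ (by positivity), pt_zero, h1]
    · rw [equatorPt, mul_div_cancel₀ _ (by positivity), pt_one, h3]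

section Cycle

variable (M N : PlanarModel)

theorem isSolution_equatorPt : (modelField M N).IsSolution equatorPt := by
  refine ⟨equatorPt_mem_S2, fun t => ?_⟩
  rw [modelField_low M N (equatorPt_mem_S2 t) (by simp [equatorPt])]
  have h := (hasDerivAt_id' t).const_mul (2 * Real.pi)
  refine (hasDerivAt_pt h.cos h.sin (hasDerivAt_const t 0)).congr_deriv ?_
  apply E3.ext' <;> simp [baseField, equatorPt] <;> ring

theorem equator_invariant {c : ℝ → E3} (hc : (modelField M N).IsSolution c) {s : ℝ}
    (h0 : c s 2 = 0) : ∃ r, ∀ t, c t = equatorPt (t + r) := by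
  have h : c s ∈ range equatorPt := by rw [range_equatorPt]; exact ⟨hc.1 s, h0⟩
  obtain ⟨θ, hθ⟩ := h
  exact ⟨θ - s, fun t => hc.eq_shift (isSolution_equatorPt M N) hθ.symm t⟩

theorem isCycle_equator : (modelField M N).IsCycle equator := by
  refine ⟨equatorPt, 1, isSolution_equatorPt M N, one_pos, fun t => ?_, ?_, range_equatorPt.symm⟩
  · have : 2 * Real.pi * (t + 1) = 2 * Real.pi * t + 2 * Real.pi := by ring
    simp only [equatorPt, this, Real.cos_add_two_pi, Real.sin_add_two_pi]
  · rw [modelField_low M N (equatorPt_mem_S2 0) (by simp [equatorPt])]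
    exact baseField_ne_zero (equatorPt_mem_S2 0) (by simp [equatorPt])

/-- The open hemispheres carry no nonconstant periodic solutions and the equator is one orbit. Hence
the condition on the other cycles in class $PC$ is vacuous. -/
theorem cycle_eq_equator {γ : Set E3} (h : (modelField M N).IsCycle γ) : γ = equator := by
  obtain ⟨c, T, hc, hT, hper, hne, rfl⟩ := h
  have hT0 : c T = c 0 := by simpa using hper 0
  rcases lt_trichotomy (c 0 2) 0 with h0 | h0 | h0
  · exact absurd (periodic_lower M N hc hT hT0 h0) hne
  · obtain ⟨r, hr⟩ := equator_invariant M N hc h0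
    rw [← range_equatorPt]
    ext p
    constructor
    · rintro ⟨t, rfl⟩
      exact ⟨_, (hr t).symm⟩
    · rintro ⟨θ, rfl⟩
      exact ⟨θ - r, by rw [hr]; simp⟩
  · exact absurd (periodic_upper M N hc hT hT0 h0) hne

/-! ### Singular points -/

theorem isHyperbolicPoint_model {p : E3} (hp : (modelField M N).IsSingularPoint p) :
    (modelField M N).IsHyperbolicPoint p := by
  rcases (singular_height_ne_zero M N hp).lt_or_gt with h0 | h0
  · have hp' := (modelField_turn M N).isSingularPoint hp
    obtain ⟨l₁, l₂, n1, n2, hd, -⟩ := singular_upper N M hp' (by simpa using h0)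
    have hd' := (modelField_turn M N).symm.isDiagonalAt hd
    rw [turn_turn] at hd'
    exact hd'.isHyperbolicPoint hp (neg_ne_zero.2 n1) (neg_ne_zero.2 n2)
  · exact isHyperbolicPoint_upper M N hp h0

theorem isSaddle_turn {p : E3} (hp : (modelField M N).IsSaddle p) :
    (modelField N M).IsSaddle (turn p) := by
  have hp' := (modelField_turn M N).isSingularPoint hp.1
  have key : ∃ l₁ l₂ : ℝ, (modelField M N).IsDiagonalAt p l₁ l₂ := by
    rcases (singular_height_ne_zero M N hp.1).lt_or_gt with h0 | h0
    · obtain ⟨l₁, l₂, -, -, hd, -⟩ := singular_upper N M hp' (by simpa using h0)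
      have hd' := (modelField_turn M N).symm.isDiagonalAt hd
      rw [turn_turn] at hd'
      exact ⟨_, _, hd'⟩
    · obtain ⟨l₁, l₂, -, -, hd, -⟩ := singular_upper M N hp.1 h0
      exact ⟨_, _, hd⟩
  obtain ⟨l₁, l₂, hd⟩ := key
  rw [((modelField_turn M N).isDiagonalAt hd).isSaddle_iff hp', neg_mul_neg]
  exact (hd.isSaddle_iff hp.1).1 hp

theorem isSaddle_turn_iff {p : E3} :
    (modelField N M).IsSaddle (turn p) ↔ (modelField M N).IsSaddle p :=
  ⟨fun h => by simpa using isSaddle_turn N M h, isSaddle_turn M N⟩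

theorem not_tendsto_saddle_of_equator {p : E3} (hp : (modelField M N).IsSaddle p) {c : ℝ → E3}
    (hc : (modelField M N).IsSolution c) {s : ℝ} (h0 : c s 2 = 0) {l : Filter ℝ} [l.NeBot] :
    ¬ Tendsto c l (𝓝 p) := by
  intro h
  obtain ⟨r, hr⟩ := equator_invariant M N hc h0
  have h1 := ((contDiff_coord 2).continuous.tendsto p).comp h
  have h2 : (fun p : E3 => p 2) ∘ c = fun _ => 0 := by
    funext t
    simp [hr, equatorPt]
  rw [h2] at h1
  exact singular_height_ne_zero M N hp.1 (tendsto_nhds_unique tendsto_const_nhds h1).symm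

theorem not_hasSaddleConnection : ¬ (modelField M N).HasSaddleConnection := by
  rintro ⟨p, q, c, hp, hq, hpc, hqc⟩
  rcases lt_trichotomy (c 0 2) 0 with h0 | h0 | h0
  · exact no_connection_upper N M (isSaddle_turn M N hq) (isSaddle_turn M N hp)
      ((modelField_turn M N).isStableSeparatrix hqc)
      ((modelField_turn M N).isUnstableSeparatrix hpc) (by simpa using h0)
  · exact not_tendsto_saddle_of_equator M N hp hpc.1 h0 hpc.2.2
  · exact no_connection_upper M N hp hq hpc hqc h0

end Cycle

/-! ### The cross-section -/

/-- A cut-off function for the cross-section. -/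
noncomputable def sectionBump : ContDiffBump (0 : ℝ) where
  rIn := 1 / 2
  rOut := 3 / 4
  rIn_pos := by norm_num
  rIn_lt_rOut := by norm_num

/-- The meridian of longitude zero near the equator, parametrized by the height. -/
noncomputable def meridian (s : ℝ) : E3 := pt √(1 - s ^ 2 * sectionBump s) 0 s

/-- The bump keeps the radicand positive for all `s`, so that the meridian is a smooth curve on the
whole line. -/
theorem one_sub_bump_pos (s : ℝ) : 0 < 1 - s ^ 2 * sectionBump s := by
  rcases le_or_gt (3 / 4) |s| with h | h
  · rw [sectionBump.zero_of_le_dist (by simpa [sectionBump, Real.dist_eq] using h)]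
    norm_num
  · have h1 : s ^ 2 ≤ (3 / 4) ^ 2 := sq_le_sq' (by linarith [abs_lt.1 h]) (abs_lt.1 h).2.le
    have h2 := sectionBump.le_one (x := s)
    have h3 := sectionBump.nonneg (x := s)
    nlinarith [sq_nonneg s]

theorem meridian_contDiff : ContDiff ℝ ∞ meridian :=
  contDiff_pt ((contDiff_const.sub ((contDiff_id.pow 2).mul sectionBump.contDiff)).sqrt
    fun s => (one_sub_bump_pos s).ne') contDiff_const contDiff_id

theorem meridian_eq {s : ℝ} (hs : s ∈ Icc (-(1 / 2) : ℝ) (1 / 2)) :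
    meridian s = pt √(1 - s ^ 2) 0 s := by
  rw [meridian, sectionBump.one_of_mem_closedBall, mul_one]
  rw [Metric.mem_closedBall, Real.dist_eq, sub_zero]
  exact abs_le.2 hs

theorem turn_meridian (s : ℝ) : turn (meridian s) = meridian (-s) := by
  apply E3.ext' <;> simp [turn, meridian, sectionBump.neg]

theorem one_sub_sq_pos {s : ℝ} (hs : s ∈ Icc (-(1 / 2) : ℝ) (1 / 2)) : 0 < 1 - s ^ 2 := by
  nlinarith [hs.1, hs.2]

theorem meridian_mem_S2 {s : ℝ} (hs : s ∈ Icc (-(1 / 2) : ℝ) (1 / 2)) : meridian s ∈ S2 := by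
  rw [meridian_eq hs, mem_S2_iff, pt_zero, pt_one, pt_two, Real.sq_sqrt (one_sub_sq_pos hs).le]
  ring

theorem meridian_injective : Function.Injective meridian := fun _ _ h =>
  congrArg (fun p : E3 => p 2) h

/-- The cross-section to the equator. -/
noncomputable def modelSection (M N : PlanarModel) : (modelField M N).CrossSection equator where
  σ := meridian
  δ := 1 / 2
  δ_pos := by norm_num
  smooth := meridian_contDiff
  mem_sphere _ := meridian_mem_S2
  injOn := meridian_injective.injOn
  -- The meridian has zero second component, and the field crosses it with the second component
  -- $2\pi(1-s^2)^{3/2}$.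
  transversal s hs := by
    rw [LinearIndependent.pair_iff]
    intro a b h
    have hd : HasDerivAt meridian (deriv meridian s) s :=
      (meridian_contDiff.differentiable (by simp) s).hasDerivAt
    have h1 : deriv meridian s 1 = 0 := (hasDerivAt_coord hd 1).unique (hasDerivAt_const s 0)
    have h2 : deriv meridian s 2 = 1 := (hasDerivAt_coord hd 2).unique (hasDerivAt_id' s)
    rw [modelField_low M N (meridian_mem_S2 hs) (abs_le.2 hs), meridian_eq hs] at h
    have hpos := one_sub_sq_pos hs
    have hr := Real.sqrt_pos.2 hpos
    have hpi := Real.pi_pos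
    have e1 : a * deriv meridian s 1 + b * (2 * Real.pi * (1 - s ^ 2) * √(1 - s ^ 2) - s ^ 3 * 0) =
        0 := congrArg (fun p : E3 => p 1) h
    have e2 : a * deriv meridian s 2 + b * (s ^ 2 * (1 - s ^ 2)) = 0 :=
      congrArg (fun p : E3 => p 2) h
    rw [h1] at e1
    rw [h2] at e2
    have hb : b = 0 := by
      have h3 : b * (2 * Real.pi * (1 - s ^ 2) * √(1 - s ^ 2)) = 0 := by linarith
      exact (mul_eq_zero.1 h3).resolve_right (by positivity)
    rw [hb] at e2
    exact ⟨by linarith, hb⟩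
  mem_cycle_iff s hs := ⟨fun h => h.2, fun h => ⟨meridian_mem_S2 hs, h⟩⟩

/-- Longitude zero means that the label is congruent to the inverse height modulo one. -/
theorem meridian_eq_flowPt {s : ℝ} (hs : s ∈ Ioc (0 : ℝ) (1 / 2)) :
    meridian s = flowPt (Int.fract (1 / s), heightTime s) := by
  have hz : height (heightTime s) = s := height_heightTime ⟨hs.1, by linarith [hs.2]⟩
  have hang : 2 * Real.pi * (Int.fract (1 / s) - 1 / s) = 0 - ⌊1 / s⌋ * (2 * Real.pi) := by
    rw [Int.fract]; ring
  rw [meridian_eq ⟨by linarith [hs.1], hs.2⟩, flowPt]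
  simp only [hz, hang, Real.cos_sub_int_mul_two_pi, Real.sin_sub_int_mul_two_pi]
  simp

theorem meridian_eq_flowPt_iff {s a t : ℝ} (hs : s ∈ Icc (-(1 / 2) : ℝ) (1 / 2))
    (ha : a ∈ Ico (0 : ℝ) 1) (h : meridian s = flowPt (a, t)) :
    s ∈ Ioc (0 : ℝ) (1 / 2) ∧ a = Int.fract (1 / s) ∧ t = heightTime s := by
  have h1 : s = height t := congrArg (fun p : E3 => p 2) h
  have h2 : s ∈ Ioc (0 : ℝ) (1 / 2) := ⟨by rw [h1]; exact (height_mem t).1, hs.2⟩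
  rw [meridian_eq_flowPt h2] at h
  have h3 := flowPt_injective ⟨Int.fract_nonneg _, Int.fract_lt_one _⟩ ha h
  exact ⟨h2, (congrArg Prod.fst h3).symm, (congrArg Prod.snd h3).symm⟩

/-! ### The Poincaré map -/

/-- The Poincaré map of the equator. -/
noncomputable def returnMap (s : ℝ) : ℝ := s / (1 - s)

section Return

variable (M N : PlanarModel)

theorem exists_vertical_solution {a : ℝ} (ha : a ∈ Ico (0 : ℝ) 1) :
    ∃ c, (modelField M N).IsSolution c ∧ ∀ t ≤ 0, c t = flowPt (a, t) := by
  obtain ⟨ψ, hψ, h⟩ := M.exists_vertical a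
  have hs := M.strip_invariant hψ (s := 0) (by rw [h 0 le_rfl]; exact ha)
  exact ⟨_, isSolution_flowPt M N hψ hs, fun t ht => by rw [h t ht]⟩

/-- The orbit is on the meridian exactly when `1 / z` differs from `1 / s` by an integer. The first
return lowers `1 / z` by one, and `1 / returnMap s = 1 / s - 1`. The bound `1/3` keeps the image
below `1/2`, so the arc runs at negative times and avoids the perturbation. -/
theorem firstReturn_pos {s : ℝ} (hs : s ∈ Ioc (0 : ℝ) (1 / 3)) :
    (modelField M N).FirstReturn (meridian '' Icc (-(1 / 2)) (1 / 2)) (meridian s)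
      (meridian (returnMap s)) := by
  have h1s : 0 < 1 - s := by linarith [hs.2]
  have hs0 := hs.1
  have hP : returnMap s ∈ Ioc (0 : ℝ) (1 / 2) := by
    refine ⟨div_pos hs0 h1s, ?_⟩
    rw [returnMap, div_le_iff₀ h1s]
    linarith [hs.2]
  have hsP : s < returnMap s := by
    rw [returnMap, lt_div_iff₀ h1s]
    nlinarith
  have hinv : 1 / returnMap s = 1 / s - 1 := by
    rw [returnMap]; field_simp
  have hfr : Int.fract (1 / returnMap s) = Int.fract (1 / s) := by rw [hinv, Int.fract_sub_one]
  have hs' : s ∈ Ioc (0 : ℝ) (1 / 2) := ⟨hs0, by linarith [hs.2]⟩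
  have mem1 : ∀ {x : ℝ}, x ∈ Ioc (0 : ℝ) (1 / 2) → x ∈ Ioo (0 : ℝ) 1 := fun hx =>
    ⟨hx.1, by linarith [hx.2]⟩
  have ha : Int.fract (1 / s) ∈ Ico (0 : ℝ) 1 := ⟨Int.fract_nonneg _, Int.fract_lt_one _⟩
  obtain ⟨c, hc, hv⟩ := exists_vertical_solution M N ha
  have hτ := heightTime_strictMonoOn (mem1 hs') (mem1 hP) hsP
  have hneg := heightTime_neg hP.1 hP.2
  refine ⟨_, heightTime (returnMap s) - heightTime s, hc.shift (heightTime s), by linarith, ?_, ?_,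
    ⟨_, ⟨by linarith [hP.1], hP.2⟩, rfl⟩, ?_⟩
  · simp only [zero_add]
    rw [hv _ (by linarith), meridian_eq_flowPt hs']
  · simp only [sub_add_cancel]
    rw [hv _ hneg.le, meridian_eq_flowPt hP, hfr]
  · rintro t ⟨ht0, ht1⟩ ⟨x, hx, hxc⟩
    rw [hv _ (by linarith)] at hxc
    obtain ⟨hx', hax, htx⟩ := meridian_eq_flowPt_iff hx ha hxc
    have hsx : s < x := by
      by_contra! hle
      have := heightTime_strictMonoOn.monotoneOn (mem1 hx') (mem1 hs') hle
      linarith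
    have hxP : x < returnMap s := by
      by_contra! hle
      have := heightTime_strictMonoOn.monotoneOn (mem1 hP) (mem1 hx') hle
      linarith
    obtain ⟨z, hz⟩ := Int.fract_eq_fract.1 hax
    have i1 : 1 / x < 1 / s := one_div_lt_one_div_of_lt hs0 hsx
    have i2 : 1 / returnMap s < 1 / x := one_div_lt_one_div_of_lt hx'.1 hxP
    rw [hinv] at i2
    have z0 : (0 : ℝ) < z := by linarith
    have z1 : (z : ℝ) < 1 := by linarith
    have z0' : 0 < z := by exact_mod_cast z0
    have z1' : z < 1 := by exact_mod_cast z1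
    omega

theorem firstReturn_zero :
    (modelField M N).FirstReturn (meridian '' Icc (-(1 / 2)) (1 / 2)) (meridian 0) (meridian 0) := by
  have h0 : meridian 0 = pt 1 0 0 := by rw [meridian_eq (by norm_num)]; simp
  refine ⟨equatorPt, 1, isSolution_equatorPt M N, one_pos, ?_, ?_, ⟨0, by norm_num, rfl⟩, ?_⟩
  · rw [h0]; simp [equatorPt]
  · rw [h0]; simp [equatorPt]
  · rintro t ⟨ht0, ht1⟩ ⟨x, hx, hxt⟩
    have h2 : x = 0 := congrArg (fun p : E3 => p 2) hxt
    rw [h2, h0] at hxt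
    have h3 : 1 = Real.cos (2 * Real.pi * t) := congrArg (fun p : E3 => p 0) hxt
    have hpi := Real.pi_pos
    have h4 := (Real.cos_eq_one_iff_of_lt_of_lt (by nlinarith) (by nlinarith)).1 h3.symm
    have : 0 < 2 * Real.pi * t := by positivity
    linarith

theorem firstReturn_model {s : ℝ} (hs : s ∈ Ioo (-(1 / 4) : ℝ) (1 / 4)) :
    (modelField M N).FirstReturn (meridian '' Icc (-(1 / 2)) (1 / 2)) (meridian s)
      (meridian (returnMap s)) := by
  rcases lt_trichotomy s 0 with h | rfl | h
  · have h1 : 0 < 1 - s := by linarith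
    have hm : -returnMap s ∈ Ioc (0 : ℝ) (1 / 3) := by
      rw [returnMap, ← neg_div]
      refine ⟨div_pos (by linarith) h1, ?_⟩
      rw [div_le_iff₀ h1]
      linarith [hs.1]
    -- For negative `s` the return from `-returnMap s` to `-s` on the positive side is turned back,
    -- which reverses its direction.
    have hr : returnMap (-returnMap s) = -s := by
      have : 1 - s + s = 1 := by ring
      rw [returnMap, returnMap, sub_neg_eq_add]
      have h2 : 1 + s / (1 - s) = 1 / (1 - s) := by field_simp; ring
      rw [h2]
      field_simp
    have h3 := (modelField_turn N M).firstReturn (G := meridian '' Icc (-(1 / 2)) (1 / 2)) ?_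
      ⟨_, ⟨by linarith [hm.1], by linarith [hm.2]⟩, rfl⟩ (firstReturn_pos N M hm)
    · rwa [hr, turn_meridian, turn_meridian, neg_neg, neg_neg] at h3
    · rintro _ ⟨x, hx, rfl⟩
      exact ⟨-x, ⟨by linarith [hx.2], by linarith [hx.1]⟩, (turn_meridian x).symm⟩
  · have : returnMap 0 = 0 := by simp [returnMap]
    rw [this]
    exact firstReturn_zero M N
  · exact firstReturn_pos M N ⟨h, by linarith [hs.2]⟩

theorem returnMap_hasDerivAt {s : ℝ} (hs : s ≠ 1) : HasDerivAt returnMap ((1 - s) ^ 2)⁻¹ s := by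
  have h : 1 - s ≠ 0 := sub_ne_zero.2 hs.symm
  refine ((hasDerivAt_id' s).div ((hasDerivAt_id' s).const_sub 1) h).congr_deriv ?_
  field_simp
  ring

theorem deriv_returnMap_zero : deriv returnMap 0 = 1 := by
  rw [(returnMap_hasDerivAt zero_ne_one).deriv]; norm_num

theorem deriv_two_returnMap_zero : iteratedDeriv 2 returnMap 0 = 2 := by
  rw [iteratedDeriv_succ, iteratedDeriv_one]
  have h : deriv returnMap =ᶠ[𝓝 0] fun s => ((1 - s) ^ 2)⁻¹ := by
    filter_upwards [isOpen_ne.mem_nhds (zero_ne_one : (0 : ℝ) ≠ 1)] with s hs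
    exact (returnMap_hasDerivAt hs).deriv
  rw [h.deriv_eq]
  have h1 := ((((hasDerivAt_id' (0 : ℝ)).const_sub 1).pow 2).inv (by norm_num)).deriv
  refine Eq.trans ?_ (h1.trans (by norm_num))
  rfl

theorem isPoincareMap_returnMap : SphereField.IsPoincareMap (modelSection M N) returnMap (1 / 4) where
  pos := by norm_num
  le := by norm_num [modelSection]
  smooth := by
    refine ContDiffOn.div contDiffOn_id (contDiffOn_const.sub contDiffOn_id) fun s hs => ?_
    have := hs.2
    linarith
  mapsTo s hs := by
    have h1 : 0 < 1 - s := by linarith [hs.2]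
    change s / (1 - s) ∈ Icc (-(1 / 2) : ℝ) (1 / 2)
    refine ⟨?_, ?_⟩
    · rw [le_div_iff₀ h1]; linarith [hs.1]
    · rw [div_le_iff₀ h1]; linarith [hs.2]
  firstReturn _ := firstReturn_model M N

/-- The generator `x²` of the Poincaré map. -/
theorem isGenerator_sq : SphereField.IsGenerator (fun x : ℝ => x ^ 2) returnMap (1 / 2) (1 / 4) where
  smooth := (contDiff_id.pow 2).contDiffOn
  zero := by norm_num
  deriv_zero := by simp
  deriv_two := by
    have h : deriv (fun x : ℝ => x ^ 2) = fun x => 2 * x := by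
      funext x; simp
    rw [iteratedDeriv_succ, iteratedDeriv_one, h]
    simp
  pos x _ hx := by positivity
  time_one s hs := by
    refine ⟨fun t => s / (1 - t * s), by simp, by simp [returnMap], fun t ht => ?_⟩
    have h1 : 3 / 4 ≤ 1 - t * s := by
      nlinarith [hs.1, hs.2, ht.1, ht.2]
    have h2 : 0 < 1 - t * s := by linarith
    refine ⟨⟨?_, ?_⟩, ?_⟩
    · rw [lt_div_iff₀ h2]; nlinarith [hs.1, hs.2, ht.1, ht.2]
    · rw [div_lt_iff₀ h2]; nlinarith [hs.1, hs.2, ht.1, ht.2]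
    · have h3 := (((hasDerivAt_id' t).mul_const s).const_sub 1).inv h2.ne'
      refine ((h3.const_mul s).congr_deriv ?_).hasDerivWithinAt
      field_simp

theorem isParabolicCycle_equator : (modelField M N).IsParabolicCycle equator :=
  ⟨isCycle_equator M N, modelSection M N, returnMap, 1 / 4, isPoincareMap_returnMap M N,
    deriv_returnMap_zero, by rw [deriv_two_returnMap_zero]; norm_num⟩

theorem isClassPC_model : (modelField M N).IsClassPC equator where
  parabolic := isParabolicCycle_equator M N
  hyperbolic_points _ := isHyperbolicPoint_model M N
  hyperbolic_cycles _ h hne := absurd (cycle_eq_equator M N h) hne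
  no_saddle_connection := not_hasSaddleConnection M N

end Return

/-! ### Separatrices that wind towards the equator -/

theorem isometry_turn : Isometry turn := by
  refine Isometry.of_dist_eq fun p q => ?_
  rw [EuclideanSpace.dist_eq, EuclideanSpace.dist_eq, Fin.sum_univ_three, Fin.sum_univ_three]
  simp [turn]

theorem turn_image_equator : turn '' equator = equator := by
  ext p
  constructor
  · rintro ⟨q, hq, rfl⟩
    exact turn_mem_equator.2 hq
  · exact fun hp => ⟨turn p, turn_mem_equator.2 hp, turn_turn p⟩

theorem infDist_turn_equator (p : E3) :
    Metric.infDist (turn p) equator = Metric.infDist p equator := by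
  have := Metric.infDist_image isometry_turn (x := p) (t := equator)
  rwa [turn_image_equator] at this

theorem windsToward_turn {c : ℝ → E3} (h : SphereField.WindsToward c equator) :
    SphereField.WindsToward (fun t => turn (c (-t))) equator := by
  obtain ⟨h1, h2⟩ := h
  refine ⟨?_, ?_⟩
  · rw [Set.disjoint_left] at h1 ⊢
    rintro _ ⟨t, rfl⟩ ht
    exact h1 ⟨-t, rfl⟩ (turn_mem_equator.1 ht)
  · simp only [infDist_turn_equator]
    rcases h2 with h2 | h2
    · exact Or.inr (h2.comp tendsto_neg_atBot_atTop)
    · exact Or.inl (h2.comp tendsto_neg_atTop_atBot)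

theorem infDist_flowPt_le (q : ℝ × ℝ) : Metric.infDist (flowPt q) equator ≤ 2 * height q.2 := by
  have hz := height_mem q.2
  have hpos := one_sub_height_sq_pos q.2
  have hmem : equatorPt (q.1 - 1 / height q.2) ∈ equator := by
    rw [← range_equatorPt]; exact mem_range_self _
  refine (Metric.infDist_le_dist_of_mem hmem).trans ?_
  have hr := Real.sq_sqrt hpos.le
  have hr0 := Real.sqrt_nonneg (1 - height q.2 ^ 2)
  have hsc := Real.cos_sq_add_sin_sq (2 * Real.pi * (q.1 - 1 / height q.2))
  rw [EuclideanSpace.dist_eq, Fin.sum_univ_three]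
  refine Real.sqrt_le_iff.2 ⟨by linarith [hz.1], ?_⟩
  simp only [Real.dist_eq, sq_abs, flowPt, equatorPt, pt_zero, pt_one, pt_two]
  set r := √(1 - height q.2 ^ 2)
  set z := height q.2
  have hr1 : r ≤ 1 := by nlinarith
  have e : (r * Real.cos (2 * Real.pi * (q.1 - 1 / z)) - Real.cos (2 * Real.pi * (q.1 - 1 / z))) ^ 2 +
      (r * Real.sin (2 * Real.pi * (q.1 - 1 / z)) - Real.sin (2 * Real.pi * (q.1 - 1 / z))) ^ 2 +
      (z - 0) ^ 2 = (r - 1) ^ 2 + z ^ 2 := by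
    linear_combination (r - 1) ^ 2 * hsc
  rw [e]
  nlinarith

section Winding

variable (M N : PlanarModel)

theorem onWindingSeparatrix_turn {p x : E3}
    (h : (modelField M N).OnWindingSeparatrix equator p x) :
    (modelField N M).OnWindingSeparatrix equator (turn p) (turn x) := by
  obtain ⟨c, hc, hw, t, rfl⟩ := h
  exact ⟨_, (modelField_turn M N).isSeparatrix hc, windsToward_turn hw, -t, by simp⟩

theorem onWindingSeparatrix_turn_iff {p x : E3} :
    (modelField N M).OnWindingSeparatrix equator (turn p) (turn x) ↔
      (modelField M N).OnWindingSeparatrix equator p x :=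
  ⟨fun h => by simpa using onWindingSeparatrix_turn N M h, onWindingSeparatrix_turn M N⟩

/-- Along the vertical line the height tends to zero in negative time, so the separatrix that enters
along this line winds towards the equator. -/
theorem onWindingSeparatrix_of_label {s : ℝ} (hs : s ∈ Ioc (0 : ℝ) (1 / 2)) {i : M.ι}
    (hi : Int.fract (1 / s) ∈ M.label i) :
    (modelField M N).OnWindingSeparatrix equator (flowPt (M.saddle i)) (meridian s) := by
  obtain ⟨ψ, hψ, hv, hlim⟩ := M.entering i _ hi
  have hstrip := M.strip_invariant hψ (s := 0)
    (by rw [hv 0 le_rfl]; exact ⟨Int.fract_nonneg _, Int.fract_lt_one _⟩)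
  have hsol := isSolution_flowPt M N hψ hstrip
  have hneg := heightTime_neg hs.1 hs.2
  refine ⟨fun t => flowPt (ψ t), Or.inl ⟨hsol, fun t ht => ?_,
    (flowPt_continuous.tendsto _).comp hlim⟩, ⟨?_, Or.inr ?_⟩, heightTime s, ?_⟩
  · have h0 : (modelField M N).toFun (flowPt (ψ t)) = 0 := by
      rw [show flowPt (ψ t) = flowPt (M.saddle i) from ht]
      exact (isSingularPoint_flowPt M N (M.saddle_singular i).1 (M.saddle_singular i).2).2
    have h1 := (hsol.const h0 0).trans (hsol.const h0 (-1)).symm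
    simp only [hv 0 le_rfl, hv (-1) (by norm_num)] at h1
    have h2 : height 0 = height (-1) := congrArg (fun p : E3 => p 2) h1
    have := height_strictMono.injective h2
    norm_num at this
  · rw [Set.disjoint_left]
    rintro _ ⟨t, rfl⟩ ht
    exact (height_mem (ψ t).2).1.ne' ht.2
  · have h1 : Tendsto (fun t => 2 * height t) atBot (𝓝 0) := by
      simpa using height_tendsto_atBot.const_mul 2
    refine squeeze_zero' (Eventually.of_forall fun t => Metric.infDist_nonneg) ?_ h1
    filter_upwards [eventually_le_atBot 0] with t ht
    rw [hv t ht]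
    exact infDist_flowPt_le _
  · simp only [hv _ hneg.le]
    exact (meridian_eq_flowPt hs).symm

/-- For a stable separatrix this is `label_unique`. An unstable one cannot pass through the section:
backwards, every orbit from there tends to height zero, where there are no saddles. -/
theorem label_of_onWindingSeparatrix {s : ℝ} (hs : s ∈ Ioc (0 : ℝ) (1 / 2)) {p : E3}
    (hp : (modelField M N).IsSaddle p)
    (h : (modelField M N).OnWindingSeparatrix equator p (meridian s)) :
    ∃ i, p = flowPt (M.saddle i) ∧ Int.fract (1 / s) ∈ M.label i := by
  obtain ⟨c, hc, -, t₀, ht₀⟩ := h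
  have hsol : (modelField M N).IsSolution c := hc.elim (fun h => h.1) fun h => h.1
  have hheight : c t₀ 2 = s := by rw [ht₀]; rfl
  have h0 : 0 < c t₀ 2 := by rw [hheight]; exact hs.1
  have h1 : c t₀ 2 < 1 := by rw [hheight]; linarith [hs.2]
  have hneg := heightTime_neg hs.1 hs.2
  have ha : Int.fract (1 / s) ∈ Ico (0 : ℝ) 1 := ⟨Int.fract_nonneg _, Int.fract_lt_one _⟩
  rcases hc with ⟨-, -, hlim⟩ | ⟨-, -, hlim⟩
  · obtain ⟨i, rfl⟩ := saddle_of_limit M N hp (upper_invariant M N hsol h0) hlim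
    refine ⟨i, rfl, ?_⟩
    obtain ⟨ψ, hψ, hstrip, hcψ⟩ := exists_planar_of_upper M N hsol h0 h1
    have h2 : ψ t₀ = (Int.fract (1 / s), heightTime s) := by
      refine flowPt_injective (hstrip t₀) ha ?_
      rw [← hcψ, ht₀, meridian_eq_flowPt hs]
    rw [funext hcψ] at hlim
    have h3 := M.label_unique i ψ hψ (tendsto_of_tendsto_flowPt hstrip (saddle_mem M i) hlim) t₀
      (by rw [h2]; exact hneg.le)
    rwa [h2] at h3
  · exfalso
    obtain ⟨d, hd, hv⟩ := exists_vertical_solution M N ha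
    have h2 : c t₀ = d (heightTime s) := by rw [ht₀, meridian_eq_flowPt hs, hv _ hneg.le]
    have h3 : Tendsto (fun t => d (t + (heightTime s - t₀)) 2) atBot (𝓝 0) := by
      refine Tendsto.congr' ?_ (height_tendsto_atBot.comp
        (tendsto_atBot_add_const_right atBot (heightTime s - t₀) tendsto_id))
      filter_upwards [eventually_le_atBot (-(heightTime s - t₀))] with t ht
      rw [hv _ (by linarith)]
      rfl
    have h4 := ((contDiff_coord 2).continuous.tendsto p).comp hlim
    refine singular_height_ne_zero M N hp.1 (tendsto_nhds_unique h4 (h3.congr fun t => ?_))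
    rw [Function.comp_apply, hsol.eq_shift hd h2]

/-- A planar model may list a saddle under several indices; the label set depends only on the point.
-/
theorem label_subset_of_saddle_eq {i j : M.ι} (h : M.saddle i = M.saddle j) :
    M.label j ⊆ M.label i := by
  intro a ha
  obtain ⟨ψ, hψ, hv, hlim⟩ := M.entering j a ha
  have h1 := M.label_unique i ψ hψ (by rwa [h]) 0 (by rw [hv 0 le_rfl])
  rwa [hv 0 le_rfl] at h1

theorem common_saddle_upper {s s' : ℝ} (hs : s ∈ Ioc (0 : ℝ) (1 / 2))
    (hs' : s' ∈ Ioc (0 : ℝ) (1 / 2)) :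
    (∃ p, (modelField M N).IsSaddle p ∧
      (modelField M N).OnWindingSeparatrix equator p (meridian s) ∧
      (modelField M N).OnWindingSeparatrix equator p (meridian s')) ↔
      ∃ i, Int.fract (1 / s) ∈ M.label i ∧ Int.fract (1 / s') ∈ M.label i := by
  constructor
  · rintro ⟨p, hp, h, h'⟩
    obtain ⟨i, rfl, hi⟩ := label_of_onWindingSeparatrix M N hs hp h
    obtain ⟨j, hij, hj⟩ := label_of_onWindingSeparatrix M N hs' hp h'
    have := flowPt_injective (Ioo_subset_Ico_self (saddle_mem M i))
      (Ioo_subset_Ico_self (saddle_mem M j)) hij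
    exact ⟨i, hi, label_subset_of_saddle_eq M this hj⟩
  · rintro ⟨i, hi, hi'⟩
    exact ⟨_, (isSaddle_upper M N (height_mem _).1).2 ⟨i, rfl⟩,
      onWindingSeparatrix_of_label M N hs hi, onWindingSeparatrix_of_label M N hs' hi'⟩

theorem common_saddle_lower {s s' : ℝ} (hs : -s ∈ Ioc (0 : ℝ) (1 / 2))
    (hs' : -s' ∈ Ioc (0 : ℝ) (1 / 2)) :
    (∃ p, (modelField M N).IsSaddle p ∧
      (modelField M N).OnWindingSeparatrix equator p (meridian s) ∧
      (modelField M N).OnWindingSeparatrix equator p (meridian s')) ↔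
      ∃ i, Int.fract (1 / -s) ∈ N.label i ∧ Int.fract (1 / -s') ∈ N.label i := by
  rw [← common_saddle_upper N M hs hs', ← turn_meridian, ← turn_meridian]
  constructor
  · rintro ⟨p, hp, h, h'⟩
    exact ⟨turn p, isSaddle_turn M N hp, onWindingSeparatrix_turn M N h,
      onWindingSeparatrix_turn M N h'⟩
  · rintro ⟨p, hp, h, h'⟩
    rw [← turn_turn p] at hp h h'
    exact ⟨turn p, (isSaddle_turn_iff M N).1 hp, (onWindingSeparatrix_turn_iff M N).1 h,
      (onWindingSeparatrix_turn_iff M N).1 h'⟩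

end Winding

/-! ### Marked sets and planar models -/

theorem coe_injOn_Ico : InjOn (fun x : ℝ => (x : UnitAddCircle)) (Ico 0 1) := fun x hx y hy h =>
  (AddCircle.coe_eq_coe_iff_of_mem_Ico (p := (1 : ℝ)) (a := 0) (by simpa using hx)
    (by simpa using hy)).1 h

theorem exists_coe_notMem (A : Finset UnitAddCircle) :
    ∃ c ∈ Ico (0 : ℝ) 1, (c : UnitAddCircle) ∉ A := by
  have h := ((Ico_infinite (zero_lt_one' ℝ)).image coe_injOn_Ico).exists_notMem_finset A
  obtain ⟨_, ⟨c, hc, rfl⟩, h⟩ := h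
  exact ⟨c, hc, h⟩

theorem exists_coe_eq (a : UnitAddCircle) : ∃ x ∈ Ico (0 : ℝ) 1, (x : UnitAddCircle) = a := by
  have h : a ∈ (fun x : ℝ => (x : AddCircle (1 : ℝ))) '' Ico 0 (0 + 1) := by
    rw [AddCircle.coe_image_Ico_eq]; trivial
  obtain ⟨x, hx, rfl⟩ := h
  exact ⟨x, by simpa using hx, rfl⟩

theorem sbtw_coe_iff {p q r : ℝ} :
    sbtw (p : UnitAddCircle) q r ↔
      toIocMod (zero_lt_one' ℝ) 0 (p - r) < toIcoMod (zero_lt_one' ℝ) 0 (q - r) := by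
  rw [sbtw_iff_not_btw, ← not_le]
  exact Iff.rfl

theorem toIocMod_of_mem_Ioo {w : ℝ} (h : w ∈ Ioo (-1 : ℝ) 0) :
    toIocMod (zero_lt_one' ℝ) 0 w = w + 1 :=
  (toIocMod_eq_iff _).2 ⟨⟨by linarith [h.1], by linarith [h.2]⟩, -1, by simp⟩

theorem toIcoMod_of_mem_Ico {w : ℝ} (h : w ∈ Ico (0 : ℝ) 1) :
    toIcoMod (zero_lt_one' ℝ) 0 w = w :=
  (toIcoMod_eq_iff _).2 ⟨⟨h.1, by linarith [h.2]⟩, 0, by simp⟩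

theorem toIcoMod_of_mem_Ioo {w : ℝ} (h : w ∈ Ioo (-1 : ℝ) 0) :
    toIcoMod (zero_lt_one' ℝ) 0 w = w + 1 :=
  (toIcoMod_eq_iff _).2 ⟨⟨by linarith [h.1], by linarith [h.2]⟩, -1, by simp⟩

/-- For points of `(0, 1)` the arc from `x` to `y` does not pass the cut, so cyclic betweenness is
the linear one. -/
theorem sbtw_coe_sub_right {x y u : ℝ} (hx : 0 < x) (hy : y < 1) (hxy : x < y)
    (hu : u ∈ Ioo (0 : ℝ) 1) (c : ℝ) :
    sbtw ((x - c : ℝ) : UnitAddCircle) (u - c : ℝ) (y - c : ℝ) ↔ x < u ∧ u < y := by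
  rw [sbtw_coe_iff, sub_sub_sub_cancel_right, sub_sub_sub_cancel_right,
    toIocMod_of_mem_Ioo ⟨by linarith, by linarith⟩]
  rcases lt_or_ge u y with h | h
  · rw [toIcoMod_of_mem_Ioo ⟨by linarith [hu.1], by linarith⟩]
    exact ⟨fun h1 => ⟨by linarith, h⟩, fun h1 => by linarith [h1.1]⟩
  · rw [toIcoMod_of_mem_Ico ⟨by linarith, by linarith [hu.2]⟩]
    exact ⟨fun h1 => by linarith [hu.2], fun h1 => by linarith [h1.2]⟩

/-- The reflection `x ↦ c - x` reverses the orientation, so the end points change places. -/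
theorem sbtw_coe_sub_left {x y u : ℝ} (hx : 0 < x) (hy : y < 1) (hxy : x < y)
    (hu : u ∈ Ioo (0 : ℝ) 1) (c : ℝ) :
    sbtw ((c - y : ℝ) : UnitAddCircle) (c - u : ℝ) (c - x : ℝ) ↔ x < u ∧ u < y := by
  rw [sbtw_coe_iff, sub_sub_sub_cancel_left, sub_sub_sub_cancel_left,
    toIocMod_of_mem_Ioo ⟨by linarith, by linarith⟩]
  rcases lt_or_ge x u with h | h
  · rw [toIcoMod_of_mem_Ioo ⟨by linarith [hu.2], by linarith⟩]
    exact ⟨fun h1 => ⟨h, by linarith⟩, fun h1 => by linarith [h1.2]⟩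
  · rw [toIcoMod_of_mem_Ico ⟨by linarith, by linarith [hu.1]⟩]
    exact ⟨fun h1 => by linarith [hu.1], fun h1 => by linarith [h1.1]⟩

namespace MarkedSet

variable (A : MarkedSet)

/-- The relation of a marked set, as a relation on the circle. -/
def Rel (a b : UnitAddCircle) : Prop := ∃ ha hb, A.rel ⟨a, ha⟩ ⟨b, hb⟩

variable {A}

theorem rel_iff (a b : A.carrier) : A.rel a b ↔ A.Rel a b :=
  ⟨fun h => ⟨a.2, b.2, h⟩, fun ⟨_, _, h⟩ => h⟩

theorem Rel.symm {a b : UnitAddCircle} (h : A.Rel a b) : A.Rel b a :=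
  let ⟨ha, hb, h⟩ := h
  ⟨hb, ha, A.rel.symm h⟩

theorem Rel.trans {a b c : UnitAddCircle} (h : A.Rel a b) (h' : A.Rel b c) : A.Rel a c :=
  let ⟨ha, _, h⟩ := h
  let ⟨_, hc, h'⟩ := h'
  ⟨ha, hc, A.rel.trans h h'⟩

theorem rel_self {a : UnitAddCircle} : A.Rel a a ↔ a ∈ A.carrier :=
  ⟨fun h => h.1, fun h => ⟨h, h, A.rel.refl _⟩⟩

theorem Rel.card {a b c : UnitAddCircle} (h : A.Rel a b) (h' : A.Rel a c) :
    a = b ∨ a = c ∨ b = c := by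
  obtain ⟨ha, hb, h⟩ := h
  obtain ⟨_, hc, h'⟩ := h'
  by_contra! hne
  have h3 := A.card_class_le ⟨a, ha⟩
  have h4 : 2 < {x | A.rel ⟨a, ha⟩ x}.ncard := (Set.two_lt_ncard_iff (toFinite _)).2
    ⟨_, _, _, A.rel.refl _, h, h', fun h => hne.1 (congrArg Subtype.val h),
      fun h => hne.2.1 (congrArg Subtype.val h), fun h => hne.2.2 (congrArg Subtype.val h)⟩
  omega

theorem Rel.sbtw_iff {a b c d : UnitAddCircle} (h : A.Rel a b) (hab : a ≠ b) (h' : A.Rel c d)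
    (hcd : c ≠ d) (hac : ¬ A.Rel a c) : sbtw a c b ↔ sbtw a d b := by
  obtain ⟨ha, hb, h⟩ := h
  obtain ⟨hc, hd, h'⟩ := h'
  exact A.not_intermingled ⟨a, ha⟩ ⟨b, hb⟩ ⟨c, hc⟩ ⟨d, hd⟩ h (fun h => hab (congrArg Subtype.val h))
    h' (fun h => hcd (congrArg Subtype.val h)) fun h => hac ⟨ha, hc, h⟩

/-- A marked set is realized by a planar model, through any coordinate on the circle which sends
the origin outside of the set. -/
theorem exists_planarModel (A : MarkedSet) {e : ℝ → UnitAddCircle} {c : ℝ}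
    (he : (∀ x : ℝ, e x = (x - c : ℝ)) ∨ ∀ x : ℝ, e x = (c - x : ℝ)) (h0 : e 0 ∉ A.carrier) :
    ∃ M : PlanarModel, (∀ i, ∀ x ∈ M.label i, ∀ y ∈ M.label i, A.Rel (e x) (e y)) ∧
      ∀ x ∈ Ico (0 : ℝ) 1, ∀ y ∈ Ico (0 : ℝ) 1, A.Rel (e x) (e y) →
        ∃ i, x ∈ M.label i ∧ y ∈ M.label i := by
  have hinj : InjOn e (Ico 0 1) := by
    intro x hx y hy hxy
    apply coe_injOn_Ico hx hy
    rcases he with he | he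
    · rw [he, he, AddCircle.coe_sub, AddCircle.coe_sub] at hxy
      exact sub_left_injective hxy
    · rw [he, he, AddCircle.coe_sub, AddCircle.coe_sub] at hxy
      exact sub_right_injective hxy
  have hfin : {x : ℝ | x ∈ Ioo (0 : ℝ) 1 ∧ e x ∈ A.carrier}.Finite := by
    refine Set.Finite.of_finite_image (f := e) (A.carrier.finite_toSet.subset ?_)
      (hinj.mono fun x hx => Ioo_subset_Ico_self hx.1)
    rintro _ ⟨x, hx, rfl⟩
    exact hx.2
  set F := hfin.toFinset
  have hF : ∀ {x}, x ∈ F ↔ x ∈ Ioo (0 : ℝ) 1 ∧ e x ∈ A.carrier := fun {x} => hfin.mem_toFinset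
  have hFI : ∀ {x}, x ∈ F → x ∈ Ico (0 : ℝ) 1 := fun h => Ioo_subset_Ico_self (hF.1 h).1
  -- In the coordinate `e`, arcs between points of the set become intervals of `(0, 1)`, and the
  -- cyclic condition becomes non-crossing of intervals. For a reflected coordinate the arc is taken
  -- from `e y` to `e x`.
  have hsb : ∀ x ∈ F, ∀ y ∈ F, ∀ u ∈ F, ∀ v ∈ F, A.Rel (e x) (e y) → A.Rel (e u) (e v) → u ≠ v →
      ¬ A.Rel (e x) (e u) → x < u → u < y → x < v ∧ v < y := by
    intro x hx y hy u hu v hv hxy huv hne hnot hxu huy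
    have hxy' : x < y := hxu.trans huy
    have h1 : e x ≠ e y := fun h => hxy'.ne (hinj (hFI hx) (hFI hy) h)
    have h2 : e u ≠ e v := fun h => hne (hinj (hFI hu) (hFI hv) h)
    have bx := (hF.1 hx).1.1
    have by1 := (hF.1 hy).1.2
    rcases he with he | he
    · have h3 := hxy.sbtw_iff h1 huv h2 hnot
      simp only [he] at h3
      rw [sbtw_coe_sub_right bx by1 hxy' (hF.1 hu).1, sbtw_coe_sub_right bx by1 hxy' (hF.1 hv).1] at h3
      exact h3.1 ⟨hxu, huy⟩
    · have h3 := hxy.symm.sbtw_iff h1.symm huv h2 fun h => hnot (hxy.trans h)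
      simp only [he] at h3
      rw [sbtw_coe_sub_left bx by1 hxy' (hF.1 hu).1, sbtw_coe_sub_left bx by1 hxy' (hF.1 hv).1] at h3
      exact h3.1 ⟨hxu, huy⟩
  obtain ⟨M, -, h2, h3⟩ := _root_.exists_planarModel F (fun x hx => (hF.1 hx).1)
    (fun x y => A.Rel (e x) (e y)) (fun x hx => rel_self.2 (hF.1 hx).2)
    (fun x _ y _ h => h.symm) (fun x _ y _ z _ h h' => h.trans h')
    (fun x hx y hy z hz h h' => by
      rcases h.card h' with h | h | h
      · exact Or.inl (hinj (hFI hx) (hFI hy) h)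
      · exact Or.inr (Or.inl (hinj (hFI hx) (hFI hz) h))
      · exact Or.inr (Or.inr (hinj (hFI hy) (hFI hz) h))) hsb
  have hmem : ∀ x ∈ Ico (0 : ℝ) 1, e x ∈ A.carrier → x ∈ F := by
    intro x hx h
    refine hF.2 ⟨⟨lt_of_le_of_ne hx.1 ?_, hx.2⟩, h⟩
    rintro rfl
    exact h0 h
  exact ⟨M, h2, fun x hx y hy h => h3 x (hmem x hx h.1) y (hmem y hy h.2.1) h⟩

end MarkedSet

/-! ### Characteristic sets -/

theorem timeFunction_sq {b s : ℝ} (h : (0 : ℝ) ∉ uIcc b s) :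
    SphereField.timeFunction (fun x => x ^ 2) b s = 1 / b - 1 / s := by
  have hne : ∀ x ∈ uIcc b s, x ≠ 0 := fun x hx h0 => h (h0 ▸ hx)
  have h1 : ∀ x ∈ uIcc b s, HasDerivAt (fun x : ℝ => -x⁻¹) (1 / x ^ 2) x := by
    intro x hx
    refine (hasDerivAt_inv (hne x hx)).neg.congr_deriv ?_
    rw [one_div, neg_neg]
  rw [SphereField.timeFunction, intervalIntegral.integral_eq_sub_of_hasDerivAt h1]
  · rw [one_div, one_div]; ring
  · refine ContinuousOn.intervalIntegrable fun x hx => ?_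
    exact (continuousAt_const.div (continuousAt_id.pow 2)
      (pow_ne_zero 2 (hne x hx))).continuousWithinAt

theorem coe_add_nat_sub_fract (c x : ℝ) (n : ℕ) :
    ((n + c - x : ℝ) : UnitAddCircle) = ((c - Int.fract x : ℝ) : UnitAddCircle) := by
  have h : (n + c - x : ℝ) = (c - Int.fract x) + ((n : ℤ) - ⌊x⌋ : ℤ) := by
    rw [Int.fract]; push_cast; ring
  rw [h, AddCircle.coe_add, add_eq_left, AddCircle.coe_eq_zero_iff]
  exact ⟨_, zsmul_one _⟩

/-- The characteristic set is determined by the labels of the separatrices. -/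
theorem isCharacteristicSet_of_labels {V : SphereField} {γ : Set E3} {S : V.CrossSection γ}
    {P u : ℝ → ℝ} {b : ℝ} {A : MarkedSet} {M : PlanarModel} {e : ℝ → UnitAddCircle} {lab : ℝ → ℝ}
    (hM : ∀ i, ∀ x ∈ M.label i, ∀ y ∈ M.label i, A.Rel (e x) (e y))
    (hA : ∀ x ∈ Ico (0 : ℝ) 1, ∀ y ∈ Ico (0 : ℝ) 1, A.Rel (e x) (e y) →
        ∃ i, x ∈ M.label i ∧ y ∈ M.label i)
    (he : ∀ a, ∃ x ∈ Ico (0 : ℝ) 1, e x = a)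
    (hlab : ∀ x ∈ Ico (0 : ℝ) 1, ∃ s ∈ Ico b (P b), lab s = x)
    (hT : ∀ s ∈ Ico b (P b), (SphereField.timeFunction u b s : UnitAddCircle) = e (lab s))
    (hW : ∀ s ∈ Ico b (P b), ∀ s' ∈ Ico b (P b), (∃ p, V.IsSaddle p ∧
      V.OnWindingSeparatrix γ p (S.σ s) ∧ V.OnWindingSeparatrix γ p (S.σ s')) ↔
        ∃ i, lab s ∈ M.label i ∧ lab s' ∈ M.label i) :
    SphereField.IsCharacteristicSet S P u b A := by
  have hwind : ∀ s, s ∈ SphereField.windingPoints S P b ↔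
      s ∈ Ico b (P b) ∧ ∃ i, lab s ∈ M.label i := by
    intro s
    refine and_congr_right fun hs => ?_
    have h := hW s hs s hs
    simpa only [and_self] using h
  constructor
  · ext a
    constructor
    · intro ha
      obtain ⟨x, hx, rfl⟩ := he a
      obtain ⟨i, hi, -⟩ := hA x hx x hx (MarkedSet.rel_self.2 ha)
      obtain ⟨s, hs, rfl⟩ := hlab x hx
      exact ⟨s, (hwind s).2 ⟨hs, i, hi⟩, hT s hs⟩
    · rintro ⟨s, hs, rfl⟩
      obtain ⟨hs, i, hi⟩ := (hwind s).1 hs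
      simp only [hT s hs]
      exact (hM i _ hi _ hi).1
  · intro a a'
    rw [MarkedSet.rel_iff]
    constructor
    · intro h
      obtain ⟨x, hx, hxa⟩ := he a
      obtain ⟨y, hy, hya⟩ := he a'
      rw [← hxa, ← hya] at h ⊢
      obtain ⟨i, hi, hi'⟩ := hA x hx y hy h
      obtain ⟨s, hs, rfl⟩ := hlab x hx
      obtain ⟨s', hs', rfl⟩ := hlab y hy
      exact ⟨s, (hwind s).2 ⟨hs, i, hi⟩, s', (hwind s').2 ⟨hs', i, hi'⟩, hT s hs, hT s' hs',
        (hW s hs s' hs').2 ⟨i, hi, hi'⟩⟩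
    · rintro ⟨s, hs, s', hs', h1, h2, h3⟩
      have hs := hs.1
      have hs' := hs'.1
      obtain ⟨i, hi, hi'⟩ := (hW s hs s' hs').1 h3
      rw [← h1, ← h2, hT s hs, hT s' hs']
      exact hM i _ hi _ hi'

section Pair

variable {M N : PlanarModel} {A : MarkedSet} {c : ℝ}

/-- The time function is `5 + c - 1 / s`, congruent to `c` minus the label, and `1 / s` runs over
the full period `(4 + c, 5 + c]`. The integer `5` makes the base point smaller than `1/4`, also for
`c = 0`. -/
theorem isCharacteristicSet_upper (hc : c ∈ Ico (0 : ℝ) 1)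
    (hM : ∀ i, ∀ x ∈ M.label i, ∀ y ∈ M.label i, A.Rel (c - x : ℝ) (c - y : ℝ))
    (hA : ∀ x ∈ Ico (0 : ℝ) 1, ∀ y ∈ Ico (0 : ℝ) 1, A.Rel (c - x : ℝ) (c - y : ℝ) →
        ∃ i, x ∈ M.label i ∧ y ∈ M.label i) :
    SphereField.IsCharacteristicSet (modelSection M N) returnMap (fun x => x ^ 2) (1 / (5 + c)) A := by
  have hc0 := hc.1
  have h5 : 0 < 5 + c := by linarith
  have h4 : 0 < 4 + c := by linarith
  have hb : returnMap (1 / (5 + c)) = 1 / (4 + c) := by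
    have : 1 - 1 / (5 + c) = (4 + c) / (5 + c) := by field_simp; ring
    rw [returnMap, this]; field_simp
  have hb0 : 0 < 1 / (5 + c) := by positivity
  have hmem : ∀ s ∈ Ico (1 / (5 + c)) (returnMap (1 / (5 + c))), s ∈ Ioc (0 : ℝ) (1 / 2) := by
    intro s hs
    rw [hb] at hs
    refine ⟨hb0.trans_le hs.1, hs.2.le.trans ?_⟩
    rw [div_le_div_iff₀ h4 two_pos]
    linarith
  refine isCharacteristicSet_of_labels (M := M) (e := fun x => ((c - x : ℝ) : UnitAddCircle))
    (lab := fun s => Int.fract (1 / s)) hM hA ?_ ?_ ?_ ?_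
  · intro a
    obtain ⟨x, hx, hxa⟩ := exists_coe_eq ((c : UnitAddCircle) - a)
    exact ⟨x, hx, by rw [AddCircle.coe_sub, hxa, sub_sub_cancel]⟩
  · intro x hx
    -- The period is closed on the right, so `x = c` is represented by `n = 5`, that is, by the base
    -- point itself.
    obtain ⟨n, hn0, hn1⟩ : ∃ n : ℕ, 4 + c < n + x ∧ n + x ≤ 5 + c := by
      rcases le_or_gt x c with h | h
      · exact ⟨5, by push_cast; linarith [hx.1, hc.2], by push_cast; linarith⟩
      · exact ⟨4, by push_cast; linarith, by push_cast; linarith [hx.2]⟩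
    have hpos : (0 : ℝ) < n + x := h4.trans hn0
    refine ⟨1 / (n + x), ⟨one_div_le_one_div_of_le hpos hn1, ?_⟩, ?_⟩
    · rw [hb]
      exact one_div_lt_one_div_of_lt h4 hn0
    · simp only [one_div_one_div]
      rw [Int.fract_natCast_add, Int.fract_eq_self.2 hx]
  · intro s hs
    rw [timeFunction_sq, one_div_one_div]
    · exact coe_add_nat_sub_fract c (1 / s) 5
    · rw [uIcc_of_le hs.1]
      exact fun h => absurd h.1 (not_le.2 hb0)
  · intro s hs s' hs'
    exact common_saddle_upper M N (hmem s hs) (hmem s' hs')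

/-- On this side the time function is `1 / -s - (5 + c)`, congruent to the label minus `c`, so the
orientation is opposite to that of the upper side. -/
theorem isCharacteristicSet_lower (hc : c ∈ Ico (0 : ℝ) 1)
    (hN : ∀ i, ∀ x ∈ N.label i, ∀ y ∈ N.label i, A.Rel (x - c : ℝ) (y - c : ℝ))
    (hA : ∀ x ∈ Ico (0 : ℝ) 1, ∀ y ∈ Ico (0 : ℝ) 1, A.Rel (x - c : ℝ) (y - c : ℝ) →
        ∃ i, x ∈ N.label i ∧ y ∈ N.label i) :
    SphereField.IsCharacteristicSet (modelSection M N) returnMap (fun x => x ^ 2)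
      (-(1 / (5 + c))) A := by
  have hc0 := hc.1
  have h5 : 0 < 5 + c := by linarith
  have h6 : 0 < 6 + c := by linarith
  have hb : returnMap (-(1 / (5 + c))) = -(1 / (6 + c)) := by
    have : 1 - -(1 / (5 + c)) = (6 + c) / (5 + c) := by field_simp; ring
    rw [returnMap, this]; field_simp
  have hmem : ∀ s ∈ Ico (-(1 / (5 + c))) (returnMap (-(1 / (5 + c)))),
      -s ∈ Ioc (0 : ℝ) (1 / 2) := by
    intro s hs
    rw [hb] at hs
    have h1 : 0 < 1 / (6 + c) := by positivity
    have h2 : 1 / (5 + c) ≤ 1 / 2 := by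
      rw [div_le_div_iff₀ h5 two_pos]
      linarith
    exact ⟨by linarith [hs.2], by linarith [hs.1]⟩
  refine isCharacteristicSet_of_labels (M := N) (e := fun x => ((x - c : ℝ) : UnitAddCircle))
    (lab := fun s => Int.fract (1 / -s)) hN hA ?_ ?_ ?_ ?_
  · intro a
    obtain ⟨x, hx, hxa⟩ := exists_coe_eq (a + (c : UnitAddCircle))
    exact ⟨x, hx, by rw [AddCircle.coe_sub, hxa, add_sub_cancel_right]⟩
  · intro x hx
    obtain ⟨n, hn0, hn1⟩ : ∃ n : ℕ, 5 + c ≤ n + x ∧ n + x < 6 + c := by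
      rcases lt_or_ge x c with h | h
      · exact ⟨6, by push_cast; linarith [hx.1, hc.2], by push_cast; linarith⟩
      · exact ⟨5, by push_cast; linarith, by push_cast; linarith [hx.2]⟩
    have hpos : (0 : ℝ) < n + x := h5.trans_le hn0
    refine ⟨-(1 / (n + x)), ⟨neg_le_neg (one_div_le_one_div_of_le h5 hn0), ?_⟩, ?_⟩
    · rw [hb]
      exact neg_lt_neg (one_div_lt_one_div_of_lt hpos hn1)
    · simp only [neg_neg, one_div_one_div]
      rw [Int.fract_natCast_add, Int.fract_eq_self.2 hx]
  · intro s hs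
    have hs0 := (hmem s hs).1
    rw [timeFunction_sq]
    · have h := congrArg Neg.neg (coe_add_nat_sub_fract c (1 / -s) 5)
      rw [← AddCircle.coe_neg, ← AddCircle.coe_neg, neg_sub, neg_sub] at h
      rw [← h]
      congr 1
      rw [one_div_neg_eq_neg_one_div, one_div_neg_eq_neg_one_div, one_div_one_div]
      push_cast
      ring
    · rw [uIcc_of_le hs.1]
      exact fun h => absurd h.2 (not_le.2 (by linarith))
  · intro s hs s' hs'
    exact common_saddle_lower M N (hmem s hs) (hmem s' hs')

end Pair

theorem theorem1p3 (Ap Am : MarkedSet)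
    (hsync : NonSynchronized (Ap.carrier : Set UnitAddCircle) (Am.carrier : Set UnitAddCircle)) :
    ∃ (V : SphereField) (γ : Set E3), V.IsClassPC γ ∧ V.IsCharacteristicPair γ Ap Am := by
  classical
  -- Each circle is cut outside its marked set: the label `0` goes to `c` on the upper side and to
  -- `-c'` on the lower one.
  obtain ⟨c, hc, hcA⟩ := exists_coe_notMem Ap.carrier
  obtain ⟨c', hc', hcA'⟩ := exists_coe_notMem (Am.carrier.image Neg.neg)
  obtain ⟨M, hM, hMA⟩ := Ap.exists_planarModel (e := fun x => ((c - x : ℝ) : UnitAddCircle))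
    (Or.inr fun _ => rfl) (by simpa using hcA)
  obtain ⟨N, hN, hNA⟩ := Am.exists_planarModel (e := fun x => ((x - c' : ℝ) : UnitAddCircle))
    (Or.inl fun _ => rfl) (fun h => hcA' (Finset.mem_image.2 ⟨_, h, by simp⟩))
  have hbound : ∀ {c : ℝ}, c ∈ Ico (0 : ℝ) 1 → 1 / (5 + c) ∈ Ioo (0 : ℝ) (1 / 4) := by
    intro c hc
    have h := hc.1
    exact ⟨by positivity, one_div_lt_one_div_of_lt (by norm_num) (by linarith)⟩
  have hb := hbound hc
  have hb' := hbound hc'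
  exact ⟨modelField M N, equator, isClassPC_model M N, modelSection M N, returnMap,
    fun x => x ^ 2, 1 / 4, 1 / (5 + c), -(1 / (5 + c')), isPoincareMap_returnMap M N,
    deriv_returnMap_zero, deriv_two_returnMap_zero, isGenerator_sq, hb,
    ⟨by linarith [hb'.2], by linarith [hb'.1]⟩, isCharacteristicSet_upper hc hM hMA,
    isCharacteristicSet_lower hc' hN hNA⟩
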